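/- Let $f$ be a meromorphic function in the plane $\mathbf{C}$ that is a local homeomorphism into the Riemann sphere $\overline{\mathbf{C}}=\mathbf{C}\cup\{\infty\}$, that is, all poles of $f$ are simple and $f'(z)\neq 0$ at every $z$ that is not a pole. Let $$u=\log\frac{2|f'|}{1+|f|^2}$$ (extended continuously to the poles of $f$), let $\sigma$ be the metric on $\mathbf{C}$ with line element $e^{u}|dz|$, i.e. the pull-back by $f$ of the standard metric of the unit sphere, and let $\operatorname{diam}(\mathbf{C},\sigma)\in[0,\infty]$ be the supremum of the $\sigma$-distances between two points of $\mathbf{C}$, the $\sigma$-distance being the infimum of the $\sigma$-lengths of the curves joining the points. A singularity of $f^{-1}$ over a point $a\in\overline{\mathbf{C}}$ is a function $V$ that assigns to every open simply connected neighborhood $\Omega$ of $a$ in $\overline{\mathbf{C}}$ a connected component $V(\Omega)$ of $f^{-1}(\Omega)$ such that $\Omega_1\subset\Omega_2$ implies $V(\Omega_1)\subset V(\Omega_2)$, and $\bigcap_{\Omega}V(\Omega)=\emptyset$. The sets $V(\Omega)$ are called the neighborhoods of the singularity. A singularity is isolated if it has a neighborhood that is not a neighborhood of any other singularity. Then: 1.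 $\operatorname{diam}(\mathbf{C},\sigma)\ge 4\pi/3$, unless $f$ is linear-fractional or of the form $f(z)=L(e^{az+b})$ with $L$ a linear-fractional transformation and $a,b\in\mathbf{C}$, $a\neq 0$. 2. If $f^{-1}$ has a non-isolated singularity, then $\operatorname{diam}(\mathbf{C},\sigma)\ge 2\pi$. 3. If all singularities of $f^{-1}$ are isolated and there are at least three of them, then $\operatorname{diam}(\mathbf{C},\sigma)\ge 4\pi/3$. -/

import Mathlib

open Set
open scoped ENNReal

noncomputable section

/-- `f` is a meromorphic function on the plane which is a local homeomorphism into the Riemann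
sphere: all its poles are simple and its derivative vanishes nowhere. Meromorphic functions are
taken in normal form: `f` is analytic wherever it has no pole, and has the
conventional value `0` at its poles. -/
structure IsDevelopingMap (f : ℂ → ℂ) : Prop where
  meromorphic : MeromorphicNFOn f univ
  simple_poles : ∀ z, -1 ≤ meromorphicOrderAt f z
  deriv_ne_zero : ∀ z, 0 ≤ meromorphicOrderAt f z → deriv f z ≠ 0

/-- `f` is a linear-fractional transformation (restricted to the plane). -/
def IsLinearFractional (f : ℂ → ℂ) : Prop :=
  ∃ α β γ δ : ℂ, α * δ - β * γ ≠ 0 ∧ ∀ z, f z = (α * z + β) / (γ * z + δ)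

/-- `f(z) = L(exp(az + b))` with `L` linear-fractional and `a ≠ 0`. -/
def IsLinearFractionalExp (f : ℂ → ℂ) : Prop :=
  ∃ L : ℂ → ℂ, IsLinearFractional L ∧
    ∃ a b : ℂ, a ≠ 0 ∧ ∀ z, f z = L (Complex.exp (a * z + b))

open Classical in
/-- The density `e^u = 2|f'| / (1 + |f|^2)` of the pull-back of the spherical metric. At a pole it
is computed with `1/f` in place of `f`, which is its continuous extension. -/
def sphericalDensity (f : ℂ → ℂ) (z : ℂ) : ℝ :=
  if 0 ≤ meromorphicOrderAt f z then 2 * ‖deriv f z‖ / (1 + ‖f z‖ ^ 2)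
  else 2 * ‖deriv f⁻¹ z‖ / (1 + ‖f⁻¹ z‖ ^ 2)

/-- Length of the curve `γ : [0,1] → ℂ` with respect to the line element `e^u |dz|`. -/
def sphericalLength (f : ℂ → ℂ) (γ : ℝ → ℂ) : ℝ≥0∞ :=
  ∫⁻ t in Icc (0 : ℝ) 1,
    ENNReal.ofReal (sphericalDensity f (γ t) * ‖derivWithin γ (Icc 0 1) t‖)

/-- Distance in the plane with respect to the line element `e^u |dz|`: the infimum of the lengths
of the `C¹` curves from `z` to `w`. -/
def sphericalDist (f : ℂ → ℂ) (z w : ℂ) : ℝ≥0∞ :=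
  ⨅ (γ : ℝ → ℂ) (_ : ContDiffOn ℝ 1 γ (Icc 0 1)) (_ : γ 0 = z) (_ : γ 1 = w),
    sphericalLength f γ

/-- Diameter of the plane with respect to the line element `e^u |dz|`. -/
def sphericalDiam (f : ℂ → ℂ) : ℝ≥0∞ := ⨆ (z : ℂ) (w : ℂ), sphericalDist f z w

open Classical in
/-- The meromorphic function `f` as a map into the Riemann sphere. -/
def toSphere (f : ℂ → ℂ) (z : ℂ) : OnePoint ℂ :=
  if 0 ≤ meromorphicOrderAt f z then (f z : OnePoint ℂ) else OnePoint.infty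

/-- The open simply connected neighborhoods of a point `a` of the Riemann sphere. -/
def SimplyConnectedNhds (a : OnePoint ℂ) : Set (Set (OnePoint ℂ)) :=
  {Ω | IsOpen Ω ∧ a ∈ Ω ∧ IsSimplyConnected Ω}

/-- A (transcendental) singularity of the inverse of `f`: a choice, for every open simply connected
neighborhood `Ω` of a point of the sphere, of a connected component of the preimage of `Ω`,
which is monotone in `Ω` and such that these components have no common point. -/
structure InverseSingularity (f : ℂ → ℂ) where
  /-- the point over which the singularity lies -/
  base : OnePoint ℂ
  /-- the neighborhoods of the singularity -/
  V : SimplyConnectedNhds base → Set ℂ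
  isComponent : ∀ Ω, ∃ z ∈ toSphere f ⁻¹' Ω.1,
    V Ω = connectedComponentIn (toSphere f ⁻¹' Ω.1) z
  mono : ∀ Ω₁ Ω₂, Ω₁.1 ⊆ Ω₂.1 → V Ω₁ ⊆ V Ω₂
  iInter_eq_empty : ⋂ Ω, V Ω = ∅

/-- A singularity is isolated if it has a neighborhood which is not a neighborhood of any other
singularity. -/
def InverseSingularity.IsIsolated {f : ℂ → ℂ} (s : InverseSingularity f) : Prop :=
  ∃ Ω : SimplyConnectedNhds s.base, ∀ s' : InverseSingularity f, s' ≠ s →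
    ∀ Ω' : SimplyConnectedNhds s'.base, s'.V Ω' ≠ s.V Ω

end

/-!
A curve in the plane is mapped by `f` to a curve on the sphere which is at least as long as the
spherical distance of its end points. Hence, if the diameter is less than `d`, any two points of the
plane can be joined by a path which is short on the sphere (`Linked`,
`linked_of_sphericalDiam_lt`), and only this property of the metric is used. From then on `f` is
regarded as a locally univalent map `F` into the sphere (`LocUniv`), and one studies its sections
over regions `Ω` of the sphere (`IsSec`), that is, branches of the inverse. A boundary point of `Ω`
is singular (`SingAt`) if the section does not extend to it.

The key estimate is `Linked.add_le`. Two singular points on the boundary of `Ω` cut this boundary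
into two pieces, and the image of the section then separates the plane: its complement splits into
two closed parts whose boundary values lie over the two pieces (`exists_separation`,
`IsSplit.exists_separation`). By a maximum principle in which the point at infinity is negligible
(`norm_le_of_frontier`) and by moving the pole, the values of `F` in each part come close to every
point off the corresponding piece (`LocUniv.subset_closure_image`). A path from one part to the
other has to cross both pieces, which gives a lower bound for `d` in terms of distances on the
sphere.

* If `Ω` is very small, the points which are almost antipodal to `Ω` show `d ≥ 2 π` approximately.
  So if `d < 2 π`, singular boundary points are locally unique (`Linked.exists_singUnique`). All
  points of a small neighbourhood of a singularity of the inverse then have the base of the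
  singularity as their singular boundary point, radial contraction to the base stays in the
  neighbourhood, and the neighbourhood determines the singularity (`Linked.isIsolated`).
* If `Ω` is a round disc with three singular boundary points, two of the three arcs, with the
  antipodes of their midpoints, show `d ≥ 4 π / 3` (`Linked.eq_of_singAt`). If `d < 4 π / 3`, and
  no section exists over the whole plane or sphere minus a point, a maximal disc, normalized to be a
  half-plane with the singular point `∞`, is enlarged until a second singular point appears
  (`IsSec.exists_extremal_halfPlane`). As there is never a third one, the section continues to all
  half-planes obtained by rotation about the second point (`isClosed_isLogPoint`,
  `isOpen_isLogPoint`), and `F` is, up to a linear-fractional transformation, the exponential of an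
  affine map (`Linked.exists_eq`).

The bound for three singularities follows, because linear-fractional maps and linear-fractional
transformations of exponentials have at most two singularities
(`card_singularity_le_of_affine`, `card_singularity_le_of_exp`).
-/

open Filter Topology

namespace SphericalMetric
/-! ### The Riemann sphere and its Möbius transformations -/

/-- The point of the sphere with homogeneous coordinates `[a : b]`. -/
noncomputable def ratio (p : ℂ × ℂ) : OnePoint ℂ :=
  if p.2 = 0 then OnePoint.infty else ((p.1 / p.2 : ℂ) : OnePoint ℂ)

theorem tendsto_infty_of_norm {α : Type*} {l : Filter α} {g : α → OnePoint ℂ}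
    (h : ∀ R : ℝ, ∀ᶠ x in l, ∀ w : ℂ, g x = w → R < ‖w‖) :
    Tendsto g l (𝓝 OnePoint.infty) := by
  rw [OnePoint.hasBasis_nhds_infty.tendsto_right_iff]
  rintro s ⟨-, hs⟩
  obtain ⟨R, hR⟩ := hs.isBounded.exists_norm_le
  filter_upwards [h R] with x hx
  induction hg : g x using OnePoint.rec with
  | infty => simp
  | coe w =>
    left
    refine ⟨w, fun hw => ?_, rfl⟩
    exact absurd (hR w hw) (not_le.2 (hx w hg))

theorem continuousAt_ratio {p : ℂ × ℂ} (hp : p ≠ 0) : ContinuousAt ratio p := by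
  by_cases h : p.2 = 0
  · have h1 : p.1 ≠ 0 := fun h1 => hp (Prod.ext h1 h)
    have : ratio p = OnePoint.infty := by simp [ratio, h]
    rw [ContinuousAt, this]
    refine tendsto_infty_of_norm fun R => ?_
    have e1 : ∀ᶠ q : ℂ × ℂ in 𝓝 p, ‖p.1‖ / 2 < ‖q.1‖ :=
      (continuous_fst.norm.continuousAt (x := p)).eventually_const_lt
        (by simpa using norm_pos_iff.2 h1)
    have e2 : ∀ᶠ q : ℂ × ℂ in 𝓝 p, (|R| + 1) * ‖q.2‖ < ‖p.1‖ / 2 := by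
      refine ((continuous_const.mul continuous_snd.norm).continuousAt (x := p)).eventually_lt_const
        ?_
      simpa [h] using h1
    filter_upwards [e1, e2] with q h1q h2q w hw
    by_cases hq : q.2 = 0
    · simp [ratio, hq] at hw
    · simp only [ratio, hq, if_false, OnePoint.coe_eq_coe] at hw
      rw [← hw, norm_div, lt_div_iff₀ (norm_pos_iff.2 hq)]
      have := le_abs_self R
      nlinarith [norm_nonneg q.2]
  · have e : ∀ᶠ q : ℂ × ℂ in 𝓝 p, ((q.1 / q.2 : ℂ) : OnePoint ℂ) = ratio q := by
      filter_upwards [continuous_snd.continuousAt.eventually_ne h] with q hq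
      simp [ratio, hq]
    refine ContinuousAt.congr ?_ e
    exact OnePoint.continuous_coe.continuousAt.comp
      (continuousAt_fst.div continuousAt_snd h)

theorem smul_coe (A : GL (Fin 2) ℂ) (w : ℂ) :
    A • (w : OnePoint ℂ) = ratio (A 0 0 * w + A 0 1, A 1 0 * w + A 1 1) := by
  rw [OnePoint.smul_some_eq_ite]; rfl

theorem smul_infty (A : GL (Fin 2) ℂ) :
    A • (OnePoint.infty : OnePoint ℂ) = ratio (A 0 0, A 1 0) := by
  rw [OnePoint.smul_infty_eq_ite]; rfl

theorem det_entries_ne (A : GL (Fin 2) ℂ) : A 0 0 * A 1 1 - A 0 1 * A 1 0 ≠ 0 := by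
  have := A.det_ne_zero
  rwa [Matrix.det_fin_two] at this

theorem continuous_smul_sphere (A : GL (Fin 2) ℂ) :
    Continuous fun x : OnePoint ℂ => A • x := by
  have hd := det_entries_ne A
  rw [OnePoint.continuous_iff, coclosedCompact_eq_cocompact]
  constructor
  · have h0 : Tendsto (fun w : ℂ => w⁻¹) (cocompact ℂ) (𝓝 0) := by
      rw [← Metric.cobounded_eq_cocompact]; exact tendsto_inv₀_cobounded
    have h1 : Tendsto (fun w : ℂ => ((A 0 0 + A 0 1 * w⁻¹, A 1 0 + A 1 1 * w⁻¹) : ℂ × ℂ))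
        (cocompact ℂ) (𝓝 (A 0 0, A 1 0)) := by
      have := (tendsto_const_nhds (x := A 0 0)).add ((tendsto_const_nhds (x := A 0 1)).mul h0)
      have h2 := (tendsto_const_nhds (x := A 1 0)).add ((tendsto_const_nhds (x := A 1 1)).mul h0)
      simpa using this.prodMk_nhds h2
    have hne : ((A 0 0, A 1 0) : ℂ × ℂ) ≠ 0 := by
      intro h
      simp only [Prod.mk_eq_zero] at h
      simp [h.1, h.2] at hd
    rw [smul_infty]
    refine ((continuousAt_ratio hne).tendsto.comp h1).congr' ?_
    have : ∀ᶠ w : ℂ in cocompact ℂ, w ≠ 0 := by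
      have := (isCompact_singleton (x := (0 : ℂ))).compl_mem_cocompact
      filter_upwards [this] with w hw using hw
    filter_upwards [this] with w hw
    rw [smul_coe]
    have e1 : A 1 0 + A 1 1 * w⁻¹ = (A 1 0 * w + A 1 1) / w := by field_simp
    have e2 : A 0 0 + A 0 1 * w⁻¹ = (A 0 0 * w + A 0 1) / w := by field_simp
    simp only [Function.comp, ratio, e1, e2, div_eq_zero_iff, hw, or_false]
    split_ifs with h
    · rfl
    · rw [div_div_div_cancel_right₀ hw]
  · rw [continuous_iff_continuousAt]
    intro w
    have : (fun w : ℂ => A • (w : OnePoint ℂ)) =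
        ratio ∘ fun w => (A 0 0 * w + A 0 1, A 1 0 * w + A 1 1) := by
      ext w; rw [smul_coe]; rfl
    rw [this]
    refine ContinuousAt.comp (continuousAt_ratio ?_) (by fun_prop)
    intro h
    simp only [Prod.mk_eq_zero] at h
    apply hd
    linear_combination (A 0 0) * h.2 - (A 1 0) * h.1

/-- A Möbius transformation as a homeomorphism of the sphere. -/
noncomputable def mobiusHomeo (A : GL (Fin 2) ℂ) : OnePoint ℂ ≃ₜ OnePoint ℂ where
  toEquiv := MulAction.toPerm A
  continuous_toFun := continuous_smul_sphere A
  continuous_invFun := continuous_smul_sphere A⁻¹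

@[simp] theorem mobiusHomeo_apply (A : GL (Fin 2) ℂ) (x : OnePoint ℂ) :
    mobiusHomeo A x = A • x := rfl

/-! ### The spherical distance -/

/-- Horizontal (complex) coordinate of the stereographic image in the unit sphere of `ℂ × ℝ`. -/
noncomputable def stereoC (x : OnePoint ℂ) : ℂ :=
  x.elim 0 fun w => 2 * w / ((1 + ‖w‖ ^ 2 : ℝ) : ℂ)

/-- Vertical coordinate of the stereographic image in the unit sphere of `ℂ × ℝ`. -/
noncomputable def stereoR (x : OnePoint ℂ) : ℝ :=
  x.elim 1 fun w => (‖w‖ ^ 2 - 1) / (1 + ‖w‖ ^ 2)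

@[simp] theorem stereoC_coe (w : ℂ) : stereoC w = 2 * w / ((1 + ‖w‖ ^ 2 : ℝ) : ℂ) := rfl
@[simp] theorem stereoC_infty : stereoC OnePoint.infty = 0 := rfl
@[simp] theorem stereoR_coe (w : ℂ) : stereoR w = (‖w‖ ^ 2 - 1) / (1 + ‖w‖ ^ 2) := rfl
@[simp] theorem stereoR_infty : stereoR OnePoint.infty = 1 := rfl

theorem one_add_sq_pos (w : ℂ) : 0 < 1 + ‖w‖ ^ 2 := by positivity

theorem tendsto_sq_cocompact : Tendsto (fun w : ℂ => 1 + ‖w‖ ^ 2) (cocompact ℂ) atTop := by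
  refine tendsto_atTop_add_const_left _ _ ?_
  exact (tendsto_pow_atTop two_ne_zero).comp (tendsto_norm_cocompact_atTop)

theorem continuous_stereoC : Continuous stereoC := by
  rw [OnePoint.continuous_iff, coclosedCompact_eq_cocompact]
  constructor
  · simp only [stereoC_coe, stereoC_infty]
    rw [tendsto_zero_iff_norm_tendsto_zero]
    have h1 : Tendsto (fun w : ℂ => 2 * ‖w‖⁻¹) (cocompact ℂ) (𝓝 0) := by
      simpa using (tendsto_inv_atTop_zero.comp tendsto_norm_cocompact_atTop).const_mul (2 : ℝ)
    refine squeeze_zero (fun w => norm_nonneg _) (fun w => ?_) h1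
    rw [norm_div, norm_mul, Complex.norm_real, Real.norm_of_nonneg (one_add_sq_pos w).le]
    rcases eq_or_ne w 0 with rfl | hw
    · simp
    have := norm_pos_iff.2 hw
    rw [div_le_iff₀ (one_add_sq_pos w)]
    simp only [Complex.norm_ofNat]
    have : 2 * ‖w‖⁻¹ * (1 + ‖w‖ ^ 2) = 2 * ‖w‖⁻¹ + 2 * ‖w‖ := by field_simp
    rw [this]
    have : 0 < ‖w‖⁻¹ := by positivity
    linarith
  · simp only [stereoC_coe]
    refine Continuous.div (by fun_prop) (by fun_prop) fun w => ?_
    exact_mod_cast (one_add_sq_pos w).ne'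

theorem continuous_stereoR : Continuous stereoR := by
  rw [OnePoint.continuous_iff, coclosedCompact_eq_cocompact]
  constructor
  · simp only [stereoR_coe, stereoR_infty]
    have h1 := (tendsto_inv_atTop_zero.comp tendsto_sq_cocompact).const_mul (2 : ℝ)
    have h2 := (tendsto_const_nhds (x := (1 : ℝ))).sub h1
    simp only [mul_zero, sub_zero] at h2
    refine h2.congr fun w => ?_
    have := (one_add_sq_pos w).ne'
    simp only [Function.comp]
    field_simp
    ring
  · simp only [stereoR_coe]
    exact Continuous.div (by fun_prop) (by fun_prop) fun w => (one_add_sq_pos w).ne'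

/-- Cosine of the spherical distance of two points of the sphere. -/
noncomputable def cosDist (x y : OnePoint ℂ) : ℝ :=
  (stereoC x * starRingEnd ℂ (stereoC y)).re + stereoR x * stereoR y

/-- The distance of two points on the unit sphere. -/
noncomputable def angDist (x y : OnePoint ℂ) : ℝ := Real.arccos (cosDist x y)

theorem cosDist_comm (x y : OnePoint ℂ) : cosDist x y = cosDist y x := by
  simp only [cosDist, Complex.mul_re, Complex.conj_re, Complex.conj_im]; ring

theorem angDist_comm (x y : OnePoint ℂ) : angDist x y = angDist y x := by
  rw [angDist, cosDist_comm]; rfl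

theorem continuous_cosDist (x : OnePoint ℂ) : Continuous (cosDist x) := by
  unfold cosDist
  have := continuous_stereoC
  have := continuous_stereoR
  refine Continuous.add (Complex.continuous_re.comp ?_) (by fun_prop)
  exact continuous_const.mul (Complex.continuous_conj.comp continuous_stereoC)

theorem continuous_angDist (x : OnePoint ℂ) : Continuous (angDist x) :=
  Real.continuous_arccos.comp (continuous_cosDist x)

theorem cosDist_coe (z w : ℂ) :
    cosDist z w = 1 - 2 * ‖z - w‖ ^ 2 / ((1 + ‖z‖ ^ 2) * (1 + ‖w‖ ^ 2)) := by
  have hz := (one_add_sq_pos z).ne'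
  have hw := (one_add_sq_pos w).ne'
  have e1 : stereoC z * starRingEnd ℂ (stereoC w) =
      (((4 / ((1 + ‖z‖ ^ 2) * (1 + ‖w‖ ^ 2)) : ℝ)) : ℂ) * (z * starRingEnd ℂ w) := by
    simp only [stereoC_coe, map_div₀, map_mul, Complex.conj_ofReal]
    have hz' : ((1 + ‖z‖ ^ 2 : ℝ) : ℂ) ≠ 0 := by exact_mod_cast hz
    have hw' : ((1 + ‖w‖ ^ 2 : ℝ) : ℂ) ≠ 0 := by exact_mod_cast hw
    rw [Complex.ofReal_div, Complex.ofReal_mul]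
    have h2 : starRingEnd ℂ 2 = 2 := Complex.conj_ofNat 2
    rw [h2]
    field_simp
    push_cast
    ring
  rw [cosDist, e1, Complex.re_ofReal_mul]
  simp only [stereoR_coe]
  have e2 : ‖z - w‖ ^ 2 = ‖z‖ ^ 2 + ‖w‖ ^ 2 - 2 * (z * starRingEnd ℂ w).re := by
    rw [← Complex.normSq_eq_norm_sq, ← Complex.normSq_eq_norm_sq, ← Complex.normSq_eq_norm_sq,
      Complex.normSq_sub]
  rw [e2]
  field_simp
  ring

theorem cosDist_infty_coe (w : ℂ) : cosDist OnePoint.infty w = 1 - 2 / (1 + ‖w‖ ^ 2) := by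
  have hw := (one_add_sq_pos w).ne'
  simp only [cosDist, stereoC_infty, zero_mul, Complex.zero_re, stereoR_infty, stereoR_coe]
  field_simp
  ring

/-- Every point of the sphere has an antipode. -/
theorem exists_antipode (x : OnePoint ℂ) : ∃ y, ∀ z, cosDist y z = - cosDist x z := by
  have key : ∀ y, stereoC y = - stereoC x → stereoR y = - stereoR x →
      ∀ z, cosDist y z = - cosDist x z := by
    intro y h1 h2 z
    simp only [cosDist, h1, h2, neg_mul, Complex.neg_re]; ring
  induction x using OnePoint.rec with
  | infty => exact ⟨((0 : ℂ) : OnePoint ℂ), key _ (by simp) (by simp)⟩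
  | coe w =>
    rcases eq_or_ne w 0 with rfl | hw
    · exact ⟨OnePoint.infty, key _ (by simp) (by simp)⟩
    · have hn := norm_ne_zero_iff.2 hw
      refine ⟨((-(starRingEnd ℂ w)⁻¹ : ℂ) : OnePoint ℂ), key _ ?_ ?_⟩
      · simp only [stereoC_coe, norm_neg, norm_inv, RCLike.norm_conj]
        have e : (1 + ‖w‖⁻¹ ^ 2 : ℝ) = (1 + ‖w‖ ^ 2) / ‖w‖ ^ 2 := by field_simp; ring
        have e' : ((‖w‖ ^ 2 : ℝ) : ℂ) = w * starRingEnd ℂ w := by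
          rw [Complex.mul_conj, Complex.normSq_eq_norm_sq]
        have hc : starRingEnd ℂ w ≠ 0 := by simpa using hw
        have h3 : ((1 + ‖w‖ ^ 2 : ℝ) : ℂ) ≠ 0 := by exact_mod_cast (one_add_sq_pos w).ne'
        rw [e, Complex.ofReal_div, e']
        field_simp
      · simp only [stereoR_coe, norm_neg, norm_inv, RCLike.norm_conj]
        have := (one_add_sq_pos w).ne'
        field_simp
        ring

theorem cosDist_self (x : OnePoint ℂ) : cosDist x x = 1 := by
  induction x using OnePoint.rec with
  | infty => simp [cosDist]
  | coe w => simp [cosDist_coe]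

/-- The Möbius transformation `w ↦ (conj p * w + 1) / (w - p)`: an isometry (up to a scalar, a
unitary matrix) which sends `p` to `∞`. -/
noncomputable def toInfty (p : ℂ) : GL (Fin 2) ℂ :=
  Matrix.GeneralLinearGroup.mkOfDetNeZero !![starRingEnd ℂ p, 1; 1, -p] (by
    rw [Matrix.det_fin_two_of]
    have : starRingEnd ℂ p * -p - 1 * 1 = -((1 + ‖p‖ ^ 2 : ℝ) : ℂ) := by
      push_cast
      rw [← Complex.conj_mul']; ring
    rw [this, neg_ne_zero]
    exact_mod_cast (one_add_sq_pos p).ne')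

theorem toInfty_coe {p w : ℂ} (h : w ≠ p) :
    toInfty p • (w : OnePoint ℂ) = (((starRingEnd ℂ p * w + 1) / (w - p) : ℂ) : OnePoint ℂ) := by
  rw [smul_coe]
  simp [toInfty, Matrix.GeneralLinearGroup.mkOfDetNeZero, ratio, ← sub_eq_add_neg, sub_ne_zero.2 h]

theorem toInfty_self (p : ℂ) : toInfty p • (p : OnePoint ℂ) = OnePoint.infty := by
  rw [smul_coe]
  simp [toInfty, Matrix.GeneralLinearGroup.mkOfDetNeZero, ratio]

theorem toInfty_infty (p : ℂ) :
    toInfty p • (OnePoint.infty : OnePoint ℂ) = ((starRingEnd ℂ p : ℂ) : OnePoint ℂ) := by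
  rw [smul_infty]
  simp [toInfty, Matrix.GeneralLinearGroup.mkOfDetNeZero, ratio]

theorem one_add_sq_toInfty {p w : ℂ} (h : w ≠ p) :
    1 + ‖(starRingEnd ℂ p * w + 1) / (w - p)‖ ^ 2 =
      (1 + ‖p‖ ^ 2) * (1 + ‖w‖ ^ 2) / ‖w - p‖ ^ 2 := by
  have hn : ‖w - p‖ ≠ 0 := norm_ne_zero_iff.2 (sub_ne_zero.2 h)
  rw [norm_div, div_pow]
  field_simp
  simp only [← Complex.normSq_eq_norm_sq, Complex.normSq_apply, Complex.sub_re, Complex.sub_im,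
    Complex.add_re, Complex.add_im, Complex.mul_re, Complex.mul_im, Complex.conj_re,
    Complex.conj_im, Complex.one_re, Complex.one_im]
  ring

theorem cosDist_toInfty (p : ℂ) (x y : OnePoint ℂ) :
    cosDist (toInfty p • x) (toInfty p • y) = cosDist x y := by
  have hp := (one_add_sq_pos p).ne'
  have key : ∀ w : ℂ, cosDist (toInfty p • (p : OnePoint ℂ)) (toInfty p • (w : OnePoint ℂ)) =
      cosDist p w := by
    intro w
    rcases eq_or_ne w p with rfl | hw
    · rw [cosDist_self, cosDist_self]
    · rw [toInfty_self, toInfty_coe hw, cosDist_infty_coe, one_add_sq_toInfty hw, cosDist_coe]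
      have hn : ‖w - p‖ ≠ 0 := norm_ne_zero_iff.2 (sub_ne_zero.2 hw)
      have := (one_add_sq_pos w).ne'
      rw [norm_sub_rev p w]
      field_simp
  have key2 : ∀ w : ℂ, cosDist (toInfty p • (OnePoint.infty : OnePoint ℂ))
      (toInfty p • (w : OnePoint ℂ)) = cosDist OnePoint.infty w := by
    intro w
    rcases eq_or_ne w p with rfl | hw
    · rw [toInfty_infty, toInfty_self, cosDist_comm, cosDist_infty_coe, cosDist_infty_coe]
      simp
    · rw [toInfty_infty, toInfty_coe hw, cosDist_infty_coe, cosDist_coe, one_add_sq_toInfty hw]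
      have hn : ‖w - p‖ ≠ 0 := norm_ne_zero_iff.2 (sub_ne_zero.2 hw)
      have := (one_add_sq_pos w).ne'
      have e : starRingEnd ℂ p - (starRingEnd ℂ p * w + 1) / (w - p) =
          - ((1 + ‖p‖ ^ 2 : ℝ) : ℂ) / (w - p) := by
        have := sub_ne_zero.2 hw
        push_cast
        rw [← Complex.conj_mul']
        field_simp
        ring
      rw [e, norm_div, norm_neg, Complex.norm_real, Real.norm_of_nonneg (one_add_sq_pos p).le,
        RCLike.norm_conj]
      field_simp
  induction x using OnePoint.rec with
  | infty =>
    induction y using OnePoint.rec with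
    | infty => rw [cosDist_self, cosDist_self]
    | coe w => exact key2 w
  | coe z =>
    induction y using OnePoint.rec with
    | infty => rw [cosDist_comm, key2, cosDist_comm]
    | coe w =>
      rcases eq_or_ne z p with rfl | hz
      · exact key w
      rcases eq_or_ne w p with rfl | hw
      · rw [cosDist_comm, key, cosDist_comm]
      rw [toInfty_coe hz, toInfty_coe hw, cosDist_coe, cosDist_coe, one_add_sq_toInfty hz,
        one_add_sq_toInfty hw]
      have hz' := sub_ne_zero.2 hz
      have hw' := sub_ne_zero.2 hw
      have e : (starRingEnd ℂ p * z + 1) / (z - p) - (starRingEnd ℂ p * w + 1) / (w - p) =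
          - ((1 + ‖p‖ ^ 2 : ℝ) : ℂ) * (z - w) / ((z - p) * (w - p)) := by
        push_cast
        rw [← Complex.conj_mul']
        field_simp
        ring
      rw [e, norm_div, norm_mul, norm_mul, norm_neg, Complex.norm_real,
        Real.norm_of_nonneg (one_add_sq_pos p).le]
      have h1 := norm_ne_zero_iff.2 hz'
      have h2 := norm_ne_zero_iff.2 hw'
      have := (one_add_sq_pos w).ne'
      have := (one_add_sq_pos z).ne'
      field_simp

theorem angDist_toInfty (p : ℂ) (x y : OnePoint ℂ) :
    angDist (toInfty p • x) (toInfty p • y) = angDist x y := by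
  rw [angDist, cosDist_toInfty, angDist]

/-! ### Locally univalent maps into the sphere -/

/-- `F` is holomorphic and locally injective as a map into the Riemann sphere: near every point it
is the composition of an analytic function with nonzero derivative and a Möbius transformation. -/
def LocUniv (F : ℂ → OnePoint ℂ) : Prop :=
  ∀ z, ∃ (A : GL (Fin 2) ℂ) (g : ℂ → ℂ), AnalyticAt ℂ g z ∧ deriv g z ≠ 0 ∧
    ∀ᶠ w in 𝓝 z, F w = A • (g w : OnePoint ℂ)

variable {F : ℂ → OnePoint ℂ} {f : ℂ → ℂ}

open Metric

theorem LocUniv.smul (hF : LocUniv F) (A : GL (Fin 2) ℂ) : LocUniv fun z => A • F z := by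
  intro z
  obtain ⟨B, g, h1, h2, h3⟩ := hF z
  refine ⟨A * B, g, h1, h2, ?_⟩
  filter_upwards [h3] with w hw
  rw [hw, mul_smul]

theorem LocUniv.continuous (hF : LocUniv F) : Continuous F := by
  rw [continuous_iff_continuousAt]
  intro z
  obtain ⟨B, g, h1, h2, h3⟩ := hF z
  refine ContinuousAt.congr ?_ (h3.mono fun _ h => h.symm)
  exact (continuous_smul_sphere B).continuousAt.comp
    (OnePoint.continuous_coe.continuousAt.comp h1.continuousAt)

/-- At a point with finite value, a locally univalent map is given by an analytic function with
nonzero derivative. -/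
theorem LocUniv.exists_chart (hF : LocUniv F) {z c : ℂ} (h : F z = c) :
    ∃ g : ℂ → ℂ, AnalyticAt ℂ g z ∧ deriv g z ≠ 0 ∧ ∀ᶠ w in 𝓝 z, F w = g w := by
  obtain ⟨A, g, h1, h2, h3⟩ := hF z
  have hd := det_entries_ne A
  have hz := h3.self_of_nhds
  rw [h, smul_coe] at hz
  have hne : A 1 0 * g z + A 1 1 ≠ 0 := by
    intro h0
    simp [ratio, h0] at hz
  have hne' : ∀ᶠ w in 𝓝 z, A 1 0 * g w + A 1 1 ≠ 0 :=
    ((continuousAt_const.mul h1.continuousAt).add continuousAt_const).eventually_ne hne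
  refine ⟨fun w => (A 0 0 * g w + A 0 1) / (A 1 0 * g w + A 1 1), ?_, ?_, ?_⟩
  · exact ((analyticAt_const.mul h1).add analyticAt_const).div
      ((analyticAt_const.mul h1).add analyticAt_const) hne
  · have hg := h1.differentiableAt.hasDerivAt
    have := ((hg.const_mul (A 0 0)).add_const (A 0 1)).div
      ((hg.const_mul (A 1 0)).add_const (A 1 1)) hne
    have h4 : deriv (fun w => (A 0 0 * g w + A 0 1) / (A 1 0 * g w + A 1 1)) z = _ := this.deriv
    rw [h4]
    refine div_ne_zero ?_ (pow_ne_zero _ hne)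
    have : A 0 0 * deriv g z * (A 1 0 * g z + A 1 1) - (A 0 0 * g z + A 0 1) *
        (A 1 0 * deriv g z) = (A 0 0 * A 1 1 - A 0 1 * A 1 0) * deriv g z := by ring
    rw [this]
    exact mul_ne_zero hd h2
  · filter_upwards [h3, hne'] with w hw hw'
    rw [hw, smul_coe]
    simp [ratio, hw']

theorem LocUniv.exists_smul_eq_coe (x : OnePoint ℂ) :
    ∃ (A : GL (Fin 2) ℂ) (c : ℂ), A • x = (c : OnePoint ℂ) := by
  induction x using OnePoint.rec with
  | infty => exact ⟨toInfty 0, _, toInfty_infty 0⟩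
  | coe w => exact ⟨1, w, one_smul _ _⟩

theorem LocUniv.isLocallyInjective (hF : LocUniv F) : IsLocallyInjective F := by
  rw [isLocallyInjective_iff_nhds]
  intro z
  obtain ⟨A, g, h1, h2, h3⟩ := hF z
  let R := (h1.hasStrictDerivAt.hasStrictFDerivAt_equiv h2).toOpenPartialHomeomorph g
  have hz : z ∈ R.source := HasStrictFDerivAt.mem_toOpenPartialHomeomorph_source _
  refine ⟨_, inter_mem h3 (R.open_source.mem_nhds hz), ?_⟩
  rintro x ⟨hx, hx'⟩ y ⟨hy, hy'⟩ hxy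
  simp only [mem_ofPred_eq] at hx hy
  rw [hx, hy, smul_left_cancel_iff, OnePoint.coe_eq_coe] at hxy
  exact R.injOn hx' hy' hxy

/-! ### Sections -/

/-- `φ` is a section of `F` (a branch of the inverse) over the subset `Ω` of the finite plane. -/
structure IsSec (F : ℂ → OnePoint ℂ) (Ω : Set ℂ) (φ : ℂ → ℂ) : Prop where
  cont : ContinuousOn φ Ω
  eq : ∀ w ∈ Ω, F (φ w) = w

/-- The point `b` of the sphere is singular for the section `φ` over `Ω`: it is not attained on the
closure of the image. -/
def SingAt (F : ℂ → OnePoint ℂ) (Ω : Set ℂ) (φ : ℂ → ℂ) (b : OnePoint ℂ) : Prop :=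
  ∀ z ∈ closure (φ '' Ω), F z ≠ b

theorem IsSec.mono {Ω Ω' : Set ℂ} {φ : ℂ → ℂ} (h : IsSec F Ω φ) (hs : Ω' ⊆ Ω) : IsSec F Ω' φ :=
  ⟨h.cont.mono hs, fun w hw => h.eq w (hs hw)⟩

theorem SingAt.mono {Ω Ω' : Set ℂ} {φ : ℂ → ℂ} {b : OnePoint ℂ} (h : SingAt F Ω φ b)
    (hs : Ω' ⊆ Ω) : SingAt F Ω' φ b :=
  fun z hz => h z (closure_mono (image_mono hs) hz)

theorem IsSec.injOn {Ω : Set ℂ} {φ : ℂ → ℂ} (h : IsSec F Ω φ) : InjOn φ Ω := by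
  intro x hx y hy hxy
  have := h.eq x hx
  rw [hxy, h.eq y hy, OnePoint.coe_eq_coe] at this
  exact this.symm

/-- Sections over a connected set which agree at one point agree. -/
theorem IsSec.eqOn (hF : LocUniv F) {Ω : Set ℂ} {φ ψ : ℂ → ℂ} (h1 : IsSec F Ω φ)
    (h2 : IsSec F Ω ψ) (hΩ : IsPreconnected Ω) {w : ℂ} (hw : w ∈ Ω) (he : φ w = ψ w) :
    EqOn φ ψ Ω :=
  (T2Space.isSeparatedMap F).eqOn_of_comp_eqOn hF.isLocallyInjective hΩ h1.cont h2.cont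
    (fun x hx => by simp [h1.eq x hx, h2.eq x hx]) hw he

/-- Local sections of a locally univalent map. -/
theorem LocUniv.exists_local_section (hF : LocUniv F) {z c : ℂ} (h : F z = c) :
    ∃ r > 0, ∃ χ : ℂ → ℂ, IsSec F (ball c r) χ ∧ χ c = z ∧
      ∀ s, 0 < s → s ≤ r → χ '' ball c s ∈ 𝓝 z := by
  obtain ⟨g, h1, h2, h3⟩ := hF.exists_chart h
  let R := (h1.hasStrictDerivAt.hasStrictFDerivAt_equiv h2).toOpenPartialHomeomorph g
  have hz : z ∈ R.source := HasStrictFDerivAt.mem_toOpenPartialHomeomorph_source _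
  have hR : (R : ℂ → ℂ) = g := HasStrictFDerivAt.toOpenPartialHomeomorph_coe _
  have hgz : g z = c := by
    have := h3.self_of_nhds
    rw [h, OnePoint.coe_eq_coe] at this
    exact this.symm
  have hc : c ∈ R.target := by
    rw [← hgz, ← hR]; exact R.map_source hz
  have hsz : R.symm c = z := by rw [← hgz, ← hR]; exact R.left_inv hz
  have h4 : ∀ᶠ w in 𝓝 c, w ∈ R.target ∧ F (R.symm w) = g (R.symm w) := by
    refine Filter.Eventually.and (R.open_target.mem_nhds hc) ?_
    have := R.continuousAt_symm hc
    rw [ContinuousAt, hsz] at this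
    exact this.eventually h3
  obtain ⟨r, hr, hball⟩ := Metric.eventually_nhds_iff_ball.1 h4
  refine ⟨r, hr, R.symm, ⟨?_, ?_⟩, hsz, ?_⟩
  · exact R.continuousOn_symm.mono fun w hw => (hball w hw).1
  · intro w hw
    rw [(hball w hw).2, ← hR, R.right_inv (hball w hw).1]
  · intro s hs hsr
    have : R.source ∩ g ⁻¹' ball c s ∈ 𝓝 z := by
      refine inter_mem (R.open_source.mem_nhds hz) (h1.continuousAt ?_)
      rw [hgz]; exact ball_mem_nhds c hs
    filter_upwards [this] with x hx
    refine ⟨g x, hx.2, ?_⟩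
    rw [← hR]; exact R.left_inv hx.1

theorem IsSec.isOpen_image (hF : LocUniv F) {Ω : Set ℂ} {φ : ℂ → ℂ} (h : IsSec F Ω φ)
    (hΩ : IsOpen Ω) : IsOpen (φ '' Ω) := by
  rw [isOpen_iff_mem_nhds]
  rintro _ ⟨w, hw, rfl⟩
  obtain ⟨r, hr, χ, h1, h2, h3⟩ := hF.exists_local_section (h.eq w hw)
  obtain ⟨s, hs, hsΩ⟩ := Metric.isOpen_iff.1 hΩ w hw
  have ht : 0 < min r s := lt_min hr hs
  have e : EqOn χ φ (ball w (min r s)) :=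
    (h1.mono (ball_subset_ball (min_le_left _ _))).eqOn hF
      (h.mono ((ball_subset_ball (min_le_right _ _)).trans hsΩ))
      (convex_ball _ _).isPreconnected (mem_ball_self ht) h2
  refine mem_of_superset (h3 _ ht (min_le_left _ _)) ?_
  rw [e.image_eq]
  exact image_mono ((ball_subset_ball (min_le_right _ _)).trans hsΩ)

theorem IsSec.differentiableOn (hF : LocUniv F) {Ω : Set ℂ} {φ : ℂ → ℂ} (h : IsSec F Ω φ)
    (hΩ : IsOpen Ω) : DifferentiableOn ℂ φ Ω := by
  intro w hw
  obtain ⟨g, h1, h2, h3⟩ := hF.exists_chart (h.eq w hw)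
  have hc : ContinuousAt φ w := h.cont.continuousAt (hΩ.mem_nhds hw)
  refine (HasDerivAt.of_local_left_inverse hc h1.differentiableAt.hasDerivAt h2 ?_
    ).differentiableAt.differentiableWithinAt
  filter_upwards [hΩ.mem_nhds hw, hc.eventually h3] with y hy hy'
  rw [h.eq y hy, OnePoint.coe_eq_coe] at hy'
  exact hy'.symm

/-- The image of a section is relatively closed in the preimage of its domain. -/
theorem IsSec.eq_of_mem_closure (hF : LocUniv F) {Ω : Set ℂ} {φ : ℂ → ℂ} (h : IsSec F Ω φ)
    (hΩ : IsOpen Ω) {z w : ℂ} (hz : z ∈ closure (φ '' Ω)) (hw : w ∈ Ω) (he : F z = w) :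
    φ w = z := by
  obtain ⟨x, hx, hlim⟩ := mem_closure_iff_seq_limit.1 hz
  choose y hy hyx using hx
  have h1 : Tendsto (fun n => ((y n : ℂ) : OnePoint ℂ)) atTop (𝓝 (w : OnePoint ℂ)) := by
    rw [← he]
    refine ((hF.continuous.tendsto z).comp hlim).congr fun n => ?_
    simp [← hyx, h.eq _ (hy n)]
  have h2 : Tendsto y atTop (𝓝 w) :=
    OnePoint.isOpenEmbedding_coe.isInducing.tendsto_nhds_iff.2 h1
  have h3 := ((h.cont.continuousAt (hΩ.mem_nhds hw)).tendsto.comp h2)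
  exact tendsto_nhds_unique (h3.congr fun n => hyx n) hlim

/-- A boundary point of `Ω` which is not singular has a disc over which the section extends. -/
theorem IsSec.exists_extension (hF : LocUniv F) {Ω : Set ℂ} {φ : ℂ → ℂ} (h : IsSec F Ω φ)
    (hΩ : Convex ℝ Ω) {z b : ℂ} (hz : z ∈ closure (φ '' Ω)) (he : F z = b) :
    ∃ r > 0, ∃ χ : ℂ → ℂ, IsSec F (ball b r) χ ∧ χ b = z ∧ EqOn φ χ (Ω ∩ ball b r) := by
  obtain ⟨r, hr, χ, h1, h2, h3⟩ := hF.exists_local_section he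
  refine ⟨r, hr, χ, h1, h2, ?_⟩
  obtain ⟨_, ⟨y, hy, hyx⟩, ⟨x, hx, rfl⟩⟩ := mem_closure_iff_nhds.1 hz _ (h3 r hr le_rfl)
  have hxy : y = x := by
    have := h1.eq y hy
    rw [hyx, h.eq x hx, OnePoint.coe_eq_coe] at this
    exact this.symm
  subst hxy
  exact (h.mono inter_subset_left).eqOn hF (h1.mono inter_subset_right)
    (hΩ.inter (convex_ball _ _)).isPreconnected ⟨hx, hy⟩ hyx.symm

/-- Gluing of sections. -/
theorem IsSec.glue {ι : Type*} {U : ι → Set ℂ} {χ : ι → ℂ → ℂ} (hU : ∀ i, IsOpen (U i))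
    (h : ∀ i, IsSec F (U i) (χ i))
    (hc : ∀ i j, EqOn (χ i) (χ j) (U i ∩ U j)) :
    ∃ ψ, IsSec F (⋃ i, U i) ψ ∧ ∀ i, EqOn ψ (χ i) (U i) := by
  classical
  let ψ : ℂ → ℂ := fun w => if hw : ∃ i, w ∈ U i then χ hw.choose w else 0
  have e : ∀ i, EqOn ψ (χ i) (U i) := by
    intro i w hw
    have hw' : ∃ i, w ∈ U i := ⟨i, hw⟩
    simp only [ψ, dif_pos hw']
    exact hc _ _ ⟨hw'.choose_spec, hw⟩
  refine ⟨ψ, ⟨?_, ?_⟩, e⟩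
  · intro w hw
    obtain ⟨i, hi⟩ := mem_iUnion.1 hw
    have : ContinuousAt ψ w :=
      ((h i).cont.continuousAt ((hU i).mem_nhds hi)).congr
        (Filter.eventuallyEq_of_mem ((hU i).mem_nhds hi) fun x hx => (e i hx).symm)
    exact this.continuousWithinAt
  · intro w hw
    obtain ⟨i, hi⟩ := mem_iUnion.1 hw
    rw [e i hi, (h i).eq w hi]

/-- Extension of a section over a convex set along discs centered at its points. -/
theorem IsSec.exists_iUnion_ball (hF : LocUniv F) {Ω : Set ℂ} {φ : ℂ → ℂ} (h : IsSec F Ω φ)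
    (hΩ : Convex ℝ Ω) {r : ℂ → ℝ} (hr : ∀ y ∈ Ω, 0 < r y)
    (hball : ∀ y ∈ Ω, ∃ χ, IsSec F (ball y (r y)) χ ∧ χ y = φ y) :
    ∃ ψ, IsSec F (⋃ y : Ω, ball (y : ℂ) (r y)) ψ ∧ EqOn ψ φ Ω := by
  choose! χ h1 h2 using hball
  have e : ∀ y ∈ Ω, EqOn φ (χ y) (Ω ∩ ball y (r y)) := fun y hy =>
    (h.mono inter_subset_left).eqOn hF ((h1 y hy).mono inter_subset_right)
      (hΩ.inter (convex_ball _ _)).isPreconnected ⟨hy, mem_ball_self (hr y hy)⟩ (h2 y hy).symm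
  obtain ⟨ψ, h3, h4⟩ := IsSec.glue (F := F) (ι := Ω) (U := fun y => ball (y : ℂ) (r y))
    (χ := fun y => χ y) (fun _ => isOpen_ball) (fun y => h1 y y.2) (by
      rintro ⟨x, hx⟩ ⟨y, hy⟩ w ⟨hwx, hwy⟩
      simp only at hwx hwy
      have hrx := hr x hx
      have hry := hr y hy
      have hd : dist x y < r x + r y := by
        have := dist_triangle_left x y w
        rw [mem_ball] at hwx hwy
        linarith
      have hs : 0 < r x + r y := by linarith
      have hs' : 1 - r x / (r x + r y) = r y / (r x + r y) := by field_simp; ring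
      -- a common point of both discs on the segment joining the centers
      have hm : AffineMap.lineMap x y (r x / (r x + r y)) ∈ Ω :=
        hΩ.lineMap_mem hx hy ⟨by positivity, (div_le_one hs).2 (by linarith)⟩
      have hmx : AffineMap.lineMap x y (r x / (r x + r y)) ∈ ball x (r x) := by
        rw [mem_ball, dist_lineMap_left, Real.norm_of_nonneg (by positivity), div_mul_eq_mul_div,
          div_lt_iff₀ hs]
        gcongr
      have hmy : AffineMap.lineMap x y (r x / (r x + r y)) ∈ ball y (r y) := by
        rw [mem_ball, dist_lineMap_right, hs', Real.norm_of_nonneg (by positivity),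
          div_mul_eq_mul_div, div_lt_iff₀ hs]
        gcongr
      exact ((h1 x hx).mono inter_subset_left).eqOn hF ((h1 y hy).mono inter_subset_right)
        ((convex_ball _ _).inter (convex_ball _ _)).isPreconnected ⟨hmx, hmy⟩
        ((e x hx ⟨hm, hmx⟩).symm.trans (e y hy ⟨hm, hmy⟩)) ⟨hwx, hwy⟩)
  refine ⟨ψ, h3, fun y hy => ?_⟩
  rw [h4 ⟨y, hy⟩ (mem_ball_self (hr y hy)), h2 y hy]

/-- Uniform extension radius over a compact set without singular points. -/
theorem IsSec.exists_uniform_radius (hF : LocUniv F) {Ω : Set ℂ} {φ : ℂ → ℂ} (h : IsSec F Ω φ)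
    (hΩ : Convex ℝ Ω) {K : Set ℂ} (hK : IsCompact K)
    (hreg : ∀ b ∈ K, b ∈ closure Ω → ¬ SingAt F Ω φ b) :
    ∃ ρ > 0, ∀ y ∈ Ω ∩ K, ∃ χ, IsSec F (ball y ρ) χ ∧ χ y = φ y := by
  refine hK.induction_on (p := fun s => ∃ ρ > 0, ∀ y ∈ Ω ∩ s, ∃ χ, IsSec F (ball y ρ) χ ∧ χ y = φ y)
    ⟨1, one_pos, by simp⟩ ?_ ?_ ?_
  · rintro s t hst ⟨ρ, hρ, h1⟩
    exact ⟨ρ, hρ, fun y hy => h1 y ⟨hy.1, hst hy.2⟩⟩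
  · rintro s t ⟨ρ, hρ, h1⟩ ⟨ρ', hρ', h1'⟩
    refine ⟨min ρ ρ', lt_min hρ hρ', ?_⟩
    rintro y ⟨hy, hy' | hy'⟩
    · obtain ⟨χ, h2, h3⟩ := h1 y ⟨hy, hy'⟩
      exact ⟨χ, h2.mono (ball_subset_ball (min_le_left _ _)), h3⟩
    · obtain ⟨χ, h2, h3⟩ := h1' y ⟨hy, hy'⟩
      exact ⟨χ, h2.mono (ball_subset_ball (min_le_right _ _)), h3⟩
  · intro b hb
    by_cases hbΩ : b ∈ closure Ω
    · have := hreg b hb hbΩ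
      simp only [SingAt, ne_eq, not_forall, not_not] at this
      obtain ⟨z, hz, he⟩ := this
      obtain ⟨r, hr, χ, h1, -, h3⟩ := h.exists_extension hF hΩ hz he
      refine ⟨ball b (r / 2), mem_nhdsWithin_of_mem_nhds (ball_mem_nhds b (half_pos hr)), r / 2,
        half_pos hr, ?_⟩
      rintro y ⟨hy, hyb⟩
      have hyr : y ∈ ball b r := ball_subset_ball (by linarith) hyb
      refine ⟨χ, h1.mono ?_, (h3 ⟨hy, hyr⟩).symm⟩
      refine ball_subset_ball' ?_
      rw [mem_ball] at hyb
      linarith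
    · refine ⟨Ωᶜ, mem_nhdsWithin_of_mem_nhds ?_, 1, one_pos, fun y hy => absurd hy.1 hy.2⟩
      filter_upwards [isClosed_closure.isOpen_compl.mem_nhds hbΩ] with x hx hx'
      exact hx (subset_closure hx')

/-- A point over the finite plane has a maximal disc over which there is a section, and this disc
has a singular boundary point, unless there is a section over the whole plane. -/
theorem LocUniv.exists_maximal_disc (hF : LocUniv F) {x c : ℂ} (hx : F x = c)
    (hu : ¬ ∃ φ, IsSec F univ φ) :
    ∃ r > 0, ∃ φ, IsSec F (ball c r) φ ∧ φ c = x ∧ ∃ b ∈ sphere c r, SingAt F (ball c r) φ b := by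
  obtain ⟨r₀, hr₀, χ₀, h1₀, h2₀, -⟩ := hF.exists_local_section hx
  let S : Set ℝ := {r | 0 < r ∧ ∃ φ, IsSec F (ball c r) φ ∧ φ c = x}
  have hS : S.Nonempty := ⟨r₀, hr₀, χ₀, h1₀, h2₀⟩
  have hagree : ∀ r ∈ S, ∀ s ∈ S, ∀ φ ψ, IsSec F (ball c r) φ → φ c = x → IsSec F (ball c s) ψ →
      ψ c = x → EqOn φ ψ (ball c r ∩ ball c s) := by
    intro r hr s hs φ ψ h1 h2 h3 h4
    exact (h1.mono inter_subset_left).eqOn hF (h3.mono inter_subset_right)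
      ((convex_ball _ _).inter (convex_ball _ _)).isPreconnected
      ⟨mem_ball_self hr.1, mem_ball_self hs.1⟩ (h2.trans h4.symm)
  have hglue : ∃ ψ, IsSec F (⋃ r : S, ball c (r : ℝ)) ψ ∧ ψ c = x := by
    choose χ h1 h2 using fun r : S => r.2.2
    obtain ⟨ψ, h3, h4⟩ := IsSec.glue (F := F) (U := fun r : S => ball c (r : ℝ)) (χ := χ)
      (fun _ => isOpen_ball) h1
      (fun r s => hagree r r.2 s s.2 _ _ (h1 r) (h2 r) (h1 s) (h2 s))
    refine ⟨ψ, h3, ?_⟩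
    rw [h4 ⟨r₀, hr₀, χ₀, h1₀, h2₀⟩ (mem_ball_self hr₀), h2]
  obtain ⟨φ, hφ, hφc⟩ := hglue
  have hbdd : BddAbove S := by
    by_contra hb
    refine hu ⟨φ, hφ.mono fun w _ => ?_⟩
    obtain ⟨r, hr, hwr⟩ := not_bddAbove_iff.1 hb (dist w c)
    exact mem_iUnion.2 ⟨⟨r, hr⟩, hwr⟩
  have hr0 : r₀ ≤ sSup S := le_csSup hbdd ⟨hr₀, χ₀, h1₀, h2₀⟩
  have hpos : 0 < sSup S := hr₀.trans_le hr0
  have hφ' : IsSec F (ball c (sSup S)) φ := by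
    refine hφ.mono fun w hw => ?_
    obtain ⟨r, hr, hwr⟩ := exists_lt_of_lt_csSup hS (mem_ball.1 hw)
    exact mem_iUnion.2 ⟨⟨r, hr⟩, hwr⟩
  refine ⟨sSup S, hpos, φ, hφ', hφc, ?_⟩
  by_contra hb
  push Not at hb
  obtain ⟨ρ, hρ, h1⟩ := hφ'.exists_uniform_radius hF (convex_ball _ _)
    (isCompact_closedBall c (sSup S)) (by
      intro b hb' _
      rcases eq_or_lt_of_le (mem_closedBall.1 hb') with h2 | h2
      · exact hb b h2
      · intro h3
        exact h3 (φ b) (subset_closure (mem_image_of_mem _ h2)) (hφ'.eq b h2))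
  obtain ⟨ψ, h2, h3⟩ := hφ'.exists_iUnion_ball hF (convex_ball _ _) (fun _ _ => hρ)
    (fun y hy => h1 y ⟨hy, ball_subset_closedBall hy⟩)
  rw [← biUnion_eq_iUnion (t := fun y _ => ball y ρ), ← thickening_eq_biUnion_ball,
    _root_.thickening_ball hρ hpos] at h2
  have : ρ + sSup S ≤ sSup S :=
    le_csSup hbdd ⟨by linarith, ψ, h2, (h3 (mem_ball_self hpos)).trans hφc⟩
  linarith

/-- Being singular at a common boundary point passes from one section to an agreeing one. -/
theorem SingAt.of_eqOn_inter (hF : LocUniv F) {Ω Ω' : Set ℂ} {φ ψ : ℂ → ℂ} {b : ℂ}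
    (hs : SingAt F Ω φ b) (h : IsSec F Ω φ) (h' : IsSec F Ω' ψ) (hΩ : Convex ℝ Ω)
    (hΩ' : Convex ℝ Ω') (he : EqOn φ ψ (Ω ∩ Ω')) (hb : b ∈ closure (Ω ∩ Ω')) :
    SingAt F Ω' ψ b := by
  intro z hz hzb
  obtain ⟨r, hr, χ, h1, h2, h3⟩ := h'.exists_extension hF hΩ' hz hzb
  obtain ⟨y, hyb, hy⟩ := mem_closure_iff_nhds.1 hb _ (ball_mem_nhds b hr)
  have e : EqOn φ χ (Ω ∩ ball b r) :=
    (h.mono inter_subset_left).eqOn hF (h1.mono inter_subset_right)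
      (hΩ.inter (convex_ball _ _)).isPreconnected ⟨hy.1, hyb⟩
      ((he hy).trans (h3 ⟨hy.2, hyb⟩))
  refine hs z ?_ hzb
  rw [← h2]
  have hb' : b ∈ closure (Ω ∩ ball b r) := by
    rw [mem_closure_iff_nhds] at hb ⊢
    intro t ht
    obtain ⟨y, hy1, hy2⟩ := hb _ (inter_mem ht (ball_mem_nhds b hr))
    exact ⟨y, hy1.1, hy2.1, hy1.2⟩
  have hc : ContinuousAt χ b := h1.cont.continuousAt (ball_mem_nhds b hr)
  have := (hc.continuousWithinAt (s := Ω ∩ ball b r)).mem_closure_image hb'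
  rw [← e.image_eq] at this
  exact closure_mono (image_mono inter_subset_left) this

/-- Transport of a section by a Möbius transformation. -/
theorem IsSec.smul {Ω Ω' : Set ℂ} {φ m : ℂ → ℂ} (h : IsSec F Ω φ) (A : GL (Fin 2) ℂ)
    (hm : ContinuousOn m Ω') (hmaps : MapsTo m Ω' Ω)
    (hA : ∀ w ∈ Ω', A • (m w : OnePoint ℂ) = w) :
    IsSec (fun z => A • F z) Ω' (φ ∘ m) :=
  ⟨h.cont.comp hm hmaps, fun w hw => by simp [h.eq _ (hmaps hw), hA w hw]⟩

/-! ### Sections over the whole plane -/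

theorem isPreconnected_norm_gt {R : ℝ} (hR : 0 < R) : IsPreconnected {w : ℂ | R < ‖w‖} := by
  have h : {w : ℂ | R < ‖w‖} = Complex.exp '' {ζ | Real.log R < ζ.re} := by
    ext w
    constructor
    · intro hw
      have hw' : R < ‖w‖ := hw
      have h0 : w ≠ 0 := norm_pos_iff.1 (hR.trans hw')
      refine ⟨Complex.log w, ?_, Complex.exp_log h0⟩
      rw [mem_ofPred_eq, Complex.log_re]
      exact Real.log_lt_log hR hw'
    · rintro ⟨ζ, hζ, rfl⟩
      rw [mem_ofPred_eq, Complex.norm_exp]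
      exact (Real.log_lt_iff_lt_exp hR).1 hζ
  rw [h]
  exact ((convex_halfSpace_re_gt _).isPreconnected).image _ Complex.continuous_exp.continuousOn

theorem toInfty_zero_coe {w : ℂ} (hw : w ≠ 0) :
    toInfty 0 • (w : OnePoint ℂ) = ((w⁻¹ : ℂ) : OnePoint ℂ) := by
  rw [toInfty_coe hw]; simp

theorem toInfty_zero_infty :
    toInfty 0 • (OnePoint.infty : OnePoint ℂ) = ((0 : ℂ) : OnePoint ℂ) := by
  rw [toInfty_infty]; simp

theorem toInfty_zero_zero :
    toInfty 0 • ((0 : ℂ) : OnePoint ℂ) = OnePoint.infty := toInfty_self 0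

/-- An injective proper entire function is affine. -/
theorem affine_of_proper {f : ℂ → ℂ} (hf : Differentiable ℂ f) (hinj : Function.Injective f)
    (hd : ∀ z, deriv f z ≠ 0) (hp : Tendsto f (cocompact ℂ) (cocompact ℂ)) :
    ∃ α β : ℂ, α ≠ 0 ∧ ∀ z, f z = α * z + β := by
  have hq : Differentiable ℂ (dslope f 0) := by
    rw [← differentiableOn_univ, Complex.differentiableOn_dslope univ_mem, differentiableOn_univ]
    exact hf
  have hq0 : ∀ z, dslope f 0 z ≠ 0 := by
    intro z
    rcases eq_or_ne z 0 with rfl | hz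
    · rw [dslope_same]; exact hd 0
    · rw [dslope_of_ne _ hz, slope_def_field]
      exact div_ne_zero (sub_ne_zero.2 fun h => hz (hinj h)) (sub_ne_zero.2 hz)
  set k : ℂ → ℂ := fun z => (dslope f 0 z)⁻¹ with hk
  have hkd : Differentiable ℂ k := hq.inv hq0
  have hkq : Differentiable ℂ (dslope k 0) := by
    rw [← differentiableOn_univ, Complex.differentiableOn_dslope univ_mem, differentiableOn_univ]
    exact hkd
  have hinv : Tendsto (fun w : ℂ => w⁻¹) (cocompact ℂ) (𝓝 0) := by
    rw [← Metric.cobounded_eq_cocompact]; exact tendsto_inv₀_cobounded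
  have hne : ∀ᶠ z : ℂ in cocompact ℂ, z ≠ 0 :=
    (isCompact_singleton (x := (0 : ℂ))).compl_mem_cocompact
  have hfinv : Tendsto (fun z => (f z - f 0)⁻¹) (cocompact ℂ) (𝓝 0) := by
    refine hinv.comp ?_
    have : Tendsto (fun z : ℂ => z - f 0) (cocompact ℂ) (cocompact ℂ) := by
      simpa [sub_eq_add_neg] using
        (Homeomorph.addRight (-f 0)).isClosedEmbedding.tendsto_cocompact
    exact this.comp hp
  have hlim : Tendsto (dslope k 0) (cocompact ℂ) (𝓝 0) := by
    have h1 : Tendsto (fun z => (f z - f 0)⁻¹ - k 0 * z⁻¹) (cocompact ℂ) (𝓝 0) := by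
      simpa using hfinv.sub (hinv.const_mul (k 0))
    refine h1.congr' ?_
    filter_upwards [hne] with z hz
    rw [dslope_of_ne _ hz, slope_def_field]
    have : k z = z / (f z - f 0) := by
      simp only [hk]
      rw [dslope_of_ne _ hz, slope_def_field, inv_div, sub_zero]
    rw [this, sub_zero, sub_div, div_div, mul_comm (f z - f 0) z, ← div_div, div_self hz,
      one_div, div_eq_mul_inv]
  have hconst := hkq.eq_const_of_tendsto_cocompact hlim
  have hkc : ∀ z, k z = k 0 := by
    intro z
    have := sub_smul_dslope k 0 z
    rw [hconst] at this
    simp only [Function.const_apply, smul_zero] at this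
    exact (sub_eq_zero.1 this.symm)
  have hk0 : k 0 ≠ 0 := inv_ne_zero (hq0 0)
  refine ⟨(k 0)⁻¹, f 0, inv_ne_zero hk0, fun z => ?_⟩
  have h1 := sub_smul_dslope f 0 z
  have h2 : dslope f 0 z = (k 0)⁻¹ := by rw [← hkc z]; simp [hk]
  rw [h2, smul_eq_mul, sub_zero] at h1
  rw [mul_comm, h1]; ring

/-- If a point over `∞` is adherent to the image of a section over an outer region, then the section
extends continuously to `∞`. -/
theorem IsSec.tendsto_of_mem_closure (hF : LocUniv F) {R : ℝ} (hR : 0 < R) {φ : ℂ → ℂ}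
    (h : IsSec F {w | R < ‖w‖} φ) {z : ℂ} (hz : z ∈ closure (φ '' {w | R < ‖w‖}))
    (he : F z = OnePoint.infty) : Tendsto φ (cocompact ℂ) (𝓝 z) := by
  have hG := hF.smul (toInfty 0)
  obtain ⟨r, hr, χ, h1, h2, h3⟩ := hG.exists_local_section (z := z) (c := 0)
    (by simp [he, toInfty_zero_infty])
  set s := min r (1 / R) with hs
  have hs0 : 0 < s := lt_min hr (by positivity)
  obtain ⟨_, ⟨y, hy, hyx⟩, ⟨w, hw, rfl⟩⟩ :=
    mem_closure_iff_nhds.1 hz _ (h3 s hs0 (min_le_left _ _))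
  have hinv : ∀ v : ℂ, 1 / s < ‖v‖ → v ≠ 0 ∧ R < ‖v‖ ∧ v⁻¹ ∈ ball (0 : ℂ) r := by
    intro v hv
    have hv0 : 0 < ‖v‖ := lt_trans (by positivity) hv
    have e1 : 1 / ‖v‖ < s := by rwa [one_div_lt hs0 hv0] at hv
    refine ⟨norm_pos_iff.1 hv0, ?_, ?_⟩
    · have := e1.trans_le (min_le_right r (1 / R))
      rwa [one_div_lt_one_div hv0 hR] at this
    · rw [mem_ball_zero_iff, norm_inv, ← one_div]
      exact e1.trans_le (min_le_left _ _)
  have hsec : IsSec F {v | 1 / s < ‖v‖} fun v => χ v⁻¹ := by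
    constructor
    · refine h1.cont.comp (continuousOn_inv₀.mono fun v hv => (hinv v hv).1)
        fun v hv => (hinv v hv).2.2
    · intro v hv
      have := h1.eq _ (hinv v hv).2.2
      rw [← toInfty_zero_coe (hinv v hv).1, smul_left_cancel_iff] at this
      exact this
  have hy' := h1.eq y (ball_subset_ball (min_le_left _ _) hy)
  have hw0 : w ≠ 0 := norm_pos_iff.1 (hR.trans hw)
  rw [hyx, h.eq w hw, toInfty_zero_coe hw0, OnePoint.coe_eq_coe] at hy'
  have hws : 1 / s < ‖w‖ := by
    rw [← hy', mem_ball_zero_iff, norm_inv, ← one_div] at hy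
    rwa [one_div_lt hs0 (norm_pos_iff.2 hw0)]
  have e : EqOn φ (fun v => χ v⁻¹) {v | 1 / s < ‖v‖} :=
    (h.mono fun v hv => (hinv v hv).2.1).eqOn hF hsec
      (isPreconnected_norm_gt (by positivity)) hws (show φ w = χ w⁻¹ by rw [hy', hyx])
  have hinv0 : Tendsto (fun w : ℂ => w⁻¹) (cocompact ℂ) (𝓝 0) := by
    rw [← Metric.cobounded_eq_cocompact]; exact tendsto_inv₀_cobounded
  have hlim := (h1.cont.continuousAt (ball_mem_nhds 0 hr)).tendsto.comp hinv0
  rw [h2] at hlim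
  refine hlim.congr' ?_
  filter_upwards [tendsto_norm_cocompact_atTop.eventually_gt_atTop (1 / s)] with v hv
  exact (e hv).symm

/-- A section over the whole finite plane exists only for affine functions. -/
theorem LocUniv.affine_of_section_univ (hF : LocUniv F) {φ : ℂ → ℂ} (h : IsSec F univ φ) :
    ∃ α β : ℂ, α ≠ 0 ∧ ∀ z, F z = ((α * z + β : ℂ) : OnePoint ℂ) := by
  have hd : Differentiable ℂ φ := by
    rw [← differentiableOn_univ]; exact h.differentiableOn hF isOpen_univ
  have hclosed : IsClosed (range φ) := by
    refine isClosed_of_closure_subset fun z hz => ?_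
    rw [← image_univ] at hz
    induction he : F z using OnePoint.rec with
    | coe w => exact ⟨w, h.eq_of_mem_closure hF isOpen_univ hz (mem_univ w) he⟩
    | infty =>
      exfalso
      by_cases hz1 : z ∈ closure (φ '' {w | 1 < ‖w‖})
      · have := hd.eq_const_of_tendsto_cocompact
          ((h.mono (subset_univ _)).tendsto_of_mem_closure hF one_pos hz1 he)
        have h01 : (0 : ℂ) = 1 := h.injOn (mem_univ _) (mem_univ _) (by rw [this]; rfl)
        exact zero_ne_one h01
      · have hsub : φ '' univ ⊆ φ '' {w | 1 < ‖w‖} ∪ φ '' closedBall 0 1 := by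
          rintro _ ⟨w, -, rfl⟩
          rcases lt_or_ge 1 ‖w‖ with hw | hw
          · exact Or.inl ⟨w, hw, rfl⟩
          · exact Or.inr ⟨w, by simpa using hw, rfl⟩
        have hz2 := closure_mono hsub hz
        rw [closure_union] at hz2
        have hcomp : IsCompact (φ '' closedBall 0 1) :=
          (isCompact_closedBall (0 : ℂ) 1).image hd.continuous
        rcases hz2 with hz2 | hz2
        · exact hz1 hz2
        · rw [hcomp.isClosed.closure_eq] at hz2
          obtain ⟨w, -, rfl⟩ := hz2
          rw [h.eq w (mem_univ _)] at he
          exact OnePoint.coe_ne_infty _ he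
  have hopen : IsOpen (range φ) := by
    rw [← image_univ]; exact h.isOpen_image hF isOpen_univ
  have hsurj : Function.Surjective φ := by
    rw [← range_eq_univ]
    exact IsClopen.eq_univ ⟨hclosed, hopen⟩ (range_nonempty φ)
  choose f hf using hsurj
  have hFf : ∀ z, F z = f z := fun z => by
    conv_lhs => rw [← hf z]
    exact h.eq _ (mem_univ _)
  have hchart : ∀ z, DifferentiableAt ℂ f z ∧ deriv f z ≠ 0 := by
    intro z
    obtain ⟨g, h1, h2, h3⟩ := hF.exists_chart (hFf z)
    have e : f =ᶠ[𝓝 z] g := by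
      filter_upwards [h3] with w hw
      rwa [hFf, OnePoint.coe_eq_coe] at hw
    exact ⟨h1.differentiableAt.congr_of_eventuallyEq e, by rwa [e.deriv_eq]⟩
  have hinj : Function.Injective f := fun x y hxy => by rw [← hf x, hxy, hf y]
  obtain ⟨α, β, hα, h1⟩ := affine_of_proper (fun z => (hchart z).1) hinj (fun z => (hchart z).2) (by
    rw [Filter.tendsto_def]
    intro s hs
    obtain ⟨K, hK, hKs⟩ := mem_cocompact.1 hs
    refine mem_cocompact.2 ⟨φ '' K, hK.image hd.continuous, fun z hz => hKs fun hzK => ?_⟩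
    exact hz ⟨f z, hzK, hf z⟩)
  exact ⟨α, β, hα, fun z => by rw [hFf, h1]⟩

/-! ### The maximum principle in unbounded regions -/

/-- Maximum principle for a bounded holomorphic function on an unbounded region whose complement
contains a disc: the point at infinity may be ignored. -/
theorem norm_le_of_frontier {U : Set ℂ} {k : ℂ → ℂ} {z₀ : ℂ} {r B M : ℝ}
    (hr : 0 < r) (hext : Disjoint (ball z₀ r) U) (hk : DiffContOnCl ℂ k U) (hM : 0 < M)
    (hB : ∀ z ∈ U, ‖k z‖ ≤ B) (hfr : ∀ z ∈ frontier U, ‖k z‖ ≤ M) {z : ℂ} (hz : z ∈ U) :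
    ‖k z‖ ≤ M := by
  have hcl : ∀ y ∈ closure U, r ≤ ‖y - z₀‖ := by
    intro y hy
    by_contra h
    push Not at h
    have h1 : y ∈ ball z₀ r := by rwa [mem_ball, dist_eq_norm]
    exact (hext.closure_right isOpen_ball).le_bot ⟨h1, hy⟩
  have hne : ∀ y ∈ closure U, y - z₀ ≠ 0 := fun y hy =>
    norm_pos_iff.1 (hr.trans_le (hcl y hy))
  have hBcl : ∀ y ∈ closure U, ‖k y‖ ≤ max B M := by
    intro y hy
    by_cases hyU : y ∈ U
    · exact (hB y hyU).trans (le_max_left _ _)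
    · refine (hfr y ⟨hy, fun h => hyU (interior_subset h)⟩).trans (le_max_right _ _)
  have hB0 : 0 < max B M := lt_max_of_lt_right hM
  -- the factor `r / (z - z₀)` makes the function small near infinity, and high powers of `k` make
  -- the factor irrelevant
  have key : ∀ n : ℕ, ‖k z‖ ^ n ≤ M ^ n * (‖z - z₀‖ / r) := by
    intro n
    set R : ℝ := ‖z‖ + ‖z₀‖ + max B M ^ n * r / M ^ n + 1 with hR
    have hp : 0 < max B M ^ n * r / M ^ n := by positivity
    have hd : DiffContOnCl ℂ (fun y => k y ^ n * (r / (y - z₀))) (U ∩ ball 0 R) := by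
      constructor
      · exact (hk.differentiableOn.mono inter_subset_left).pow n |>.mul
          ((differentiableOn_const _).div (by fun_prop)
            fun y hy => hne y (subset_closure hy.1))
      · have hsub : closure (U ∩ ball 0 R) ⊆ closure U := closure_mono inter_subset_left
        exact (hk.continuousOn.mono hsub).pow n |>.mul
          (continuousOn_const.div (by fun_prop) fun y hy => hne y (hsub hy))
    have hzR : z ∈ closure (U ∩ ball 0 R) := by
      refine subset_closure ⟨hz, ?_⟩
      rw [mem_ball_zero_iff]
      have := norm_nonneg z₀
      linarith
    have hbd : ∀ y ∈ frontier (U ∩ ball 0 R), ‖k y ^ n * (r / (y - z₀))‖ ≤ M ^ n := by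
      intro y hy
      have hnorm : ‖k y ^ n * (r / (y - z₀))‖ = ‖k y‖ ^ n * (r / ‖y - z₀‖) := by
        rw [norm_mul, norm_pow, norm_div, Complex.norm_real, Real.norm_of_nonneg hr.le]
      rw [hnorm]
      rcases frontier_inter_subset _ _ hy with hy | hy
      · have h1 := hcl y hy.1.1
        have h2 : r / ‖y - z₀‖ ≤ 1 := div_le_one_of_le₀ h1 (norm_nonneg _)
        calc ‖k y‖ ^ n * (r / ‖y - z₀‖) ≤ M ^ n * 1 :=
              mul_le_mul (pow_le_pow_left₀ (norm_nonneg _) (hfr y hy.1) n) h2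
                (by positivity) (by positivity)
          _ = M ^ n := mul_one _
      · have hyR : ‖y‖ = R := by
          have := frontier_ball_subset_sphere hy.2
          rwa [mem_sphere_zero_iff_norm] at this
        have h1 : max B M ^ n * r / M ^ n ≤ ‖y - z₀‖ := by
          have := norm_sub_norm_le y z₀
          rw [hyR] at this
          have := norm_nonneg z
          linarith
        have h2 : 0 < ‖y - z₀‖ := hp.trans_le h1
        rw [← mul_div_assoc, div_le_iff₀ h2]
        rw [div_le_iff₀ (by positivity)] at h1
        calc ‖k y‖ ^ n * r ≤ max B M ^ n * r :=
              mul_le_mul_of_nonneg_right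
                (pow_le_pow_left₀ (norm_nonneg _) (hBcl y hy.1) n) hr.le
          _ ≤ M ^ n * ‖y - z₀‖ := by linarith [mul_comm (M ^ n) ‖y - z₀‖]
    have := Complex.norm_le_of_forall_mem_frontier_norm_le
      (isBounded_ball.subset inter_subset_right) hd hbd hzR
    rw [norm_mul, norm_pow, norm_div, Complex.norm_real, Real.norm_of_nonneg hr.le] at this
    have h2 : 0 < ‖z - z₀‖ := norm_pos_iff.2 (hne z (subset_closure hz))
    rw [← mul_div_assoc, div_le_iff₀ h2] at this
    rw [← mul_div_assoc, le_div_iff₀ hr]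
    exact this
  by_contra h
  push Not at h
  have h1 : 1 < ‖k z‖ / M := by rwa [one_lt_div hM]
  obtain ⟨n, hn⟩ := pow_unbounded_of_one_lt (‖z - z₀‖ / r) h1
  rw [div_pow, lt_div_iff₀ (by positivity)] at hn
  have := key n
  linarith [mul_comm (M ^ n) (‖z - z₀‖ / r)]

/-- The affine coordinate on the sphere, with the value `0` at infinity. -/
def finPart (x : OnePoint ℂ) : ℂ := x.elim 0 id

@[simp] theorem finPart_coe (w : ℂ) : finPart w = w := rfl

theorem coe_finPart {x : OnePoint ℂ} (h : x ≠ OnePoint.infty) : (finPart x : OnePoint ℂ) = x := by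
  induction x using OnePoint.rec with
  | infty => exact absurd rfl h
  | coe w => rfl

theorem LocUniv.differentiableAt_finPart (hF : LocUniv F) {z : ℂ} (h : F z ≠ OnePoint.infty) :
    DifferentiableAt ℂ (fun w => finPart (F w)) z ∧ deriv (fun w => finPart (F w)) z ≠ 0 := by
  obtain ⟨g, h1, h2, h3⟩ := hF.exists_chart (coe_finPart h).symm
  have e : (fun w => finPart (F w)) =ᶠ[𝓝 z] g := by
    filter_upwards [h3] with w hw
    rw [hw, finPart_coe]
  exact ⟨h1.differentiableAt.congr_of_eventuallyEq e, by rwa [e.deriv_eq]⟩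

/-- The Möbius transformation `v ↦ 1 / (v - w)`. -/
noncomputable def invSub (w : ℂ) : GL (Fin 2) ℂ :=
  Matrix.GeneralLinearGroup.mkOfDetNeZero !![0, 1; 1, -w] (by
    rw [Matrix.det_fin_two_of]; simp)

theorem invSub_coe {w v : ℂ} (h : v ≠ w) :
    invSub w • (v : OnePoint ℂ) = (((v - w)⁻¹ : ℂ) : OnePoint ℂ) := by
  rw [smul_coe]
  simp [invSub, Matrix.GeneralLinearGroup.mkOfDetNeZero, ratio, ← sub_eq_add_neg, sub_ne_zero.2 h]

theorem invSub_self (w : ℂ) : invSub w • (w : OnePoint ℂ) = OnePoint.infty := by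
  rw [smul_coe]
  simp [invSub, Matrix.GeneralLinearGroup.mkOfDetNeZero, ratio]

theorem invSub_infty (w : ℂ) :
    invSub w • (OnePoint.infty : OnePoint ℂ) = ((0 : ℂ) : OnePoint ℂ) := by
  rw [smul_infty]
  simp [invSub, Matrix.GeneralLinearGroup.mkOfDetNeZero, ratio]

theorem norm_finPart_invSub_le {w : ℂ} {η : ℝ} (hη : 0 < η) {x : OnePoint ℂ}
    (h : ∀ v : ℂ, x = v → η ≤ ‖v - w‖) : ‖finPart (invSub w • x)‖ ≤ 1 / η := by
  induction x using OnePoint.rec with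
  | infty =>
    rw [invSub_infty]
    simpa using hη.le
  | coe v =>
    have h1 := h v rfl
    have h2 : v ≠ w := by
      rintro rfl
      simp at h1
      linarith
    rw [invSub_coe h2, finPart_coe, norm_inv, ← one_div]
    exact one_div_le_one_div_of_le hη h1

theorem exists_ball_of_isOpen {s : Set (OnePoint ℂ)} (hs : IsOpen s) {c : ℂ}
    (hc : (c : OnePoint ℂ) ∈ s) : ∃ δ > 0, ∀ v ∈ ball c δ, (v : OnePoint ℂ) ∈ s := by
  obtain ⟨δ, hδ, h⟩ := Metric.isOpen_iff.1 (hs.preimage OnePoint.continuous_coe) c hc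
  exact ⟨δ, hδ, fun v hv => h hv⟩

/-- Local step of the moving pole argument: if the values of `F` on `U` omit a neighbourhood of a
point close to `c`, where closeness depends only on the boundary values, they omit a neighbourhood
of `c`. -/
theorem LocUniv.exists_nhds_omitted (hF : LocUniv F) {U : Set ℂ} {z₀ : ℂ} {r : ℝ}
    (hr : 0 < r) (hext : Disjoint (ball z₀ r) U) {K : Set (OnePoint ℂ)} (hK : IsClosed K)
    (hfr : ∀ z ∈ frontier U, F z ∈ K) {c : ℂ} (hc : (c : OnePoint ℂ) ∉ K) :
    ∃ N ∈ 𝓝 (c : OnePoint ℂ), ∀ x ∈ N, x ∉ closure (F '' U) →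
      (c : OnePoint ℂ) ∉ closure (F '' U) := by
  obtain ⟨δ, hδ, hδK⟩ := exists_ball_of_isOpen hK.isOpen_compl hc
  refine ⟨(↑) '' ball c (δ / 2), ?_, ?_⟩
  · exact (OnePoint.isOpen_image_coe.2 isOpen_ball).mem_nhds
      (mem_image_of_mem _ (mem_ball_self (half_pos hδ)))
  rintro _ ⟨w, hw, rfl⟩ hwU
  obtain ⟨η, hη, hηU⟩ := exists_ball_of_isOpen isClosed_closure.isOpen_compl hwU
  have hne : ∀ z ∈ closure U, invSub w • F z ≠ OnePoint.infty := by
    intro z hz h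
    rw [← invSub_self w, smul_left_cancel_iff] at h
    refine hwU ?_
    rw [← h]
    exact closure_mono (Subset.rfl) (hF.continuous.continuousWithinAt.mem_closure_image hz)
  have hd : ∀ z ∈ closure U, DifferentiableAt ℂ (fun z => finPart (invSub w • F z)) z :=
    fun z hz => ((hF.smul (invSub w)).differentiableAt_finPart (hne z hz)).1
  have hk : DiffContOnCl ℂ (fun z => finPart (invSub w • F z)) U :=
    DifferentiableOn.diffContOnCl fun z hz => (hd z hz).differentiableWithinAt
  have hfrb : ∀ z ∈ frontier U, ‖finPart (invSub w • F z)‖ ≤ 1 / (δ / 2) := by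
    intro z hz
    refine norm_finPart_invSub_le (half_pos hδ) fun v hv => ?_
    by_contra h
    push Not at h
    refine hδK v ?_ (hv ▸ hfr z hz)
    rw [mem_ball, dist_eq_norm]
    rw [mem_ball, dist_eq_norm] at hw
    calc ‖v - c‖ = ‖(v - w) + (w - c)‖ := by ring_nf
      _ ≤ ‖v - w‖ + ‖w - c‖ := norm_add_le _ _
      _ < δ := by linarith
  have hB : ∀ z ∈ U, ‖finPart (invSub w • F z)‖ ≤ 1 / η := by
    intro z hz
    refine norm_finPart_invSub_le hη fun v hv => ?_
    by_contra h
    push Not at h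
    refine hηU v (by rwa [mem_ball, dist_eq_norm]) ?_
    rw [← hv]
    exact subset_closure (mem_image_of_mem F hz)
  have hall : ∀ z ∈ U, ∀ v : ℂ, F z = v → δ / 2 ≤ ‖v - w‖ := by
    intro z hz v hv
    have h1 := norm_le_of_frontier hr hext hk (by positivity) hB hfrb hz
    have h2 : v ≠ w := by
      rintro rfl
      exact hne z (subset_closure hz) (by rw [hv, invSub_self])
    simp only [hv, invSub_coe h2, finPart_coe] at h1
    rw [norm_inv, ← one_div] at h1
    exact (one_div_le_one_div (norm_pos_iff.2 (sub_ne_zero.2 h2)) (half_pos hδ)).1 h1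
  intro hcl
  have hN : ((↑) '' ball w (δ / 2) : Set (OnePoint ℂ)) ∈ 𝓝 (c : OnePoint ℂ) :=
    (OnePoint.isOpen_image_coe.2 isOpen_ball).mem_nhds (mem_image_of_mem _ (by
      rwa [mem_ball, dist_comm]))
  obtain ⟨_, ⟨v, hv, hvz⟩, ⟨z, hz, rfl⟩⟩ := mem_closure_iff_nhds.1 hcl _ hN
  rw [mem_ball, dist_eq_norm] at hv
  linarith [hall z hz v hvz.symm]

/-- Moving the pole: if the boundary values of `F` on a region whose complement contains a disc lie
in a compact set with connected complement, then the values of `F` in the region are dense in this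
complement, as soon as one of them lies in it. -/
theorem LocUniv.subset_closure_image (hF : LocUniv F) {U : Set ℂ} {z₀ : ℂ} {r : ℝ}
    (hr : 0 < r) (hext : Disjoint (ball z₀ r) U) {K : Set (OnePoint ℂ)} (hK : IsClosed K)
    (hKc : IsPreconnected Kᶜ) (hfr : ∀ z ∈ frontier U, F z ∈ K) (hne : ∃ z ∈ U, F z ∉ K) :
    Kᶜ ⊆ closure (F '' U) := by
  have hnhds : ∀ x ∈ Kᶜ, ∃ N ∈ 𝓝 x, ∀ y ∈ N, y ∉ closure (F '' U) → x ∉ closure (F '' U) := by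
    intro x hx
    obtain ⟨A, c, hAc⟩ := LocUniv.exists_smul_eq_coe x
    have himg : ∀ s : Set (OnePoint ℂ), ∀ y, A • y ∈ mobiusHomeo A '' s ↔ y ∈ s := by
      intro s y
      rw [← mobiusHomeo_apply, (mobiusHomeo A).injective.mem_set_image]
    have hcl : closure ((fun z => A • F z) '' U) = mobiusHomeo A '' closure (F '' U) := by
      rw [Homeomorph.image_closure, image_image]; rfl
    obtain ⟨N, hN, h⟩ := (hF.smul A).exists_nhds_omitted hr hext
      (K := mobiusHomeo A '' K) ((mobiusHomeo A).isClosed_image.2 hK)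
      (fun z hz => (himg K _).2 (hfr z hz)) (c := c) (by rw [← hAc, himg]; exact hx)
    refine ⟨(mobiusHomeo A) ⁻¹' N, ?_, ?_⟩
    · exact (mobiusHomeo A).continuous.continuousAt (by rwa [mobiusHomeo_apply, hAc])
    · intro y hy hyU
      have := h _ hy (by rw [hcl, mobiusHomeo_apply, himg]; exact hyU)
      rwa [hcl, ← hAc, himg] at this
  by_contra hcon
  rw [not_subset] at hcon
  obtain ⟨x, hx, hxU⟩ := hcon
  have hsub : Kᶜ ⊆ (closure (F '' U))ᶜ := by
    refine hKc.subset_of_closure_inter_subset isClosed_closure.isOpen_compl ⟨x, hx, hxU⟩ ?_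
    rintro y ⟨hy, hyK⟩
    obtain ⟨N, hN, h⟩ := hnhds y hyK
    obtain ⟨y', h1, h2⟩ := mem_closure_iff_nhds.1 hy N hN
    exact h y' h1 h2
  obtain ⟨z, hz, hzK⟩ := hne
  exact hsub hzK (subset_closure (mem_image_of_mem F hz))

/-- The values of a locally univalent map of the plane are dense in the sphere. -/
theorem LocUniv.dense_range (hF : LocUniv F) : Dense (range F) := by
  intro e
  by_contra he
  obtain ⟨A, hA⟩ : ∃ A : GL (Fin 2) ℂ, A • e = OnePoint.infty := by
    induction e using OnePoint.rec with
    | infty => exact ⟨1, one_smul _ _⟩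
    | coe c => exact ⟨invSub c, invSub_self c⟩
  have hG := hF.smul A
  have h1 : (mobiusHomeo A) '' (closure (range F))ᶜ ∈ 𝓝 (OnePoint.infty : OnePoint ℂ) := by
    rw [← hA]
    exact ((mobiusHomeo A).isOpen_image.2 isClosed_closure.isOpen_compl).mem_nhds
      ⟨e, he, rfl⟩
  obtain ⟨s, ⟨-, hs⟩, hsub⟩ := OnePoint.hasBasis_nhds_infty.mem_iff.1 h1
  have h2 : ∀ z, A • F z ∉ (mobiusHomeo A) '' (closure (range F))ᶜ := by
    intro z
    rw [← mobiusHomeo_apply, (mobiusHomeo A).injective.mem_set_image, notMem_compl_iff]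
    exact subset_closure (mem_range_self z)
  have h3 : ∀ z, A • F z ≠ OnePoint.infty := fun z hz => h2 z (hsub (Or.inr hz))
  have h4 : ∀ z, finPart (A • F z) ∈ s := by
    intro z
    by_contra h
    exact h2 z (hsub (Or.inl ⟨_, h, coe_finPart (h3 z)⟩))
  have h5 : Differentiable ℂ fun z => finPart (A • F z) := fun z =>
    (hG.differentiableAt_finPart (h3 z)).1
  have h6 := fun z w => h5.apply_eq_apply_of_bounded
    (hs.isBounded.subset (range_subset_iff.2 h4)) z w
  have h7 : (fun z => finPart (A • F z)) = fun _ => finPart (A • F 0) := by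
    ext z; exact h6 z 0
  apply (hG.differentiableAt_finPart (h3 0)).2
  rw [h7]; simp

/-! ### Separation of the plane by a disc with two singular boundary points -/

theorem isSimplyConnected_univ_complex : IsSimplyConnected (univ : Set ℂ) := by
  rw [IsSimplyConnected]
  have : ContractibleSpace (univ : Set ℂ) :=
    (Homeomorph.Set.univ ℂ).toHomotopyEquiv.contractibleSpace
  infer_instance

theorem LocUniv.of_differentiable {f : ℂ → ℂ} (hf : Differentiable ℂ f) (hd : ∀ z, deriv f z ≠ 0) :
    LocUniv fun z => (f z : OnePoint ℂ) := fun z =>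
  ⟨1, f, hf.analyticAt z, hd z, Eventually.of_forall fun _ => (one_smul _ _).symm⟩

/-- If the frontier of a connected open subset `D` of the plane is the union of two disjoint closed
pieces, then its complement is the union of two disjoint closed pieces containing these. -/
theorem exists_separation {D : Set ℂ} (hDo : IsOpen D) (hD : IsPreconnected D)
    {C₁ C₂ : Set ℂ} (h1 : IsClosed C₁) (h2 : IsClosed C₂) (hdisj : Disjoint C₁ C₂)
    (hfr : frontier D ⊆ C₁ ∪ C₂) :
    ∃ G₁ G₂ : Set ℂ, IsClosed G₁ ∧ IsClosed G₂ ∧ Disjoint G₁ G₂ ∧ G₁ ∪ G₂ = Dᶜ ∧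
      frontier D ∩ C₁ ⊆ G₁ ∧ frontier D ∩ C₂ ⊆ G₂ := by
  classical
  obtain ⟨ω, hω0, hω1, -⟩ := exists_continuous_zero_one_of_isClosed h2 h1 hdisj.symm
  rcases D.eq_empty_or_nonempty with rfl | ⟨d, hd⟩
  · exact ⟨univ, ∅, isClosed_univ, isClosed_empty, by simp, by simp, by simp, by simp⟩
  -- the function `exp (2 π i ω)` on `D`, continued by `1`, has a continuous logarithm
  let h : ℂ → ℂ := fun z => if z ∈ D then Complex.exp (2 * Real.pi * Complex.I * ω z) else 1
  have hcont : Continuous h := by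
    refine Continuous.if ?_ (by fun_prop) continuous_const
    intro z hz
    rcases hfr hz with hz1 | hz2
    · have : ω z = 1 := hω1 hz1
      simp [this, Complex.exp_two_pi_mul_I]
    · have : ω z = 0 := hω0 hz2
      simp [this]
  obtain ⟨L, hL, hexp⟩ := Complex.exists_continuousOn_eqOn_exp_comp isSimplyConnected_univ_complex
    isOpen_univ (g := h) hcont.continuousOn (by
      rintro ⟨z, -, hz⟩
      simp only [h] at hz
      split_ifs at hz
      · exact Complex.exp_ne_zero _ hz
      · exact one_ne_zero hz)
  have hL : Continuous L := continuousOn_univ.1 hL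
  have hexp : ∀ z, Complex.exp (L z) = h z := fun z => hexp (mem_univ z)
  have hpi : (2 * Real.pi * Complex.I : ℂ) ≠ 0 := Complex.two_pi_I_ne_zero
  -- on `D` the logarithm differs from `2 π i ω` by a constant
  have hconst : ∀ z ∈ D, L z - 2 * Real.pi * Complex.I * ω z =
      L d - 2 * Real.pi * Complex.I * ω d := by
    have hG : LocUniv fun z => (Complex.exp z : OnePoint ℂ) :=
      LocUniv.of_differentiable Complex.differentiable_exp fun z => by
        rw [Complex.deriv_exp]; exact Complex.exp_ne_zero z
    have hone : ∀ z ∈ D, Complex.exp (L z - 2 * Real.pi * Complex.I * ω z) = 1 := by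
      intro z hz
      rw [Complex.exp_sub, hexp z]
      simp only [h, if_pos hz]
      exact div_self (Complex.exp_ne_zero _)
    exact (T2Space.isSeparatedMap _).eqOn_of_comp_eqOn hG.isLocallyInjective hD
      (g₁ := fun z => L z - 2 * Real.pi * Complex.I * ω z)
      (g₂ := fun _ => L d - 2 * Real.pi * Complex.I * ω d) (by fun_prop) continuousOn_const
      (fun z hz => by simp only [Function.comp, hone z hz, hone d hd]) hd rfl
  obtain ⟨m₀, hm₀⟩ : ∃ m : ℤ, L d - 2 * Real.pi * Complex.I * ω d =
      m * (2 * Real.pi * Complex.I) := by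
    have := hexp d
    simp only [h, if_pos hd] at this
    obtain ⟨n, hn⟩ := Complex.exp_eq_exp_iff_exists_int.1 this
    exact ⟨n, by rw [hn]; ring⟩
  have hcl : ∀ z ∈ closure D, L z = m₀ * (2 * Real.pi * Complex.I) +
      2 * Real.pi * Complex.I * ω z := by
    have hcl : IsClosed {z | L z = m₀ * (2 * Real.pi * Complex.I) +
        2 * Real.pi * Complex.I * ω z} := isClosed_eq hL (by fun_prop)
    refine fun z hz => hcl.closure_subset_iff.2 (fun z hz => ?_) hz
    rw [mem_ofPred_eq, ← hm₀, ← hconst z hz]; ring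
  have hoff : ∀ z ∉ D, ∃ n : ℤ, L z = n * (2 * Real.pi * Complex.I) := by
    intro z hz
    have := hexp z
    simp only [h, if_neg hz] at this
    exact Complex.exp_eq_one_iff.1 this
  set m₁ : ℂ := (m₀ + 1) * (2 * Real.pi * Complex.I) with hm₁
  have hoff2 : ∀ z ∉ D, L z ≠ m₁ → 1 ≤ ‖L z - m₁‖ := by
    intro z hz hne
    obtain ⟨n, hn⟩ := hoff z hz
    have e : L z - m₁ = ((n - (m₀ + 1) : ℤ) : ℂ) * (2 * Real.pi * Complex.I) := by
      rw [hn, hm₁]; push_cast; ring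
    have hn0 : n - (m₀ + 1) ≠ 0 := by
      intro h0
      rw [h0] at e
      exact hne (sub_eq_zero.1 (by simpa using e))
    have h3 : (1 : ℝ) ≤ |((n - (m₀ + 1) : ℤ) : ℝ)| := by
      exact_mod_cast Int.one_le_abs hn0
    have h4 : ‖(2 * Real.pi * Complex.I : ℂ)‖ = 2 * Real.pi := by
      simp [abs_of_pos Real.pi_pos]
    rw [e, norm_mul, h4, Complex.norm_intCast]
    nlinarith [Real.pi_gt_three]
  have hDc : IsClosed Dᶜ := hDo.isClosed_compl
  refine ⟨Dᶜ ∩ {z | L z = m₁}, Dᶜ ∩ {z | 1 ≤ ‖L z - m₁‖},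
    hDc.inter (isClosed_eq hL continuous_const),
    hDc.inter (isClosed_le continuous_const (by fun_prop)), ?_, ?_, ?_, ?_⟩
  · rw [Set.disjoint_left]
    rintro z ⟨-, hz⟩ ⟨-, hz'⟩
    rw [mem_ofPred_eq] at hz hz'
    rw [hz, sub_self, norm_zero] at hz'
    linarith
  · rw [← inter_union_distrib_left, inter_eq_left]
    intro z hz
    by_cases hz' : L z = m₁
    · exact Or.inl hz'
    · exact Or.inr (hoff2 z hz hz')
  · rintro z ⟨hz, hz1⟩
    have hzD : z ∉ D := fun h' => hz.2 (hDo.interior_eq.symm ▸ h')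
    refine ⟨hzD, ?_⟩
    have : ω z = 1 := hω1 hz1
    rw [mem_ofPred_eq, hcl z hz.1, this, hm₁]; push_cast; ring
  · rintro z ⟨hz, hz2⟩
    have hzD : z ∉ D := fun h' => hz.2 (hDo.interior_eq.symm ▸ h')
    refine ⟨hzD, hoff2 z hzD ?_⟩
    have : ω z = 0 := hω0 hz2
    rw [hcl z hz.1, this, hm₁]
    intro h'
    apply hpi
    push_cast at h'
    linear_combination -h'

/-- For any two points of the plane there is a path joining them such that, for points `t₁ ≤ t₂` on
it, the spherical distance from the beginning to `t₁` and that from `t₂` to the end have a sum less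
than `d`. This is what is used of the diameter of the pulled back metric being less than `d`. -/
def Linked (F : ℂ → OnePoint ℂ) (d : ℝ) : Prop :=
  ∀ y₁ y₂ : ℂ, ∃ γ : ℝ → ℂ, ContinuousOn γ (Icc 0 1) ∧ γ 0 = y₁ ∧ γ 1 = y₂ ∧
    ∀ t₁ t₂, 0 ≤ t₁ → t₁ ≤ t₂ → t₂ ≤ 1 →
      angDist (F y₁) (F (γ t₁)) + angDist (F (γ t₂)) (F y₂) < d

theorem Linked.smul_toInfty {d : ℝ} (h : Linked F d) (p : ℂ) :
    Linked (fun z => toInfty p • F z) d := by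
  intro y₁ y₂
  obtain ⟨γ, h1, h2, h3, h4⟩ := h y₁ y₂
  exact ⟨γ, h1, h2, h3, by simpa only [angDist_toInfty] using h4⟩

theorem continuous_angDist_prod :
    Continuous fun p : OnePoint ℂ × OnePoint ℂ => angDist p.1 p.2 := by
  have h1 := continuous_stereoC
  have h2 := continuous_stereoR
  refine Real.continuous_arccos.comp (Continuous.add (Complex.continuous_re.comp ?_) (by fun_prop))
  exact (h1.comp continuous_fst).mul (Complex.continuous_conj.comp (h1.comp continuous_snd))

theorem LocUniv.isOpenMap (hF : LocUniv F) : IsOpenMap F := by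
  rw [isOpenMap_iff_nhds_le]
  intro z s hs
  obtain ⟨A, c, hA⟩ := LocUniv.exists_smul_eq_coe (F z)
  obtain ⟨r, hr, χ, h1, h2, -⟩ := (hF.smul A).exists_local_section hA
  have hc : ContinuousAt χ c := h1.cont.continuousAt (ball_mem_nhds c hr)
  have hs' : F ⁻¹' s ∈ 𝓝 (χ c) := by rw [h2]; exact hs
  have h3 : ∀ᶠ w in 𝓝 c, w ∈ ball c r ∧ χ w ∈ F ⁻¹' s :=
    Filter.Eventually.and (ball_mem_nhds c hr) (hc hs')
  have h4 : mobiusHomeo A '' s ∈ 𝓝 (c : OnePoint ℂ) := by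
    rw [OnePoint.nhds_coe_eq, mem_map]
    filter_upwards [h3] with w hw
    exact ⟨F (χ w), hw.2, h1.eq w hw.1⟩
  have h5 := (mobiusHomeo A).continuous.continuousAt (x := F z)
    (by rwa [mobiusHomeo_apply, hA] : mobiusHomeo A '' s ∈ 𝓝 (mobiusHomeo A (F z)))
  rwa [mem_map, preimage_image_eq _ (mobiusHomeo A).injective] at h5

/-- A subset of the frontier of a connected region whose exterior is connected has connected
complement, unless it is the whole frontier. -/
theorem isPreconnected_compl_of_subset_frontier {X : Type*} [TopologicalSpace X] {O A : Set X}
    (hO : IsPreconnected O) (hOo : IsOpen O) (hE : IsPreconnected (closure O)ᶜ)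
    (hEcl : frontier O ⊆ closure (closure O)ᶜ) (hA : A ⊆ frontier O)
    (hne : (frontier O \ A).Nonempty) : IsPreconnected Aᶜ := by
  have e : Aᶜ = (O ∪ (frontier O \ A)) ∪ ((closure O)ᶜ ∪ (frontier O \ A)) := by
    ext x
    rw [hOo.frontier_eq] at hA ⊢
    constructor
    · intro hx
      by_cases h1 : x ∈ O
      · exact Or.inl (Or.inl h1)
      · by_cases h2 : x ∈ closure O
        · exact Or.inl (Or.inr ⟨⟨h2, h1⟩, hx⟩)
        · exact Or.inr (Or.inl h2)
    · rintro ((h1 | h1) | (h1 | h1)) hx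
      · exact (hA hx).2 h1
      · exact h1.2 hx
      · exact h1 (hA hx).1
      · exact h1.2 hx
  obtain ⟨b, hb⟩ := hne
  rw [e]
  refine IsPreconnected.union b (Or.inr hb) (Or.inr hb) ?_ ?_
  · exact hO.subset_closure subset_union_left
      (union_subset subset_closure fun x hx => hx.1.1)
  · exact hE.subset_closure subset_union_left
      (union_subset subset_closure fun x hx => hEcl hx.1)

/-! ### The distance estimate for separating sections -/

/-- A nonempty region of the plane whose exterior in the sphere is connected and accumulates at
every boundary point. -/
structure IsRegion (Ω : Set ℂ) : Prop where
  isOpen : IsOpen Ω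
  nonempty : Ω.Nonempty
  preconn : IsPreconnected Ω
  exterior : IsPreconnected (closure ((↑) '' Ω : Set (OnePoint ℂ)))ᶜ
  frontier_subset : frontier ((↑) '' Ω : Set (OnePoint ℂ)) ⊆
    closure (closure ((↑) '' Ω : Set (OnePoint ℂ)))ᶜ

/-- The boundary of `Ω` is the union of two closed pieces, none of which contains the other, such
that the points common to both pieces are singular for the section `φ`. -/
structure IsSplit (F : ℂ → OnePoint ℂ) (Ω : Set ℂ) (φ : ℂ → ℂ) (A₁ A₂ : Set (OnePoint ℂ)) :
    Prop where
  closed₁ : IsClosed A₁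
  closed₂ : IsClosed A₂
  eq_union : A₁ ∪ A₂ = frontier ((↑) '' Ω : Set (OnePoint ℂ))
  sing : ∀ b ∈ A₁, b ∈ A₂ → SingAt F Ω φ b
  nonempty₁ : (A₁ \ A₂).Nonempty
  nonempty₂ : (A₂ \ A₁).Nonempty

theorem IsSplit.symm {Ω : Set ℂ} {φ : ℂ → ℂ} {A₁ A₂ : Set (OnePoint ℂ)}
    (h : IsSplit F Ω φ A₁ A₂) : IsSplit F Ω φ A₂ A₁ :=
  ⟨h.closed₂, h.closed₁, union_comm A₂ A₁ ▸ h.eq_union, fun b h1 h2 => h.sing b h2 h1,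
    h.nonempty₂, h.nonempty₁⟩

theorem IsSec.mem_frontier_of_mem_frontier (hF : LocUniv F) {Ω : Set ℂ} {φ : ℂ → ℂ}
    (hΩ : IsOpen Ω) (h : IsSec F Ω φ) {z : ℂ} (hz : z ∈ frontier (φ '' Ω)) :
    F z ∈ frontier ((↑) '' Ω : Set (OnePoint ℂ)) := by
  rw [(h.isOpen_image hF hΩ).frontier_eq] at hz
  rw [(OnePoint.isOpen_image_coe.2 hΩ).frontier_eq]
  constructor
  · refine map_mem_closure hF.continuous hz.1 ?_
    rintro _ ⟨w, hw, rfl⟩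
    exact ⟨w, hw, (h.eq w hw).symm⟩
  · rintro ⟨w, hw, he⟩
    exact hz.2 ⟨w, hw, h.eq_of_mem_closure hF hΩ hz.1 hw he.symm⟩

/-- Near a frontier point of the image of a section there are points whose value lies in the
exterior of the domain. -/
theorem IsSec.exists_mem_exterior (hF : LocUniv F) {Ω : Set ℂ} {φ : ℂ → ℂ}
    (hΩ : IsRegion Ω) (h : IsSec F Ω φ) {z : ℂ} (hz : z ∈ frontier (φ '' Ω)) {N : Set ℂ}
    (hN : N ∈ 𝓝 z) : ∃ y ∈ N, F y ∉ closure ((↑) '' Ω : Set (OnePoint ℂ)) := by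
  have h1 := hΩ.frontier_subset (h.mem_frontier_of_mem_frontier hF hΩ.isOpen hz)
  have h2 : F '' N ∈ 𝓝 (F z) := hF.isOpenMap.image_mem_nhds hN
  obtain ⟨_, ⟨y, hy, rfl⟩, hy'⟩ := mem_closure_iff_nhds.1 h1 _ h2
  exact ⟨y, hy, hy'⟩

theorem IsSec.notMem_closure_image (hF : LocUniv F) {Ω : Set ℂ} {φ : ℂ → ℂ}
    (h : IsSec F Ω φ) {z : ℂ} (hz : F z ∉ closure ((↑) '' Ω : Set (OnePoint ℂ))) :
    z ∉ closure (φ '' Ω) := by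
  intro h1
  refine hz (map_mem_closure hF.continuous h1 ?_)
  rintro _ ⟨w, hw, rfl⟩
  exact ⟨w, hw, (h.eq w hw).symm⟩

theorem IsSplit.isPreconnected_compl {Ω : Set ℂ} {φ : ℂ → ℂ} {A₁ A₂ : Set (OnePoint ℂ)}
    (hΩ : IsRegion Ω) (h : IsSplit F Ω φ A₁ A₂) : IsPreconnected A₁ᶜ := by
  refine isPreconnected_compl_of_subset_frontier
    (O := ((↑) '' Ω : Set (OnePoint ℂ))) (hΩ.preconn.image _ OnePoint.continuous_coe.continuousOn)
    (OnePoint.isOpen_image_coe.2 hΩ.isOpen) hΩ.exterior hΩ.frontier_subset ?_ ?_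
  · rw [← h.eq_union]; exact subset_union_left
  · obtain ⟨b, hb⟩ := h.nonempty₂
    exact ⟨b, h.eq_union ▸ Or.inr hb.1, hb.2⟩

/-- Each boundary piece is attained on the frontier of the image of the section. -/
theorem IsSplit.exists_mem_frontier (hF : LocUniv F) {Ω : Set ℂ} {φ : ℂ → ℂ}
    (hΩ : IsRegion Ω) (h : IsSec F Ω φ) {A₁ A₂ : Set (OnePoint ℂ)} (hA : IsSplit F Ω φ A₁ A₂) :
    ∃ z ∈ frontier (φ '' Ω), F z ∈ A₁ := by
  have hE : ((closure ((↑) '' Ω : Set (OnePoint ℂ)))ᶜ).Nonempty := by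
    obtain ⟨b, hb⟩ := hA.nonempty₁
    exact closure_nonempty_iff.1 ⟨b, hΩ.frontier_subset (hA.eq_union ▸ Or.inl hb.1)⟩
  have hDne : (φ '' Ω).Nonempty := hΩ.nonempty.image φ
  obtain ⟨z, hz⟩ : (frontier (φ '' Ω)).Nonempty := by
    rw [nonempty_frontier_iff]
    refine ⟨hDne, fun hu => ?_⟩
    obtain ⟨_, hy, ⟨z, rfl⟩⟩ := hF.dense_range.inter_open_nonempty _
      isClosed_closure.isOpen_compl hE
    exact h.notMem_closure_image hF hy (subset_closure (hu ▸ mem_univ z))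
  by_contra hcon
  push Not at hcon
  obtain ⟨y, -, hy⟩ := h.exists_mem_exterior hF hΩ hz univ_mem
  obtain ⟨r, hr, hball⟩ := Metric.isOpen_iff.1 isClosed_closure.isOpen_compl y
    (h.notMem_closure_image hF hy)
  have hsub := hF.subset_closure_image hr (U := φ '' Ω)
    (disjoint_left.2 fun x hx hx' => hball hx (subset_closure hx')) hA.closed₂
    (hA.symm.isPreconnected_compl hΩ) (fun x hx => by
      have := h.mem_frontier_of_mem_frontier hF hΩ.isOpen hx
      rw [← hA.eq_union] at this
      exact this.resolve_left (hcon x hx)) (by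
      obtain ⟨w, hw⟩ := hΩ.nonempty
      refine ⟨φ w, mem_image_of_mem _ hw, fun h' => ?_⟩
      have h1 : F (φ w) ∈ frontier ((↑) '' Ω : Set (OnePoint ℂ)) := hA.eq_union ▸ Or.inr h'
      rw [(OnePoint.isOpen_image_coe.2 hΩ.isOpen).frontier_eq, h.eq w hw] at h1
      exact h1.2 (mem_image_of_mem _ hw))
  obtain ⟨e, he⟩ := hE
  have heA : e ∈ A₂ᶜ := by
    intro h'
    have h1 : e ∈ frontier ((↑) '' Ω : Set (OnePoint ℂ)) := hA.eq_union ▸ Or.inr h'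
    exact he (frontier_subset_closure h1)
  refine he (closure_mono ?_ (hsub heA))
  rintro _ ⟨_, ⟨w, hw, rfl⟩, rfl⟩
  exact ⟨w, hw, (h.eq w hw).symm⟩

/-- The complement of the image of a section splits according to a splitting of the boundary. The
first part takes values arbitrarily close to every point outside the first boundary piece. -/
theorem IsSplit.exists_separation (hF : LocUniv F) {Ω : Set ℂ} {φ : ℂ → ℂ}
    (hΩ : IsRegion Ω) (h : IsSec F Ω φ) {A₁ A₂ : Set (OnePoint ℂ)} (hA : IsSplit F Ω φ A₁ A₂) :
    ∃ G₁ G₂ : Set ℂ, IsClosed G₁ ∧ Disjoint G₁ G₂ ∧ G₁ ⊆ (φ '' Ω)ᶜ ∧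
      (∀ z ∈ frontier G₁, z ∈ frontier (φ '' Ω) ∧ F z ∈ A₁) ∧
      (∀ z ∈ frontier (φ '' Ω), F z ∈ A₂ → z ∈ G₂) ∧
      ∀ w ∉ A₁, w ∈ closure (F '' G₁) := by
  have hDo := h.isOpen_image hF hΩ.isOpen
  have hD := hΩ.preconn.image φ h.cont
  obtain ⟨G₁, G₂, c1, c2, hd, hu, hs1, hs2⟩ := SphericalMetric.exists_separation hDo hD
    (C₁ := closure (φ '' Ω) ∩ F ⁻¹' A₁) (C₂ := closure (φ '' Ω) ∩ F ⁻¹' A₂)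
    (isClosed_closure.inter (hA.closed₁.preimage hF.continuous))
    (isClosed_closure.inter (hA.closed₂.preimage hF.continuous))
    (disjoint_left.2 fun z h1 h2 => hA.sing _ h1.2 h2.2 z h1.1 rfl) (by
      intro z hz
      have h1 := h.mem_frontier_of_mem_frontier hF hΩ.isOpen hz
      rw [← hA.eq_union] at h1
      exact h1.imp (fun h2 => ⟨hz.1, h2⟩) (fun h2 => ⟨hz.1, h2⟩))
  have hs1 : ∀ z ∈ frontier (φ '' Ω), F z ∈ A₁ → z ∈ G₁ := fun z hz h' => hs1 ⟨hz, hz.1, h'⟩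
  have hs2 : ∀ z ∈ frontier (φ '' Ω), F z ∈ A₂ → z ∈ G₂ := fun z hz h' => hs2 ⟨hz, hz.1, h'⟩
  have hG1 : G₁ ⊆ (φ '' Ω)ᶜ := hu ▸ subset_union_left
  have hcase : ∀ z ∉ φ '' Ω, z ∉ G₂ → z ∈ G₁ := by
    intro z hz h'
    have : z ∈ G₁ ∪ G₂ := hu ▸ hz
    exact this.resolve_right h'
  have hfr : ∀ z ∈ frontier G₁, z ∈ frontier (φ '' Ω) ∧ F z ∈ A₁ := by
    intro z hz
    have hz1 : z ∈ G₁ := c1.frontier_subset hz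
    have hz2 : z ∉ G₂ := fun h' => hd.le_bot ⟨hz1, h'⟩
    have hzf : z ∈ frontier (φ '' Ω) := by
      rw [hDo.frontier_eq]
      refine ⟨?_, hG1 hz1⟩
      by_contra hcl
      apply hz.2
      rw [mem_interior_iff_mem_nhds]
      filter_upwards [isClosed_closure.isOpen_compl.mem_nhds hcl, c2.isOpen_compl.mem_nhds hz2]
        with y hy1 hy2
      exact hcase y (fun h' => hy1 (subset_closure h')) hy2
    refine ⟨hzf, ?_⟩
    have h1 := h.mem_frontier_of_mem_frontier hF hΩ.isOpen hzf
    rw [← hA.eq_union] at h1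
    exact h1.resolve_right fun h' => hz2 (hs2 z hzf h')
  refine ⟨G₁, G₂, c1, hd, hG1, hfr, hs2, ?_⟩
  intro w hw
  obtain ⟨_, x, hx, rfl⟩ := hΩ.nonempty.image φ
  obtain ⟨r, hr, hball⟩ := Metric.isOpen_iff.1 hDo _ (mem_image_of_mem φ hx)
  refine closure_mono (image_mono interior_subset) (hF.subset_closure_image hr
    (U := interior G₁) (z₀ := φ x) ?_ hA.closed₁ (hA.isPreconnected_compl hΩ)
    (fun z hz => (hfr z (frontier_interior_subset hz)).2) ?_ hw)
  · exact disjoint_left.2 fun y hy hy' => hG1 (interior_subset hy') (hball hy)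
  · obtain ⟨z, hz, hzA⟩ := hA.exists_mem_frontier hF hΩ h
    have hz2 : z ∉ G₂ := fun h' => hd.le_bot ⟨hs1 z hz hzA, h'⟩
    obtain ⟨y, hy, hy'⟩ := h.exists_mem_exterior hF hΩ hz (c2.isOpen_compl.mem_nhds hz2)
    refine ⟨y, ?_, fun h' => hy' ?_⟩
    · rw [mem_interior_iff_mem_nhds]
      filter_upwards [isClosed_closure.isOpen_compl.mem_nhds (h.notMem_closure_image hF hy'),
        c2.isOpen_compl.mem_nhds hy] with v hv1 hv2
      exact hcase v (fun h' => hv1 (subset_closure h')) hv2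
    · have h1 : F y ∈ frontier ((↑) '' Ω : Set (OnePoint ℂ)) := hA.eq_union ▸ Or.inl h'
      exact frontier_subset_closure h1

/-- A path which enters or leaves a set meets its frontier. -/
theorem exists_mem_frontier_of_path {γ : ℝ → ℂ} {a b : ℝ} (hab : a ≤ b)
    (hγ : ContinuousOn γ (Icc a b)) {G : Set ℂ} (h : γ a ∈ G ∧ γ b ∉ G ∨ γ a ∉ G ∧ γ b ∈ G) :
    ∃ t ∈ Icc a b, γ t ∈ frontier G := by
  by_contra hcon
  push Not at hcon
  have hpre := isPreconnected_Icc.image γ hγ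
  have hsub : γ '' Icc a b ⊆ interior G ∪ interior Gᶜ := by
    rintro _ ⟨t, ht, rfl⟩
    by_contra h'
    rw [mem_union, not_or] at h'
    apply hcon t ht
    rw [frontier, closure_eq_compl_interior_compl]
    exact ⟨h'.2, h'.1⟩
  have hd : Disjoint (interior G) (interior Gᶜ) :=
    disjoint_left.2 fun x h1 h2 => interior_subset h2 (interior_subset h1)
  have ha : γ a ∈ γ '' Icc a b := mem_image_of_mem _ (left_mem_Icc.2 hab)
  have hb : γ b ∈ γ '' Icc a b := mem_image_of_mem _ (right_mem_Icc.2 hab)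
  rcases hpre.subset_or_subset isOpen_interior isOpen_interior hd hsub with h1 | h1 <;>
  · have h2 := interior_subset (h1 ha)
    have h3 := interior_subset (h1 hb)
    tauto

/-- A lower bound for the distances from `w` to a closed set persists, up to an arbitrarily small
loss, at values of `F` close to `w`. -/
theorem exists_mem_forall_lt_angDist (M : GL (Fin 2) ℂ) {G : Set ℂ} {A : Set (OnePoint ℂ)}
    (hA : IsClosed A) {w : OnePoint ℂ} (hw : w ∈ closure (F '' G)) {c c' : ℝ} (hc : c' < c)
    (h : ∀ b ∈ A, c ≤ angDist (M • w) (M • b)) :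
    ∃ y ∈ G, ∀ b ∈ A, c' < angDist (M • F y) (M • b) := by
  have hM := continuous_smul_sphere M
  have hcont : Continuous fun q : OnePoint ℂ × OnePoint ℂ => angDist (M • q.1) (M • q.2) :=
    Continuous.comp (g := fun q : OnePoint ℂ × OnePoint ℂ => angDist q.1 q.2)
      (f := fun q : OnePoint ℂ × OnePoint ℂ => (M • q.1, M • q.2)) continuous_angDist_prod
      ((hM.comp continuous_fst).prodMk (hM.comp continuous_snd))
  have h1 : ∀ᶠ x in 𝓝 w, ∀ b ∈ A, c' < angDist (M • x) (M • b) := by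
    refine hA.isCompact.eventually_forall_of_forall_eventually fun b hb => ?_
    exact (hcont.tendsto (w, b)).eventually (lt_mem_nhds (hc.trans_le (h b hb)))
  obtain ⟨_, hx, ⟨y, hy, rfl⟩⟩ := mem_closure_iff_nhds.1 hw _ h1
  exact ⟨y, hy, hx⟩

/-- A section whose boundary splits in two ways into pieces meeting in singular points only yields
a lower bound for the diameter: a path joining the two parts of the complement of its image
leaves the first one over `A₁` and enters the second one over `B₁`. The Möbius transformation `M`
allows for non-isometric charts. -/
theorem Linked.add_le (hF : LocUniv F) {M : GL (Fin 2) ℂ} {d : ℝ}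
    (hL : Linked (fun z => M • F z) d) {Ω : Set ℂ} {φ : ℂ → ℂ}
    (hΩ : IsRegion Ω) (h : IsSec F Ω φ) {A₁ A₂ B₁ B₂ : Set (OnePoint ℂ)}
    (hA : IsSplit F Ω φ A₁ A₂) (hB : IsSplit F Ω φ B₁ B₂)
    (hAB : ∀ b ∈ A₁, b ∈ B₁ → SingAt F Ω φ b) {w₁ w₂ : OnePoint ℂ} {c₁ c₂ : ℝ}
    (hw₁ : w₁ ∉ A₁) (hw₂ : w₂ ∉ B₁) (hc₁ : ∀ b ∈ A₁, c₁ ≤ angDist (M • w₁) (M • b))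
    (hc₂ : ∀ b ∈ B₁, c₂ ≤ angDist (M • w₂) (M • b)) : c₁ + c₂ ≤ d := by
  obtain ⟨G₁, G₂, g1, g2, g3, g4, g5, g6⟩ := hA.exists_separation hF hΩ h
  obtain ⟨H₁, H₂, k1, k2, k3, k4, k5, k6⟩ := hB.exists_separation hF hΩ h
  have hsplit : ∀ z ∈ frontier (φ '' Ω), ¬ (F z ∈ A₁ ∧ F z ∈ B₁) := fun z hz hz' =>
    hAB _ hz'.1 hz'.2 z hz.1 rfl
  have hmem : ∀ {A₁ A₂ : Set (OnePoint ℂ)}, IsSplit F Ω φ A₁ A₂ → ∀ z ∈ frontier (φ '' Ω),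
      F z ∉ A₁ → F z ∈ A₂ := by
    intro A₁ A₂ hA z hz hz'
    have h1 := h.mem_frontier_of_mem_frontier hF hΩ.isOpen hz
    rw [← hA.eq_union] at h1
    exact h1.resolve_left hz'
  have hGH : G₁ ∩ H₁ = ∅ := by
    have hfr : ∀ z ∈ G₁ ∩ H₁, z ∉ frontier G₁ ∧ z ∉ frontier H₁ := by
      rintro z ⟨hz1, hz2⟩
      constructor
      · intro hz
        obtain ⟨h1, h2⟩ := g4 z hz
        exact k2.le_bot ⟨hz2, k5 z h1 (hmem hB z h1 fun h3 => hsplit z h1 ⟨h2, h3⟩)⟩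
      · intro hz
        obtain ⟨h1, h2⟩ := k4 z hz
        exact g2.le_bot ⟨hz1, g5 z h1 (hmem hA z h1 fun h3 => hsplit z h1 ⟨h3, h2⟩)⟩
    have hop : IsOpen (G₁ ∩ H₁) := by
      rw [isOpen_iff_mem_nhds]
      intro z hz
      have h1 := hfr z hz
      rw [g1.frontier_eq, k1.frontier_eq] at h1
      have h2 : z ∈ interior G₁ := by by_contra h'; exact h1.1 ⟨hz.1, h'⟩
      have h3 : z ∈ interior H₁ := by by_contra h'; exact h1.2 ⟨hz.2, h'⟩
      exact inter_mem (mem_interior_iff_mem_nhds.1 h2) (mem_interior_iff_mem_nhds.1 h3)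
    rcases isClopen_iff.1 ⟨g1.inter k1, hop⟩ with h1 | h1
    · exact h1
    · obtain ⟨z, hz⟩ := hΩ.nonempty.image φ
      have h2 : z ∈ G₁ ∩ H₁ := h1 ▸ mem_univ z
      exact absurd hz (g3 h2.1)
  by_contra hcon
  push Not at hcon
  set ε := (c₁ + c₂ - d) / 2 with hε
  have hε0 : 0 < ε := by linarith
  obtain ⟨y₁, hy₁, hy₁'⟩ := exists_mem_forall_lt_angDist M hA.closed₁ (g6 w₁ hw₁)
    (sub_lt_self c₁ hε0) hc₁
  obtain ⟨y₂, hy₂, hy₂'⟩ := exists_mem_forall_lt_angDist M hB.closed₁ (k6 w₂ hw₂)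
    (sub_lt_self c₂ hε0) hc₂
  obtain ⟨γ, hγ, rfl, rfl, hlt⟩ := hL y₁ y₂
  obtain ⟨t₁, ht₁, hf₁⟩ := exists_mem_frontier_of_path zero_le_one hγ
    (Or.inl ⟨hy₁, fun h' => (hGH ▸ ⟨h', hy₂⟩ : γ 1 ∈ (∅ : Set ℂ))⟩)
  obtain ⟨t₂, ht₂, hf₂⟩ := exists_mem_frontier_of_path ht₁.2 (hγ.mono (Icc_subset_Icc_left ht₁.1))
    (Or.inr ⟨fun h' => (hGH ▸ ⟨g1.frontier_subset hf₁, h'⟩ : γ t₁ ∈ (∅ : Set ℂ)), hy₂⟩)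
  have h1 := hy₁' _ (g4 _ hf₁).2
  have h2 := hy₂' _ (k4 _ hf₂).2
  have h3 := hlt t₁ t₂ ht₁.1 ht₂.1 ht₂.2
  rw [angDist_comm] at h2
  linarith

/-! ### Singular points over small discs -/

theorem closure_coe_image {Ω : Set ℂ} (hb : Bornology.IsBounded Ω) :
    closure ((↑) '' Ω : Set (OnePoint ℂ)) = (↑) '' closure Ω := by
  refine (closure_minimal (image_mono subset_closure) ?_).antisymm
    (image_closure_subset_closure_image OnePoint.continuous_coe)
  exact (hb.isCompact_closure.image OnePoint.continuous_coe).isClosed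

theorem frontier_coe_image {Ω : Set ℂ} (hΩ : IsOpen Ω) (hb : Bornology.IsBounded Ω) :
    frontier ((↑) '' Ω : Set (OnePoint ℂ)) = (↑) '' frontier Ω := by
  rw [(OnePoint.isOpen_image_coe.2 hΩ).frontier_eq, hΩ.frontier_eq, closure_coe_image hb,
    image_sdiff OnePoint.coe_injective]

/-- A bounded open set which is star-shaped about `c` in the strict sense that the open segments
from `c` to boundary points lie in the set. -/
structure IsStar (Ω : Set ℂ) (c : ℂ) : Prop where
  isOpen : IsOpen Ω
  bounded : Bornology.IsBounded Ω
  mem : c ∈ Ω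
  segment : ∀ y ∈ closure Ω, ∀ t : ℝ, 0 ≤ t → t < 1 → c + t * (y - c) ∈ Ω

theorem IsStar.of_convex {Ω : Set ℂ} {c : ℂ} (h1 : IsOpen Ω) (h2 : Convex ℝ Ω)
    (hb : Bornology.IsBounded Ω) (hc : c ∈ Ω) : IsStar Ω c := by
  refine ⟨h1, hb, hc, fun y hy t ht0 ht1 => ?_⟩
  have := h2.combo_interior_closure_mem_interior (a := 1 - t) (b := t)
    (by rwa [h1.interior_eq]) hy (by linarith) ht0 (by ring)
  rw [h1.interior_eq] at this
  convert this using 1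
  simp only [Complex.real_smul]; push_cast; ring

theorem IsStar.union {Ω Ω' : Set ℂ} {c : ℂ} (h : IsStar Ω c) (h' : IsStar Ω' c) :
    IsStar (Ω ∪ Ω') c := by
  refine ⟨h.isOpen.union h'.isOpen, h.bounded.union h'.bounded, Or.inl h.mem, ?_⟩
  intro y hy t ht0 ht1
  rw [closure_union] at hy
  exact hy.imp (fun hy => h.segment y hy t ht0 ht1) fun hy => h'.segment y hy t ht0 ht1

theorem IsStar.notMem_closure {Ω : Set ℂ} {c : ℂ} (h : IsStar Ω c) {y : ℂ} (hy : y ∉ Ω) {t : ℝ}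
    (ht : 1 < t) : c + t * (y - c) ∉ closure Ω := by
  intro h'
  apply hy
  have h0 : (t : ℂ) ≠ 0 := by exact_mod_cast (by linarith : t ≠ 0)
  have := h.segment _ h' t⁻¹ (by positivity) (inv_lt_one_of_one_lt₀ ht)
  convert this using 1
  push_cast; field_simp; ring

theorem IsStar.preconn {Ω : Set ℂ} {c : ℂ} (h : IsStar Ω c) : IsPreconnected Ω := by
  have : StarConvex ℝ c Ω := by
    rw [starConvex_iff_forall_pos h.mem]
    intro y hy a b ha hb hab
    have := h.segment y (subset_closure hy) b hb.le (by linarith)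
    convert this using 1
    rw [← eq_sub_iff_add_eq] at hab
    simp only [Complex.real_smul, hab]; push_cast; ring
  exact (this.isPathConnected h.mem).isConnected.isPreconnected

theorem IsStar.isRegion {Ω : Set ℂ} {c : ℂ} (h : IsStar Ω c) : IsRegion Ω := by
  have hcl := closure_coe_image h.bounded
  have hcoe : ∀ y : ℂ, (y : OnePoint ℂ) ∈ (closure ((↑) '' Ω : Set (OnePoint ℂ)))ᶜ ↔
      y ∉ closure Ω := by
    intro y
    rw [hcl, mem_compl_iff, OnePoint.coe_injective.mem_set_image]
  refine ⟨h.isOpen, ⟨c, h.mem⟩, h.preconn, ?_, ?_⟩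
  · refine isPreconnected_of_forall OnePoint.infty fun x hx => ?_
    induction x using OnePoint.rec with
    | infty => exact ⟨{OnePoint.infty}, by simpa using hx, rfl, rfl, isPreconnected_singleton⟩
    | coe y =>
      rw [hcoe] at hx
      have hyc : y - c ≠ 0 := fun h0 => hx (subset_closure (by rw [sub_eq_zero.1 h0]; exact h.mem))
      let γ : ℝ → OnePoint ℂ := fun t => ((c + t * (y - c) : ℂ) : OnePoint ℂ)
      have hγ : Continuous γ := OnePoint.continuous_coe.comp (by fun_prop)
      have hlim : Tendsto γ atTop (𝓝 OnePoint.infty) := by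
        refine tendsto_infty_of_norm fun R => ?_
        have h1 : Tendsto (fun t : ℝ => t * ‖y - c‖ - ‖c‖) atTop atTop :=
          tendsto_atTop_add_const_right _ _
            (tendsto_id.atTop_mul_const (norm_pos_iff.2 hyc))
        filter_upwards [h1.eventually_gt_atTop R, eventually_ge_atTop 0] with t ht ht0 w hw
        rw [← OnePoint.coe_eq_coe.1 hw]
        have h2 : ‖(t * (y - c) : ℂ)‖ = t * ‖y - c‖ := by
          rw [norm_mul, Complex.norm_real, Real.norm_of_nonneg ht0]
        have h3 := norm_sub_le (c + t * (y - c)) c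
        rw [add_sub_cancel_left, h2] at h3
        linarith
      refine ⟨insert OnePoint.infty (γ '' Ici 1), ?_, mem_insert _ _, ?_, ?_⟩
      · rintro _ (rfl | ⟨t, ht, rfl⟩)
        · rw [hcl]; rintro ⟨w, -, hw⟩
          exact OnePoint.coe_ne_infty w hw
        · rw [hcoe]
          rcases eq_or_lt_of_le (mem_Ici.1 ht) with rfl | ht
          · simpa using hx
          · exact h.notMem_closure (fun h' => hx (subset_closure h')) ht
      · exact Or.inr ⟨1, by simp, by simp [γ]⟩
      · refine (isPreconnected_Ici.image γ hγ.continuousOn).subset_closure (subset_insert _ _) ?_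
        refine insert_subset ?_ subset_closure
        exact mem_closure_of_tendsto hlim
          ((eventually_ge_atTop 1).mono fun t ht => mem_image_of_mem _ ht)
  · rw [frontier_coe_image h.isOpen h.bounded]
    rintro _ ⟨y, hy, rfl⟩
    have hlim : Tendsto (fun t : ℝ => ((c + t * (y - c) : ℂ) : OnePoint ℂ)) (𝓝[>] 1)
        (𝓝 (y : OnePoint ℂ)) := by
      have : Continuous fun t : ℝ => ((c + t * (y - c) : ℂ) : OnePoint ℂ) :=
        OnePoint.continuous_coe.comp (by fun_prop)
      have h1 := this.tendsto 1
      simp only [Complex.ofReal_one, one_mul, add_sub_cancel] at h1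
      exact h1.mono_left nhdsWithin_le_nhds
    refine mem_closure_of_tendsto hlim ?_
    filter_upwards [self_mem_nhdsWithin] with t ht
    rw [hcoe]
    rw [h.isOpen.frontier_eq] at hy
    exact h.notMem_closure hy.2 ht

theorem IsStar.eq_of_mem_frontier {Ω : Set ℂ} {c : ℂ} (h : IsStar Ω c) {y y' : ℂ}
    (hy : y ∈ frontier Ω) (hy' : y' ∈ frontier Ω) {l : ℝ} (hl : 0 ≤ l)
    (he : y' - c = l * (y - c)) : y' = y := by
  rw [h.isOpen.frontier_eq] at hy hy'
  have e : y' = c + l * (y - c) := by rw [← he]; ring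
  rcases lt_trichotomy l 1 with h1 | rfl | h1
  · exact absurd (e ▸ h.segment y hy.1 l hl h1) hy'.2
  · rw [e]; simp
  · exact absurd (e ▸ hy'.1) (h.notMem_closure hy.2 h1)

theorem IsStar.exists_mem_frontier {Ω : Set ℂ} {c : ℂ} (h : IsStar Ω c) {v : ℂ} (hv : v ≠ 0) :
    ∃ l : ℝ, 0 < l ∧ c + l * v ∈ frontier Ω := by
  obtain ⟨R, hR⟩ := h.bounded.exists_norm_le
  have hv' := norm_pos_iff.2 hv
  have hR0 : 0 ≤ R := (norm_nonneg _).trans (hR c h.mem)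
  obtain ⟨t, ht, hf⟩ := exists_mem_frontier_of_path (γ := fun t : ℝ => c + t * v) (G := Ω)
    (a := 0) (b := (2 * R + 1) / ‖v‖) (by positivity) (by fun_prop) (Or.inl ⟨by simpa using h.mem, by
      intro h'
      have h1 := hR _ h'
      have h2 := hR _ h.mem
      have h3 := norm_sub_le (c + ((2 * R + 1) / ‖v‖ : ℝ) * v) c
      rw [add_sub_cancel_left, norm_mul, Complex.norm_real,
        Real.norm_of_nonneg (by positivity), div_mul_cancel₀ _ hv'.ne'] at h3
      linarith⟩)
  refine ⟨t, lt_of_le_of_ne ht.1 ?_, hf⟩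
  rintro rfl
  rw [h.isOpen.frontier_eq] at hf
  exact hf.2 (by simpa using h.mem)

/-- The oriented area spanned by two complex numbers. -/
def area (u v : ℂ) : ℝ := u.re * v.im - u.im * v.re

theorem continuous_area {f g : ℂ → ℂ} (hf : Continuous f) (hg : Continuous g) :
    Continuous fun z => area (f z) (g z) := by
  unfold area; fun_prop

theorem exists_eq_mul_of_area_eq_zero {u v : ℂ} (hv : v ≠ 0) (h : area u v = 0) :
    ∃ l : ℝ, u = l * v := by
  refine ⟨(u / v).re, ?_⟩
  have hi : (u / v).im = 0 := by
    rw [Complex.div_im]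
    unfold area at h
    rw [← sub_div, div_eq_zero_iff]
    left; linarith
  have : ((u / v).re : ℂ) = u / v := by
    apply Complex.ext <;> simp [hi]
  rw [this, div_mul_cancel₀ _ hv]

/-- Two singular boundary points, not collinear with the center, split the boundary of a
star-shaped region. -/
theorem IsStar.isSplit {Ω : Set ℂ} {c : ℂ} (h : IsStar Ω c) {φ : ℂ → ℂ} {p q : ℂ}
    (hp : p ∈ frontier Ω) (hq : q ∈ frontier Ω) (hsp : SingAt F Ω φ p) (hsq : SingAt F Ω φ q)
    (hpq : area (p - c) (q - c) ≠ 0) :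
    IsSplit F Ω φ
      ((↑) '' (frontier Ω ∩ {y | 0 ≤ area (y - c) (q - c) * area (p - c) (q - c) ∧
        0 ≤ area (p - c) (y - c) * area (p - c) (q - c)}))
      ((↑) '' (frontier Ω ∩ {y | area (y - c) (q - c) * area (p - c) (q - c) ≤ 0 ∨
        area (p - c) (y - c) * area (p - c) (q - c) ≤ 0})) := by
  set D := area (p - c) (q - c) with hD
  have hD2 : 0 < D * D := mul_self_pos.2 hpq
  have hc1 : Continuous fun y => area (y - c) (q - c) * D :=
    (continuous_area (by fun_prop) (by fun_prop)).mul continuous_const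
  have hc2 : Continuous fun y => area (p - c) (y - c) * D :=
    (continuous_area (by fun_prop) (by fun_prop)).mul continuous_const
  have hcpt : IsCompact (frontier Ω) :=
    h.bounded.isCompact_closure.of_isClosed_subset isClosed_frontier frontier_subset_closure
  have hp0 : p - c ≠ 0 := by rintro h0; simp [hD, h0, area] at hpq
  have hq0 : q - c ≠ 0 := by rintro h0; simp [hD, h0, area] at hpq
  have hlin1 : ∀ (l a b : ℝ), area (l * (a * (p - c) + b * (q - c))) (q - c) = l * a * D := by
    intro l a b; simp [hD, area]; ring
  have hlin2 : ∀ (l a b : ℝ), area (p - c) (l * (a * (p - c) + b * (q - c))) = l * b * D := by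
    intro l a b; simp [hD, area]; ring
  have hsum : (p - c) + (q - c) ≠ 0 := by
    intro h0
    have := hlin1 1 1 1
    simp [h0, area] at this
    exact hpq this.symm
  refine ⟨?_, ?_, ?_, ?_, ?_, ?_⟩
  · exact ((hcpt.inter_right ((isClosed_le continuous_const hc1).inter
      (isClosed_le continuous_const hc2))).image OnePoint.continuous_coe).isClosed
  · exact ((hcpt.inter_right ((isClosed_le hc1 continuous_const).union
      (isClosed_le hc2 continuous_const))).image OnePoint.continuous_coe).isClosed
  · rw [frontier_coe_image h.isOpen h.bounded, ← image_union, ← inter_union_distrib_left]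
    congr 1
    rw [inter_eq_left]
    intro y _
    by_contra h'
    simp only [mem_union, mem_ofPred_eq, not_or, not_and_or, not_le] at h'
    rcases h'.1 with h1 | h1
    · exact absurd h1 h'.2.1.not_gt
    · exact absurd h1 h'.2.2.not_gt
  · rintro _ ⟨y, ⟨hy, h1, h2⟩, rfl⟩ ⟨y', ⟨-, h3⟩, he⟩
    rw [OnePoint.coe_eq_coe] at he
    subst he
    rcases h3 with h3 | h3
    · have h4 : area (y' - c) (q - c) = 0 := by
        have := le_antisymm h3 h1
        exact (mul_eq_zero.1 this).resolve_right hpq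
      obtain ⟨l, hl⟩ := exists_eq_mul_of_area_eq_zero hq0 h4
      have h5 := hlin2 l 0 1
      simp only [Complex.ofReal_zero, zero_mul, Complex.ofReal_one, one_mul, zero_add, mul_one,
        ← hl] at h5
      rw [h5, mul_assoc] at h2
      rwa [h.eq_of_mem_frontier hq hy (by nlinarith) hl]
    · have h4 : area (p - c) (y' - c) = 0 := by
        have := le_antisymm h3 h2
        exact (mul_eq_zero.1 this).resolve_right hpq
      obtain ⟨l, hl⟩ := exists_eq_mul_of_area_eq_zero (u := y' - c) (v := p - c) hp0 (by
        unfold area at h4 ⊢; linarith)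
      have h5 := hlin1 l 1 0
      simp only [Complex.ofReal_zero, zero_mul, Complex.ofReal_one, one_mul, add_zero, mul_one,
        ← hl] at h5
      rw [h5, mul_assoc] at h1
      rwa [h.eq_of_mem_frontier hp hy (by nlinarith) hl]
  · obtain ⟨l, hl, hy⟩ := h.exists_mem_frontier hsum
    have h1 := hlin1 l 1 1
    have h2 := hlin2 l 1 1
    simp only [Complex.ofReal_one, one_mul, mul_one] at h1 h2
    have hpos : 0 < l * D * D := by nlinarith
    refine ⟨_, ⟨_, ⟨hy, ?_⟩, rfl⟩, ?_⟩
    · simp only [mem_ofPred_eq, add_sub_cancel_left, h1, h2]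
      exact ⟨hpos.le, hpos.le⟩
    · rintro ⟨y', ⟨-, h3⟩, he⟩
      rw [OnePoint.coe_eq_coe] at he
      subst he
      simp only [mem_ofPred_eq, add_sub_cancel_left, h1, h2] at h3
      rcases h3 with h3 | h3 <;> linarith
  · obtain ⟨l, hl, hy⟩ := h.exists_mem_frontier (neg_ne_zero.2 hsum)
    have h1 := hlin1 (-l) 1 1
    have h2 := hlin2 (-l) 1 1
    simp only [Complex.ofReal_neg, Complex.ofReal_one, one_mul, mul_one, neg_mul, ← mul_neg]
      at h1 h2
    have hpos : 0 < l * D * D := by nlinarith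
    refine ⟨_, ⟨_, ⟨hy, ?_⟩, rfl⟩, ?_⟩
    · simp only [mem_ofPred_eq, add_sub_cancel_left, h1, h2]
      left; nlinarith
    · rintro ⟨y', ⟨-, h3⟩, he⟩
      rw [OnePoint.coe_eq_coe] at he
      subst he
      simp only [mem_ofPred_eq, add_sub_cancel_left, h1, h2] at h3
      nlinarith [h3.1]

theorem exists_area_ne_zero {p q : ℂ} (hpq : p ≠ q) {U : Set ℂ} (hU : IsOpen U)
    (hne : U.Nonempty) : ∃ c ∈ U, area (p - c) (q - c) ≠ 0 := by
  by_contra hcon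
  push Not at hcon
  obtain ⟨c, hc⟩ := hne
  have hcont : Continuous fun t : ℝ => c + t * (Complex.I * (q - p)) := by fun_prop
  have h1 : ∀ᶠ t : ℝ in 𝓝[>] 0, c + t * (Complex.I * (q - p)) ∈ U := by
    refine (hcont.tendsto 0).mono_left nhdsWithin_le_nhds (hU.mem_nhds ?_)
    simpa using hc
  obtain ⟨t, ht, ht0⟩ := (h1.and self_mem_nhdsWithin).exists
  have h2 := hcon _ ht
  have h3 := hcon _ hc
  have h4 : area (p - c) (q - c) + t * ((q - p).re ^ 2 + (q - p).im ^ 2) = 0 := by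
    rw [← h2]; simp [area]; ring
  rw [h3, zero_add, mul_eq_zero] at h4
  have ht0 : 0 < t := ht0
  rcases h4 with h4 | h4
  · exact ht0.ne' h4
  · apply hpq
    have e1 : (q - p).re = 0 := by nlinarith [sq_nonneg (q - p).re, sq_nonneg (q - p).im]
    have e2 : (q - p).im = 0 := by nlinarith [sq_nonneg (q - p).re, sq_nonneg (q - p).im]
    exact (sub_eq_zero.1 (Complex.ext e1 e2 : q - p = 0)).symm

theorem IsSec.coe_mem_closure (hF : LocUniv F) {Ω : Set ℂ} {φ : ℂ → ℂ} (h : IsSec F Ω φ) {z b : ℂ}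
    (hz : z ∈ closure (φ '' Ω)) (hb : F z = b) : b ∈ closure Ω := by
  have : (b : OnePoint ℂ) ∈ closure ((↑) '' Ω : Set (OnePoint ℂ)) := by
    rw [← hb]
    refine map_mem_closure hF.continuous hz ?_
    rintro _ ⟨w, hw, rfl⟩
    exact ⟨w, hw, (h.eq w hw).symm⟩
  rwa [OnePoint.isOpenEmbedding_coe.isInducing.closure_eq_preimage_closure_image]

/-- Sections over two overlapping convex sets which agree on the intersection have a common
extension to the union, and singular boundary points of one of them are singular for it. -/
theorem IsSec.exists_union (hF : LocUniv F) {U V : Set ℂ} {φ ψ : ℂ → ℂ} (hφ : IsSec F U φ)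
    (hψ : IsSec F V ψ) (hU : IsOpen U) (hV : IsOpen V) (hUc : Convex ℝ U) (hVc : Convex ℝ V)
    (hne : (U ∩ V).Nonempty) (he : EqOn φ ψ (U ∩ V)) :
    ∃ χ, IsSec F (U ∪ V) χ ∧ EqOn χ φ U ∧ EqOn χ ψ V ∧
      (∀ p : ℂ, p ∈ frontier U → SingAt F U φ p → p ∈ frontier (U ∪ V) ∧ SingAt F (U ∪ V) χ p) ∧
      (∀ p : ℂ, p ∈ frontier V → SingAt F V ψ p → p ∈ frontier (U ∪ V) ∧ SingAt F (U ∪ V) χ p) := by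
  obtain ⟨χ, h1, h2⟩ := IsSec.glue (F := F) (ι := Bool) (U := fun i => cond i U V)
    (χ := fun i => cond i φ ψ) (by simp [hU, hV]) (by simp [hφ, hψ]) (by
      simp only [Bool.forall_bool, cond_true, cond_false]
      exact ⟨⟨fun _ _ => rfl, fun x hx => (he hx.symm).symm⟩, he, fun _ _ => rfl⟩)
  have hun : (⋃ i, (cond i U V : Set ℂ)) = U ∪ V := by
    rw [union_eq_iUnion]
  rw [hun] at h1
  have e1 : EqOn χ φ U := h2 true
  have e2 : EqOn χ ψ V := h2 false
  obtain ⟨c, hcU, hcV⟩ := hne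
  have key : ∀ {U V : Set ℂ} {φ ψ : ℂ → ℂ}, IsSec F U φ → IsSec F V ψ → IsOpen U → IsOpen V →
      Convex ℝ U → Convex ℝ V → EqOn φ ψ (U ∩ V) → c ∈ U → c ∈ V → EqOn χ φ U → EqOn χ ψ V →
      ∀ p : ℂ, p ∈ frontier U → SingAt F U φ p →
        p ∈ frontier (U ∪ V) ∧ SingAt F (U ∪ V) χ p := by
    intro U V φ ψ hφ hψ hU hV hUc hVc he hcU hcV e1 e2 p hp hs
    have hcl : p ∈ closure V → p ∈ closure (U ∩ V) := by
      intro hpV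
      have hlim : Tendsto (fun t : ℝ => (1 - t) • c + t • p) (𝓝[<] 1) (𝓝 p) := by
        have : Continuous fun t : ℝ => (1 - t) • c + t • p := by fun_prop
        have h1 := this.tendsto 1
        simp only [sub_self, zero_smul, one_smul, zero_add] at h1
        exact h1.mono_left nhdsWithin_le_nhds
      refine mem_closure_of_tendsto hlim ?_
      filter_upwards [Ioo_mem_nhdsLT zero_lt_one] with t ht
      have k1 := hUc.combo_interior_closure_mem_interior (by rwa [hU.interior_eq]) hp.1
        (by linarith [ht.2] : 0 < 1 - t) ht.1.le (by ring)
      have k2 := hVc.combo_interior_closure_mem_interior (by rwa [hV.interior_eq]) hpV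
        (by linarith [ht.2] : 0 < 1 - t) ht.1.le (by ring)
      exact ⟨interior_subset k1, interior_subset k2⟩
    have hsV : SingAt F V ψ p := by
      intro z hz hzp
      exact hs.of_eqOn_inter hF hφ hψ hUc hVc he
        (hcl (hψ.coe_mem_closure hF hz hzp)) z hz hzp
    have hpV : p ∉ V := fun h' =>
      hsV (ψ p) (subset_closure (mem_image_of_mem _ h')) (hψ.eq p h')
    constructor
    · rw [(hU.union hV).frontier_eq]
      rw [hU.frontier_eq] at hp
      exact ⟨closure_mono subset_union_left hp.1, fun h' => h'.elim hp.2 hpV⟩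
    · intro z hz
      rw [image_union, closure_union] at hz
      rw [e1.image_eq, e2.image_eq] at hz
      exact hz.elim (hs z) (hsV z)
  refine ⟨χ, h1, e1, e2, key hφ hψ hU hV hUc hVc he hcU hcV e1 e2, ?_⟩
  rw [union_comm]
  exact key hψ hφ hV hU hVc hUc (fun x hx => (he hx.symm).symm) hcV hcU e2 e1

theorem Linked.pos {d : ℝ} (hL : Linked F d) : 0 < d := by
  obtain ⟨γ, -, h0, h1, h⟩ := hL 0 0
  have := h 0 1 le_rfl zero_le_one le_rfl
  rw [h0, h1] at this
  simpa [angDist, cosDist_self] using this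

/-- Two overlapping sections over convex subsets of the disc of radius `ε` about `a` cannot have
different singular boundary points. -/
def SingUnique (F : ℂ → OnePoint ℂ) (a : ℂ) (ε : ℝ) : Prop :=
  ∀ {U V : Set ℂ} {φ ψ : ℂ → ℂ} {p q : ℂ}, IsSec F U φ → IsSec F V ψ → IsOpen U → IsOpen V →
    Convex ℝ U → Convex ℝ V → U ⊆ ball a ε → V ⊆ ball a ε → (U ∩ V).Nonempty →
    EqOn φ ψ (U ∩ V) → p ∈ frontier U → SingAt F U φ p → q ∈ frontier V → SingAt F V ψ q → p = q

/-- If the diameter is less than `2 π`, then near every point of the plane a singular point is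
determined by the section: otherwise two singular boundary points would split the boundary of a
small region into two pieces, both at distance almost `π` from an antipode. -/
theorem Linked.exists_singUnique (hF : LocUniv F) {M : GL (Fin 2) ℂ} {d : ℝ}
    (hL : Linked (fun z => M • F z) d) (hd : d < 2 * Real.pi) (a : ℂ) :
    ∃ ε > 0, SingUnique F a ε := by
  obtain ⟨w', hw'⟩ := exists_antipode (M • (a : OnePoint ℂ))
  obtain ⟨w, rfl⟩ : ∃ w, M • w = w' := ⟨M⁻¹ • w', smul_inv_smul _ _⟩
  have hd0 := hL.pos
  set η := (2 * Real.pi - d) / 4 with hη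
  have hη0 : 0 < η := by linarith
  have h1 : ∀ᶠ b : ℂ in 𝓝 a, Real.pi - η < angDist (M • w) (M • (b : OnePoint ℂ)) := by
    have hc : Continuous fun b : ℂ => angDist (M • w) (M • (b : OnePoint ℂ)) :=
      (continuous_angDist _).comp ((continuous_smul_sphere M).comp OnePoint.continuous_coe)
    refine hc.continuousAt.eventually_const_lt ?_
    have : angDist (M • w) (M • (a : OnePoint ℂ)) = Real.pi := by
      rw [angDist, hw', cosDist_self, Real.arccos_neg_one]
    simp only [this]
    linarith
  obtain ⟨ε, hε, hball⟩ := Metric.nhds_basis_closedBall.mem_iff.1 h1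
  refine ⟨ε, hε, ?_⟩
  intro U V φ ψ p q hφ hψ hU hV hUc hVc hUa hVa hne he hp hsp hq hsq
  by_contra hpq
  obtain ⟨χ, h2, -, -, h3, h4⟩ := hφ.exists_union hF hψ hU hV hUc hVc hne he
  obtain ⟨hp', hsp'⟩ := h3 p hp hsp
  obtain ⟨hq', hsq'⟩ := h4 q hq hsq
  obtain ⟨c, ⟨hcU, hcV⟩, hc⟩ := exists_area_ne_zero hpq (hU.inter hV) hne
  have hstar := (IsStar.of_convex hU hUc (isBounded_ball.subset hUa) hcU).union
    (IsStar.of_convex hV hVc (isBounded_ball.subset hVa) hcV)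
  have hsplit := hstar.isSplit hp' hq' hsp' hsq' hc
  have hfar : ∀ y ∈ frontier (U ∪ V), Real.pi - η ≤ angDist (M • w) (M • (y : OnePoint ℂ)) := by
    intro y hy
    have : y ∈ closedBall a ε :=
      closure_ball_subset_closedBall (closure_mono (union_subset hUa hVa) hy.1)
    have h5 : Real.pi - η < angDist (M • w) (M • (y : OnePoint ℂ)) := hball this
    exact h5.le
  have hnear : angDist (M • w) (M • w) = 0 := by simp [angDist, cosDist_self]
  have hA : ∀ S : Set ℂ, ∀ b ∈ ((↑) '' (frontier (U ∪ V) ∩ S) : Set (OnePoint ℂ)),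
      Real.pi - η ≤ angDist (M • w) (M • b) := by
    rintro S _ ⟨y, hy, rfl⟩
    exact hfar y hy.1
  have hwA : ∀ S : Set ℂ, w ∉ ((↑) '' (frontier (U ∪ V) ∩ S) : Set (OnePoint ℂ)) := by
    intro S hS
    have := hA S w hS
    rw [hnear] at this
    linarith [Real.pi_pos]
  have := hL.add_le hF hstar.isRegion h2 hsplit hsplit.symm (fun b hb hb' => hsplit.sing b hb hb')
    (hwA _) (hwA _) (hA _) (hA _)
  linarith

/-! ### Components of preimages of small discs -/

/-- The largest disc about `F x` carrying a section through `x` has the singular boundary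
point `p`. -/
def HasSingularDisc (F : ℂ → OnePoint ℂ) (p x : ℂ) : Prop :=
  ∃ (c : ℂ) (φ : ℂ → ℂ), F x = c ∧ c ≠ p ∧ IsSec F (ball c (dist c p)) φ ∧ φ c = x ∧
    SingAt F (ball c (dist c p)) φ p

theorem mem_frontier_ball_dist {c p : ℂ} (h : c ≠ p) : p ∈ frontier (ball c (dist c p)) := by
  rw [frontier_ball c (dist_pos.2 h).ne', mem_sphere, dist_comm]

/-- Sections over discs about the same value through the same point have the same singular
boundary points. -/
theorem HasSingularDisc.eq (hF : LocUniv F) {a : ℂ} {ε : ℝ} (hu : SingUnique F a ε) {p q x : ℂ}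
    (hp : HasSingularDisc F p x) (hq : HasSingularDisc F q x) {c : ℂ} (hc : F x = c)
    (hpa : dist c p + dist c a ≤ ε) (hqa : dist c q + dist c a ≤ ε) : p = q := by
  obtain ⟨c', φ, h1, h2, h3, h4, h5⟩ := hp
  obtain ⟨c'', ψ, k1, k2, k3, k4, k5⟩ := hq
  obtain rfl : c' = c := OnePoint.coe_eq_coe.1 (h1.symm.trans hc)
  obtain rfl : c'' = c' := OnePoint.coe_eq_coe.1 (k1.symm.trans hc)
  have hm : ∀ p, c'' ≠ p → c'' ∈ ball c'' (dist c'' p) := fun p h => mem_ball_self (dist_pos.2 h)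
  exact hu h3 k3 isOpen_ball isOpen_ball (convex_ball _ _) (convex_ball _ _)
    (ball_subset_ball' hpa) (ball_subset_ball' hqa) ⟨c'', hm p h2, hm q k2⟩
    ((h3.mono inter_subset_left).eqOn hF (k3.mono inter_subset_right)
      ((convex_ball _ _).inter (convex_ball _ _)).isPreconnected ⟨hm p h2, hm q k2⟩
      (h4.trans k4.symm)) (mem_frontier_ball_dist h2) h5 (mem_frontier_ball_dist k2) k5

theorem IsSec.apply_eq_of_univ (hF : LocUniv F) {φ : ℂ → ℂ} (h : IsSec F univ φ) {x c : ℂ}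
    (hx : F x = c) : φ c = x := by
  obtain ⟨α, β, hα, haff⟩ := hF.affine_of_section_univ h
  have h1 := h.eq c (mem_univ c)
  rw [← hx, haff, haff, OnePoint.coe_eq_coe] at h1
  exact mul_left_cancel₀ hα (add_right_cancel h1)

/-- A section over a connected open set through a point of a component of the preimage of this set
has this component as its image. -/
theorem IsSec.image_eq_component (hF : LocUniv F) {Ω : Set ℂ} {φ : ℂ → ℂ} (h : IsSec F Ω φ)
    (hΩ : IsOpen Ω) (hΩc : IsPreconnected Ω) {x z c : ℂ}
    (hx : x ∈ connectedComponentIn (F ⁻¹' ((↑) '' Ω)) z) (hc : c ∈ Ω) (hφ : φ c = x) :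
    φ '' Ω = connectedComponentIn (F ⁻¹' ((↑) '' Ω)) z := by
  have hxi : x ∈ φ '' Ω := ⟨c, hc, hφ⟩
  refine Subset.antisymm ?_ ?_
  · rw [connectedComponentIn_eq hx]
    refine (hΩc.image φ h.cont).subset_connectedComponentIn hxi ?_
    rintro _ ⟨w, hw, rfl⟩
    exact ⟨w, hw, (h.eq w hw).symm⟩
  · have hcov : connectedComponentIn (F ⁻¹' ((↑) '' Ω)) z ⊆ φ '' Ω ∪ (closure (φ '' Ω))ᶜ := by
      intro y hy
      by_cases hcl : y ∈ closure (φ '' Ω)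
      · obtain ⟨w, hw, he⟩ := connectedComponentIn_subset _ _ hy
        exact Or.inl ⟨w, hw, h.eq_of_mem_closure hF hΩ hcl hw he.symm⟩
      · exact Or.inr hcl
    refine isPreconnected_connectedComponentIn.subset_left_of_subset_union (h.isOpen_image hF hΩ)
      isClosed_closure.isOpen_compl
      (disjoint_left.2 fun y h1 h2 => h2 (subset_closure h1)) hcov ⟨x, hx, hxi⟩

/-- A component of the preimage of a small disc which is not the image of a section has one
singular point, common to all its points. -/
theorem SingUnique.exists_hasSingularDisc (hF : LocUniv F) {a : ℂ} {ε δ : ℝ}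
    (hu : SingUnique F a ε) (hδε : δ ≤ ε / 8) {z : ℂ}
    (hno : ¬ ∃ φ, IsSec F (ball a δ) φ ∧
      φ '' ball a δ = connectedComponentIn (F ⁻¹' ((↑) '' ball a δ)) z) :
    ∃ p, ∀ x ∈ connectedComponentIn (F ⁻¹' ((↑) '' ball a δ)) z,
      HasSingularDisc F p x ∧ ∀ c : ℂ, F x = c → dist c p ≤ 2 * δ := by
  set V := connectedComponentIn (F ⁻¹' ((↑) '' ball a δ)) z with hV
  have hnosec : ∀ x ∈ V, ∀ c φ, F x = (c : ℂ) → IsSec F (ball c (2 * δ)) φ → φ c ≠ x := by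
    intro x hx c φ hc h hφ
    obtain ⟨c', hc', he⟩ := connectedComponentIn_subset _ _ hx
    obtain rfl : c' = c := OnePoint.coe_eq_coe.1 (he.trans hc)
    have hsub : ball a δ ⊆ ball c' (2 * δ) := by
      refine ball_subset_ball' ?_
      rw [mem_ball, dist_comm] at hc'
      linarith
    exact hno ⟨φ, h.mono hsub, (h.mono hsub).image_eq_component hF isOpen_ball
      (convex_ball _ _).isPreconnected hx hc' hφ⟩
  have hdisc : ∀ x ∈ V, ∃ p, HasSingularDisc F p x ∧ ∀ c : ℂ, F x = c → dist c p ≤ 2 * δ := by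
    intro x hx
    obtain ⟨c, hc, he⟩ := connectedComponentIn_subset _ _ hx
    have hng : ¬ ∃ φ, IsSec F univ φ := by
      rintro ⟨φ, hφ⟩
      exact hnosec x hx c φ he.symm (hφ.mono (subset_univ _)) (hφ.apply_eq_of_univ hF he.symm)
    obtain ⟨r, hr, φ, h1, h2, p, hp, hs⟩ := hF.exists_maximal_disc he.symm hng
    have hpr : dist c p = r := by rw [dist_comm]; exact hp
    refine ⟨p, ⟨c, φ, he.symm, dist_pos.1 (hpr ▸ hr), hpr ▸ h1, h2, hpr ▸ hs⟩, ?_⟩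
    intro c' hc'
    obtain rfl : c' = c := OnePoint.coe_eq_coe.1 (hc'.symm.trans he.symm)
    rw [hpr]
    by_contra hlt
    push Not at hlt
    exact hnosec x hx c' φ hc' (h1.mono (ball_subset_ball hlt.le)) h2
  choose! P hP hPd using hdisc
  rcases V.eq_empty_or_nonempty with he | ⟨x₀, hx₀⟩
  · exact ⟨0, by simp [he]⟩
  refine ⟨P x₀, fun x hx => ?_⟩
  suffices P x = P x₀ from this ▸ ⟨hP x hx, hPd x hx⟩
  refine isPreconnected_connectedComponentIn.induction₂ (fun x y => P x = P y) ?_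
    (fun _ _ _ _ _ _ => Eq.trans) (fun _ _ _ _ => Eq.symm) hx hx₀
  intro x hx
  obtain ⟨c, φ, h1, h2, h3, h4, h5⟩ := hP x hx
  have hopen : φ '' ball c (dist c (P x)) ∈ 𝓝 x :=
    (h3.isOpen_image hF isOpen_ball).mem_nhds ⟨c, mem_ball_self (dist_pos.2 h2), h4⟩
  filter_upwards [nhdsWithin_le_nhds hopen, self_mem_nhdsWithin] with y hyφ hy
  obtain ⟨w, hw, rfl⟩ := hyφ
  obtain ⟨c', ψ, k1, k2, k3, k4, k5⟩ := hP _ hy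
  obtain rfl : c' = w := OnePoint.coe_eq_coe.1 (k1.symm.trans (h3.eq w hw))
  have hm : c' ∈ ball c' (dist c' (P (φ c'))) := mem_ball_self (dist_pos.2 k2)
  have hball : ∀ y ∈ V, ∀ c : ℂ, F y = c → ball c (dist c (P y)) ⊆ ball a ε := by
    intro y hy c hc
    obtain ⟨v, hv, he⟩ := connectedComponentIn_subset _ _ hy
    obtain rfl : v = c := OnePoint.coe_eq_coe.1 (he.trans hc)
    refine ball_subset_ball' ?_
    have h1 := hPd y hy v hc
    have h2 := mem_ball.1 hv
    have h3 : 0 < δ := dist_nonneg.trans_lt h2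
    linarith
  exact hu h3 k3 isOpen_ball isOpen_ball (convex_ball _ _) (convex_ball _ _)
    (hball x hx c h1) (hball _ hy c' k1) ⟨c', hw, hm⟩
    ((h3.mono inter_subset_left).eqOn hF (k3.mono inter_subset_right)
      ((convex_ball _ _).inter (convex_ball _ _)).isPreconnected ⟨hw, hm⟩ k4.symm)
    (mem_frontier_ball_dist h2) h5 (mem_frontier_ball_dist k2) k5

/-- If all points of a component over a disc have the center as their singular point, then only
one component over any smaller concentric disc is contained in it, by radial contraction. -/
theorem isPreconnected_inter_component (hF : LocUniv F) {b : ℂ} {δ η : ℝ} (hη : 0 < η)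
    (hηδ : η ≤ δ) {z : ℂ}
    (h : ∀ x ∈ connectedComponentIn (F ⁻¹' ((↑) '' ball b δ)) z, HasSingularDisc F b x) :
    IsPreconnected (connectedComponentIn (F ⁻¹' ((↑) '' ball b δ)) z ∩ F ⁻¹' ((↑) '' ball b η)) := by
  set V := connectedComponentIn (F ⁻¹' ((↑) '' ball b δ)) z with hV
  have hδ : 0 < δ := hη.trans_le hηδ
  choose! c φ h1 h2 h3 h4 h5 using h
  have hcV : ∀ x ∈ V, dist (c x) b < δ := by
    intro x hx
    obtain ⟨v, hv, he⟩ := connectedComponentIn_subset _ _ hx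
    rw [← OnePoint.coe_eq_coe.1 (he.trans (h1 x hx))]
    exact hv
  let l : ℝ → ℂ → ℂ := fun t x => b + t * (c x - b)
  have hl : ∀ x ∈ V, ∀ t : ℝ, 0 < t → t ≤ 1 → l t x ∈ ball (c x) (dist (c x) b) := by
    intro x hx t ht0 ht1
    rw [mem_ball, dist_eq_norm, dist_eq_norm]
    have e : l t x - c x = ((t - 1 : ℝ) : ℂ) * (c x - b) := by simp only [l]; push_cast; ring
    have := norm_pos_iff.2 (sub_ne_zero.2 (h2 x hx))
    rw [e, norm_mul, Complex.norm_real, Real.norm_eq_abs, abs_of_nonpos (by linarith)]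
    nlinarith
  have hlb : ∀ x t, 0 ≤ t → dist (l t x) b = t * dist (c x) b := by
    intro x t ht
    simp only [dist_eq_norm, l, add_sub_cancel_left, norm_mul, Complex.norm_real,
      Real.norm_of_nonneg ht]
  let ρ : ℝ → ℂ → ℂ := fun t x => φ x (l t x)
  have hFρ : ∀ x ∈ V, ∀ t : ℝ, 0 < t → t ≤ 1 → F (ρ t x) = l t x := fun x hx t ht0 ht1 =>
    (h3 x hx).eq _ (hl x hx t ht0 ht1)
  have hρ1 : ∀ x ∈ V, ρ 1 x = x := by
    intro x hx
    simp only [ρ, l, Complex.ofReal_one, one_mul, add_sub_cancel, h4 x hx]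
  set s := η / δ with hs
  have hs0 : 0 < s := by positivity
  have hs1 : s ≤ 1 := (div_le_one hδ).2 hηδ
  -- the radial path of a point of the component
  have hpath : ∀ x ∈ V, IsPreconnected ((fun t => ρ t x) '' Icc s 1) := by
    intro x hx
    refine isPreconnected_Icc.image _ ((h3 x hx).cont.comp ?_ fun t ht => ?_)
    · exact Continuous.continuousOn (by simp only [l]; fun_prop)
    · exact hl x hx t (hs0.trans_le ht.1) ht.2
  have hpathV : ∀ x ∈ V, (fun t => ρ t x) '' Icc s 1 ⊆ V := by
    intro x hx
    rw [hV, connectedComponentIn_eq hx]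
    refine (hpath x hx).subset_connectedComponentIn ⟨1, ⟨hs1, le_rfl⟩, hρ1 x hx⟩ ?_
    rintro _ ⟨t, ht, rfl⟩
    have ht0 := hs0.trans_le ht.1
    refine ⟨l t x, ?_, (hFρ x hx t ht0 ht.2).symm⟩
    rw [mem_ball, hlb x t ht0.le]
    have := hcV x hx
    nlinarith [ht.2, dist_nonneg (x := c x) (y := b)]
  have hρV : ρ s '' V ⊆ V ∩ F ⁻¹' ((↑) '' ball b η) := by
    rintro _ ⟨x, hx, rfl⟩
    refine ⟨hpathV x hx ⟨s, ⟨le_rfl, hs1⟩, rfl⟩, l s x, ?_, (hFρ x hx s hs0 hs1).symm⟩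
    rw [mem_ball, hlb x s hs0.le]
    calc s * dist (c x) b < s * δ := by gcongr; exact hcV x hx
      _ = η := by rw [hs]; field_simp
  have hcont : ContinuousOn (ρ s) V := by
    intro x hx
    have hopen : φ x '' ball (c x) (dist (c x) b) ∈ 𝓝 x :=
      ((h3 x hx).isOpen_image hF isOpen_ball).mem_nhds
        ⟨c x, mem_ball_self (dist_pos.2 (h2 x hx)), h4 x hx⟩
    have hcc : ContinuousWithinAt c V x := by
      have h6 : ContinuousWithinAt (fun y => ((c y : ℂ) : OnePoint ℂ)) V x :=
        hF.continuous.continuousWithinAt.congr (fun y hy => (h1 y hy).symm) (h1 x hx).symm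
      exact OnePoint.isOpenEmbedding_coe.isInducing.continuousWithinAt_iff.2 h6
    have hlc : ContinuousWithinAt (l s) V x :=
      continuousWithinAt_const.add (continuousWithinAt_const.mul (hcc.sub continuousWithinAt_const))
    have hev : ∀ᶠ y in 𝓝[V] x, l s y ∈ ball (c x) (dist (c x) b) :=
      hlc (isOpen_ball.mem_nhds (hl x hx s hs0 hs1))
    have hφc : ContinuousWithinAt (fun y => φ x (l s y)) V x :=
      (((h3 x hx).cont.continuousAt (isOpen_ball.mem_nhds (hl x hx s hs0 hs1))).tendsto.comp hlc)
    refine hφc.congr_of_eventuallyEq ?_ rfl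
    filter_upwards [hev, nhdsWithin_le_nhds hopen, self_mem_nhdsWithin] with y hy hyφ hyV
    obtain ⟨w, hw, rfl⟩ := hyφ
    have hwc : w = c (φ x w) := OnePoint.coe_eq_coe.1 (((h3 x hx).eq w hw).symm.trans (h1 _ hyV))
    have hm : w ∈ ball (c (φ x w)) (dist (c (φ x w)) b) := by
      rw [← hwc]; exact mem_ball_self (dist_pos.2 (hwc ▸ h2 _ hyV))
    refine ((h3 _ hyV).mono inter_subset_left).eqOn hF ((h3 x hx).mono inter_subset_right)
      ((convex_ball _ _).inter (convex_ball _ _)).isPreconnected ⟨hm, hw⟩ ?_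
      ⟨hl _ hyV s hs0 hs1, hy⟩
    exact (congrArg (φ (φ x w)) hwc).trans (h4 _ hyV)
  rcases V.eq_empty_or_nonempty with he | ⟨x₀, hx₀⟩
  · rw [he, empty_inter]; exact isPreconnected_empty
  refine isPreconnected_of_forall (ρ s x₀) ?_
  rintro x ⟨hx, hxη⟩
  refine ⟨ρ s '' V ∪ (fun t => ρ t x) '' Icc s 1, union_subset hρV ?_,
    Or.inl ⟨x₀, hx₀, rfl⟩, Or.inr ⟨1, ⟨hs1, le_rfl⟩, hρ1 x hx⟩, ?_⟩
  · refine subset_inter (hpathV x hx) ?_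
    rintro _ ⟨t, ht, rfl⟩
    have ht0 := hs0.trans_le ht.1
    refine ⟨l t x, ?_, (hFρ x hx t ht0 ht.2).symm⟩
    obtain ⟨v, hv, he⟩ := hxη
    rw [OnePoint.coe_eq_coe.1 (he.trans (h1 x hx)), mem_ball] at hv
    rw [mem_ball, hlb x t ht0.le]
    nlinarith [ht.2, dist_nonneg (x := c x) (y := b)]
  · exact (isPreconnected_connectedComponentIn.image _ hcont).union (ρ s x) ⟨x, hx, rfl⟩
      ⟨s, ⟨le_rfl, hs1⟩, rfl⟩ (hpath x hx)

/-! ### Singularities are isolated if the diameter is less than `2 π` -/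

/-- The neighbourhood of a point of the sphere which is a disc in the chart given by a Möbius
transformation. -/
def discNhd (A : GL (Fin 2) ℂ) (b : ℂ) (η : ℝ) : Set (OnePoint ℂ) :=
  mobiusHomeo A ⁻¹' ((↑) '' ball b η)

theorem discNhd_subset (A : GL (Fin 2) ℂ) (b : ℂ) {η δ : ℝ} (h : η ≤ δ) :
    discNhd A b η ⊆ discNhd A b δ :=
  preimage_mono (image_mono (ball_subset_ball h))

theorem discNhd_mem {A : GL (Fin 2) ℂ} {a : OnePoint ℂ} {b : ℂ} (hA : A • a = (b : OnePoint ℂ))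
    {η : ℝ} (hη : 0 < η) : discNhd A b η ∈ SimplyConnectedNhds a := by
  refine ⟨(OnePoint.isOpen_image_coe.2 isOpen_ball).preimage (mobiusHomeo A).continuous, ?_, ?_⟩
  · exact ⟨b, mem_ball_self hη, by rw [mobiusHomeo_apply, hA]⟩
  · rw [discNhd, Homeomorph.isSimplyConnected_preimage,
      OnePoint.isOpenEmbedding_coe.isEmbedding.isSimplyConnected_image, IsSimplyConnected]
    have := Metric.contractibleSpace_ball (x := b) hη
    infer_instance

theorem exists_discNhd_subset {A : GL (Fin 2) ℂ} {a : OnePoint ℂ} {b : ℂ}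
    (hA : A • a = (b : OnePoint ℂ)) {N : Set (OnePoint ℂ)} (hN : N ∈ 𝓝 a) :
    ∃ η₀ > 0, ∀ η ≤ η₀, discNhd A b η ⊆ N := by
  have h1 : mobiusHomeo A '' N ∈ 𝓝 (b : OnePoint ℂ) := by
    rw [← hA, ← mobiusHomeo_apply]
    exact (mobiusHomeo A).isOpenMap.image_mem_nhds hN
  rw [OnePoint.nhds_coe_eq, mem_map] at h1
  obtain ⟨η₀, hη₀, h2⟩ := Metric.mem_nhds_iff.1 h1
  refine ⟨η₀, hη₀, fun η hη x hx => ?_⟩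
  obtain ⟨v, hv, he⟩ := hx
  obtain ⟨y, hy, he'⟩ := h2 (ball_subset_ball hη hv)
  rwa [(mobiusHomeo A).injective (he.symm.trans he'.symm)]

theorem singularity_nonempty (s : InverseSingularity f) (Ω : SimplyConnectedNhds s.base) :
    (s.V Ω).Nonempty := by
  obtain ⟨z, hz, he⟩ := s.isComponent Ω
  rw [he]; exact connectedComponentIn_nonempty_iff.2 hz

theorem singularity_eq_component (s : InverseSingularity f) {Ω : SimplyConnectedNhds s.base} {x : ℂ}
    (hx : x ∈ s.V Ω) : s.V Ω = connectedComponentIn (toSphere f ⁻¹' Ω.1) x := by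
  obtain ⟨z, hz, he⟩ := s.isComponent Ω
  rw [he] at hx ⊢
  exact connectedComponentIn_eq hx

theorem singularity_subset (s : InverseSingularity f) (Ω : SimplyConnectedNhds s.base) :
    s.V Ω ⊆ toSphere f ⁻¹' Ω.1 := by
  obtain ⟨z, hz, he⟩ := s.isComponent Ω
  rw [he]; exact connectedComponentIn_subset _ _

theorem singularity_ext {s s' : InverseSingularity f} (hb : s.base = s'.base)
    (h : ∀ Ω, ∀ h1 : Ω ∈ SimplyConnectedNhds s.base, ∀ h2 : Ω ∈ SimplyConnectedNhds s'.base,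
      (s.V ⟨Ω, h1⟩ ∩ s'.V ⟨Ω, h2⟩).Nonempty) : s = s' := by
  have hV : ∀ Ω, ∀ h1 : Ω ∈ SimplyConnectedNhds s.base, ∀ h2 : Ω ∈ SimplyConnectedNhds s'.base,
      s.V ⟨Ω, h1⟩ = s'.V ⟨Ω, h2⟩ := by
    intro Ω h1 h2
    obtain ⟨x, hx, hx'⟩ := h Ω h1 h2
    rw [singularity_eq_component s hx, singularity_eq_component s' hx']
  obtain ⟨a, V, c1, c2, c3⟩ := s
  obtain ⟨a', V', c1', c2', c3'⟩ := s'
  obtain rfl : a = a' := hb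
  obtain rfl : V = V' := funext fun Ω => hV Ω.1 Ω.2 Ω.2
  rfl

/-- The neighbourhoods of a singularity over small discs are not images of sections: the value
of the section at the center would belong to all neighbourhoods. -/
theorem not_exists_section_singularity (s : InverseSingularity f)
    {A : GL (Fin 2) ℂ} {b : ℂ} (hA : A • s.base = (b : OnePoint ℂ)) {η : ℝ} (hη : 0 < η) :
    ¬ ∃ φ, IsSec (fun z => A • toSphere f z) (ball b η) φ ∧
      φ '' ball b η = s.V ⟨discNhd A b η, discNhd_mem hA hη⟩ := by
  rintro ⟨φ, hφ, hV⟩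
  have hmem : ∀ Ω, φ b ∈ s.V Ω := by
    intro Ω
    obtain ⟨η₀, hη₀, hsub⟩ := exists_discNhd_subset hA (Ω.2.1.mem_nhds Ω.2.2.1)
    have ht : 0 < min η₀ η := lt_min hη₀ hη
    have h1 : s.V ⟨discNhd A b (min η₀ η), discNhd_mem hA ht⟩ ⊆ s.V Ω :=
      s.mono _ _ (hsub _ (min_le_left _ _))
    refine h1 ?_
    obtain ⟨x, hx⟩ := singularity_nonempty s ⟨discNhd A b (min η₀ η), discNhd_mem hA ht⟩
    have hxη : x ∈ s.V ⟨discNhd A b η, discNhd_mem hA hη⟩ :=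
      s.mono _ _ (discNhd_subset A b (min_le_right _ _)) hx
    rw [← hV] at hxη
    obtain ⟨w, hw, rfl⟩ := hxη
    have hwt : w ∈ ball b (min η₀ η) := by
      obtain ⟨v, hv, he⟩ := singularity_subset s _ hx
      rwa [← OnePoint.coe_eq_coe.1 (he.trans (hφ.eq w hw))]
    rw [singularity_eq_component s hx]
    refine (((convex_ball b _).isPreconnected.image φ
      (hφ.cont.mono (ball_subset_ball (min_le_right _ _)))).subset_connectedComponentIn
      ⟨w, hwt, rfl⟩ ?_) ⟨b, mem_ball_self ht, rfl⟩
    rintro _ ⟨v, hv, rfl⟩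
    exact ⟨v, hv, (hφ.eq v (ball_subset_ball (min_le_right _ _) hv)).symm⟩
  have : φ b ∈ ⋂ Ω, s.V Ω := mem_iInter.2 hmem
  rw [s.iInter_eq_empty] at this
  exact this

/-- At all points of a small neighbourhood of a singularity, the largest disc carrying a section has
the base of the singularity on its boundary: the singular boundary point is the same for all
neighbourhoods of the singularity, and lies close to the base for the small ones. -/
theorem singularity_hasSingularDisc (hF : LocUniv (toSphere f)) (s : InverseSingularity f)
    {A : GL (Fin 2) ℂ} {b : ℂ} (hA : A • s.base = (b : OnePoint ℂ)) {ε δ : ℝ}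
    (hu : SingUnique (fun z => A • toSphere f z) b ε) (hδ : 0 < δ) (hδε : δ ≤ ε / 8) {x : ℂ}
    (hx : x ∈ s.V ⟨discNhd A b δ, discNhd_mem hA hδ⟩) :
    HasSingularDisc (fun z => A • toSphere f z) b x := by
  have hG := hF.smul A
  have key : ∀ η (hη : 0 < η), η ≤ δ → ∃ p,
      ∀ x ∈ s.V ⟨discNhd A b η, discNhd_mem hA hη⟩,
        HasSingularDisc (fun z => A • toSphere f z) p x ∧
        ∀ c : ℂ, A • toSphere f x = c → dist c p ≤ 2 * η := by
    intro η hη hηδ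
    obtain ⟨z, hz, he⟩ := s.isComponent ⟨discNhd A b η, discNhd_mem hA hη⟩
    have hno := not_exists_section_singularity s hA hη
    rw [he] at hno
    rw [he]
    exact hu.exists_hasSingularDisc hG (hηδ.trans hδε) hno
  obtain ⟨p, hp⟩ := key δ hδ le_rfl
  suffices p = b from this ▸ (hp x hx).1
  refine dist_le_zero.1 (le_of_forall_pos_le_add fun e he => ?_)
  have ht : 0 < min δ (e / 3) := lt_min hδ (by positivity)
  obtain ⟨q, hq⟩ := key _ ht (min_le_left _ _)
  obtain ⟨y, hy⟩ := singularity_nonempty s ⟨discNhd A b _, discNhd_mem hA ht⟩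
  have hyδ : y ∈ s.V ⟨discNhd A b δ, discNhd_mem hA hδ⟩ :=
    s.mono _ _ (discNhd_subset A b (min_le_left _ _)) hy
  obtain ⟨c, hc, hcy⟩ := singularity_subset s _ hy
  have h1 := (hp y hyδ).2 c hcy.symm
  have h2 := (hq y hy).2 c hcy.symm
  rw [mem_ball] at hc
  have h3 := min_le_left δ (e / 3)
  have h4 := min_le_right δ (e / 3)
  obtain rfl : p = q := (hp y hyδ).1.eq hG hu (hq y hy).1 hcy.symm (by linarith) (by linarith)
  have := dist_triangle_left p b c
  linarith

/-- If the diameter is less than `2 π`, a small neighbourhood of a singularity determines the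
singularity: its points have the base as their singular boundary point, and radial contraction
shows that it contains only one component over each smaller disc about the base. -/
theorem Linked.isIsolated (hF : LocUniv (toSphere f)) {d : ℝ} (hL : Linked (toSphere f) d)
    (hd : d < 2 * Real.pi) (s : InverseSingularity f) : s.IsIsolated := by
  obtain ⟨A, b, hA⟩ := LocUniv.exists_smul_eq_coe s.base
  set G : ℂ → OnePoint ℂ := fun z => A • toSphere f z with hGdef
  have hG : LocUniv G := hF.smul A
  have hLG : Linked (fun z => A⁻¹ • G z) d := by simpa only [hGdef, inv_smul_smul] using hL
  obtain ⟨ε, hε, hu⟩ := hLG.exists_singUnique hG hd b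
  have hδ : 0 < ε / 8 := by positivity
  set δ := ε / 8 with hδdef
  refine ⟨⟨discNhd A b δ, discNhd_mem hA hδ⟩, fun s' hne Ω' hV => hne ?_⟩
  -- the base of the second singularity lies in the closed disc, in particular in the same chart
  have hcl : s'.base ∈ closure (discNhd A b δ) := by
    rw [mem_closure_iff_nhds]
    intro N hN
    obtain ⟨A', b', hA'⟩ := LocUniv.exists_smul_eq_coe s'.base
    obtain ⟨η, hη, hsub⟩ := exists_discNhd_subset hA' (inter_mem hN (Ω'.2.1.mem_nhds Ω'.2.2.1))
    have hsub := hsub η le_rfl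
    obtain ⟨x, hx⟩ := singularity_nonempty s' ⟨discNhd A' b' η, discNhd_mem hA' hη⟩
    refine ⟨toSphere f x, (hsub (singularity_subset s' _ hx)).1, ?_⟩
    have : x ∈ s'.V Ω' := s'.mono _ _ (hsub.trans inter_subset_right) hx
    rw [hV] at this
    exact singularity_subset s _ this
  obtain ⟨b', hA'⟩ : ∃ b' : ℂ, A • s'.base = (b' : OnePoint ℂ) := by
    have h1 : mobiusHomeo A s'.base ∈ closure ((↑) '' ball b δ : Set (OnePoint ℂ)) := by
      exact map_mem_closure (mobiusHomeo A).continuous hcl (mapsTo_preimage _ _)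
    rw [closure_coe_image isBounded_ball] at h1
    obtain ⟨b', -, h2⟩ := h1
    exact ⟨b', h2.symm⟩
  obtain ⟨ε', hε', hu'⟩ := hLG.exists_singUnique hG hd b'
  obtain ⟨η₀, hη₀, hsub⟩ := exists_discNhd_subset hA' (Ω'.2.1.mem_nhds Ω'.2.2.1)
  -- neighbourhoods of the second singularity contained in the given one of the first
  have hsmall : ∀ η (hη : 0 < η), η ≤ η₀ →
      s'.V ⟨discNhd A b' η, discNhd_mem hA' hη⟩ ⊆ s.V ⟨discNhd A b δ, discNhd_mem hA hδ⟩ :=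
    fun η hη h => (s'.mono _ _ (hsub η h)).trans hV.subset
  have hdisc := fun x => singularity_hasSingularDisc hF s hA hu hδ le_rfl (x := x)
  obtain rfl : b = b' := by
    set η := min η₀ (min (ε' / 8) δ) with hη
    have hη0 : 0 < η := lt_min hη₀ (lt_min (by positivity) hδ)
    have hη1 : η ≤ η₀ := min_le_left _ _
    have hη2 : η ≤ ε' / 8 := (min_le_right _ _).trans (min_le_left _ _)
    have hη3 : η ≤ δ := (min_le_right _ _).trans (min_le_right _ _)
    obtain ⟨x, hx⟩ := singularity_nonempty s' ⟨discNhd A b' η, discNhd_mem hA' hη0⟩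
    have hxs := hsmall η hη0 hη1 hx
    obtain ⟨c, hc, hcx⟩ := singularity_subset s' _ hx
    obtain ⟨c', hc', hcx'⟩ := singularity_subset s _ hxs
    obtain rfl : c = c' := OnePoint.coe_eq_coe.1 (hcx.trans hcx'.symm)
    rw [mem_ball] at hc hc'
    exact (hdisc x hxs).eq hG hu (singularity_hasSingularDisc hF s' hA' hu' hη0 hη2 hx) hcx.symm
      (by linarith) (by linarith)
  have hbase : s'.base = s.base := (mobiusHomeo A).injective (hA'.trans hA.symm)
  refine singularity_ext hbase fun Ω h1 h2 => ?_
  obtain ⟨η₁, hη₁, hsub₁⟩ := exists_discNhd_subset hA (h2.1.mem_nhds h2.2.1)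
  set η := min η₁ (min η₀ δ) with hη
  have hη0 : 0 < η := lt_min hη₁ (lt_min hη₀ hδ)
  have hη1 : η ≤ η₁ := min_le_left _ _
  have hη2 : η ≤ η₀ := (min_le_right _ _).trans (min_le_left _ _)
  have hη3 : η ≤ δ := (min_le_right _ _).trans (min_le_right _ _)
  obtain ⟨x, hx⟩ := singularity_nonempty s ⟨discNhd A b η, discNhd_mem hA hη0⟩
  obtain ⟨y, hy⟩ := singularity_nonempty s' ⟨discNhd A b η, discNhd_mem hA' hη0⟩
  have hxδ : x ∈ s.V ⟨discNhd A b δ, discNhd_mem hA hδ⟩ :=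
    s.mono _ _ (discNhd_subset A b hη3) hx
  have hyδ := hsmall η hη0 hη2 hy
  obtain ⟨z, hz, hVz⟩ := s.isComponent ⟨discNhd A b δ, discNhd_mem hA hδ⟩
  have hpre := isPreconnected_inter_component hG hη0 hη3 (z := z) (by
    intro x hx
    refine hdisc x ?_
    rw [hVz]; exact hx)
  have hxT : x ∈ connectedComponentIn (G ⁻¹' ((↑) '' ball b δ)) z ∩ G ⁻¹' ((↑) '' ball b η) := by
    refine ⟨?_, singularity_subset s _ hx⟩
    rw [hVz] at hxδ; exact hxδ
  have hyT : y ∈ connectedComponentIn (G ⁻¹' ((↑) '' ball b δ)) z ∩ G ⁻¹' ((↑) '' ball b η) := by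
    refine ⟨?_, singularity_subset s' _ hy⟩
    rw [hVz] at hyδ; exact hyδ
  have hyx : y ∈ s.V ⟨discNhd A b η, discNhd_mem hA hη0⟩ := by
    rw [singularity_eq_component s hx]
    exact hpre.subset_connectedComponentIn hxT inter_subset_right hyT
  exact ⟨y, s'.mono _ _ (hsub₁ η hη1) hy, s.mono _ _ (hsub₁ η hη1) hyx⟩

/-! ### Half-planes and their boundary circles -/

/-- The half-plane of the points with component greater than `t` in the direction `e`. -/
def halfPlane (e : ℂ) (t : ℝ) : Set ℂ := {u | t < (starRingEnd ℂ e * u).re}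

theorem isOpen_halfPlane (e : ℂ) (t : ℝ) : IsOpen (halfPlane e t) :=
  isOpen_lt continuous_const (by fun_prop)

theorem convex_halfPlane (e : ℂ) (t : ℝ) : Convex ℝ (halfPlane e t) := by
  have h : IsLinearMap ℝ fun u : ℂ => (starRingEnd ℂ e * u).re :=
    ⟨fun x y => by simp [mul_add], fun c x => by simp; ring⟩
  exact convex_halfSpace_gt h t

theorem conj_mul_mul {e : ℂ} (he : ‖e‖ = 1) (x : ℂ) : starRingEnd ℂ e * (e * x) = x := by
  rw [← mul_assoc, mul_comm (starRingEnd ℂ e), Complex.mul_conj']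
  simp [he]

/-- The boundary of the half-plane in the sphere. -/
def boundaryCircle (e : ℂ) (t : ℝ) : Set (OnePoint ℂ) :=
  insert OnePoint.infty ((↑) '' {u : ℂ | (starRingEnd ℂ e * u).re = t})

theorem boundaryCircle_subset_closure {e : ℂ} (he : ‖e‖ = 1) (t : ℝ) :
    boundaryCircle e t ⊆ closure ((↑) '' halfPlane e t) := by
  have hmem : ∀ (b : ℂ) (x : ℝ), t ≤ (starRingEnd ℂ e * b).re → 0 < x →
      b + e * x ∈ halfPlane e t := by
    intro b x hb hx
    rw [halfPlane, mem_ofPred_eq, mul_add, conj_mul_mul he, Complex.add_re, Complex.ofReal_re]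
    linarith
  rintro _ (rfl | ⟨b, hb, rfl⟩)
  · have hlim : Tendsto (fun x : ℝ => ((e * t + e * x : ℂ) : OnePoint ℂ)) atTop
        (𝓝 OnePoint.infty) := by
      refine tendsto_infty_of_norm fun R => ?_
      filter_upwards [eventually_gt_atTop (R + |t|)] with x hx w hw
      rw [← OnePoint.coe_eq_coe.1 hw, ← mul_add, norm_mul, he, one_mul, ← Complex.ofReal_add,
        Complex.norm_real, Real.norm_eq_abs]
      have := le_abs_self (t + x)
      have := neg_abs_le t
      linarith
    refine mem_closure_of_tendsto hlim ?_
    filter_upwards [eventually_gt_atTop 0] with x hx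
    refine mem_image_of_mem _ (hmem _ x ?_ hx)
    rw [conj_mul_mul he, Complex.ofReal_re]
  · have hc : Continuous fun x : ℝ => ((b + e * x : ℂ) : OnePoint ℂ) :=
      OnePoint.continuous_coe.comp (by fun_prop)
    have hlim : Tendsto (fun x : ℝ => ((b + e * x : ℂ) : OnePoint ℂ)) (𝓝[>] 0)
        (𝓝 (b : OnePoint ℂ)) := by
      have := hc.tendsto 0
      simp only [Complex.ofReal_zero, mul_zero, add_zero] at this
      exact this.mono_left nhdsWithin_le_nhds
    refine mem_closure_of_tendsto hlim ?_
    filter_upwards [self_mem_nhdsWithin] with x hx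
    exact mem_image_of_mem _ (hmem b x hb.ge hx)

theorem boundaryCircle_neg (e : ℂ) (t : ℝ) : boundaryCircle (-e) (-t) = boundaryCircle e t := by
  simp only [boundaryCircle, map_neg, neg_mul, Complex.neg_re, neg_inj]

theorem compl_halfPlane (e : ℂ) (t : ℝ) :
    ((↑) '' halfPlane e t : Set (OnePoint ℂ))ᶜ =
      boundaryCircle e t ∪ (↑) '' halfPlane (-e) (-t) := by
  ext x
  induction x using OnePoint.rec with
  | infty => simp [boundaryCircle]
  | coe u =>
    simp only [mem_compl_iff, OnePoint.coe_injective.mem_set_image, boundaryCircle, mem_union,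
      mem_insert_iff, OnePoint.coe_ne_infty, false_or, mem_ofPred_eq, halfPlane, map_neg, neg_mul,
      Complex.neg_re, neg_lt_neg_iff, not_lt, le_iff_lt_or_eq]
    tauto

theorem closure_halfPlane_sphere {e : ℂ} (he : ‖e‖ = 1) (t : ℝ) :
    closure ((↑) '' halfPlane e t : Set (OnePoint ℂ)) = ((↑) '' halfPlane (-e) (-t))ᶜ := by
  have h := compl_halfPlane (-e) (-t)
  rw [boundaryCircle_neg, neg_neg, neg_neg] at h
  refine (closure_minimal ?_ (OnePoint.isOpen_image_coe.2
    (isOpen_halfPlane _ _)).isClosed_compl).antisymm ?_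
  · rw [h]; exact subset_union_right
  · rw [h]; exact union_subset (boundaryCircle_subset_closure he t) subset_closure

theorem frontier_halfPlane_sphere {e : ℂ} (he : ‖e‖ = 1) (t : ℝ) :
    frontier ((↑) '' halfPlane e t : Set (OnePoint ℂ)) = boundaryCircle e t := by
  have h := compl_halfPlane e t
  rw [(OnePoint.isOpen_image_coe.2 (isOpen_halfPlane e t)).frontier_eq,
    closure_halfPlane_sphere he, sdiff_eq, h, inter_union_distrib_left, inter_comm,
    compl_inter_self, union_empty, inter_eq_left]
  have h' := compl_halfPlane (-e) (-t)
  rw [boundaryCircle_neg] at h'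
  rw [h']; exact subset_union_left

theorem isRegion_halfPlane {e : ℂ} (he : ‖e‖ = 1) (t : ℝ) : IsRegion (halfPlane e t) := by
  refine ⟨isOpen_halfPlane e t, ?_, (convex_halfPlane e t).isPreconnected, ?_, ?_⟩
  · refine ⟨e * (t + 1 : ℝ), ?_⟩
    rw [halfPlane, mem_ofPred_eq, conj_mul_mul he, Complex.ofReal_re]; linarith
  · rw [closure_halfPlane_sphere he, compl_compl]
    exact (convex_halfPlane _ _).isPreconnected.image _ OnePoint.continuous_coe.continuousOn
  · rw [closure_halfPlane_sphere he, compl_compl, frontier_halfPlane_sphere he,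
      ← boundaryCircle_neg]
    exact boundaryCircle_subset_closure (by rwa [norm_neg]) _

/-- A parametrization of the boundary circle of a half-plane, by half of the central angle. -/
noncomputable def circlePt (e : ℂ) (t a : ℝ) : OnePoint ℂ :=
  ratio (e * (t * Real.cos a + Complex.I * (√(1 + t ^ 2) * Real.sin a : ℝ)), (Real.cos a : ℂ))

theorem circlePt_of_cos_eq_zero (e : ℂ) (t : ℝ) {a : ℝ} (h : Real.cos a = 0) :
    circlePt e t a = OnePoint.infty := by
  simp [circlePt, ratio, h]

theorem circlePt_of_cos_ne_zero (e : ℂ) (t : ℝ) {a : ℝ} (h : Real.cos a ≠ 0) :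
    circlePt e t a =
      ((e * (t + Complex.I * (√(1 + t ^ 2) * Real.tan a : ℝ)) : ℂ) : OnePoint ℂ) := by
  have h' : (Real.cos a : ℂ) ≠ 0 := by exact_mod_cast h
  rw [circlePt, ratio, if_neg h', OnePoint.coe_eq_coe, Real.tan_eq_sin_div_cos]
  simp only [Complex.ofReal_mul, Complex.ofReal_div]
  field_simp

theorem continuous_circlePt {e : ℂ} (he : ‖e‖ = 1) (t : ℝ) : Continuous (circlePt e t) := by
  rw [continuous_iff_continuousAt]
  intro a
  have h : ((e * (t * Real.cos a + Complex.I * (√(1 + t ^ 2) * Real.sin a : ℝ)),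
      (Real.cos a : ℂ)) : ℂ × ℂ) ≠ 0 := by
    intro h0
    rw [Prod.mk_eq_zero] at h0
    have hc : Real.cos a = 0 := by exact_mod_cast h0.2
    have he0 : e ≠ 0 := by rintro rfl; simp at he
    have h1 := (mul_eq_zero.1 h0.1).resolve_left he0
    rw [hc] at h1
    simp only [Complex.ofReal_zero, mul_zero, zero_add, mul_eq_zero, Complex.I_ne_zero, false_or,
      Complex.ofReal_eq_zero] at h1
    have h2 : 0 < √(1 + t ^ 2) := Real.sqrt_pos.2 (by positivity)
    have h3 := h1.resolve_left h2.ne'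
    have := Real.sin_sq_add_cos_sq a
    rw [h3, hc] at this
    norm_num at this
  exact ContinuousAt.comp (g := ratio) (f := fun a : ℝ =>
    ((e * (t * Real.cos a + Complex.I * (√(1 + t ^ 2) * Real.sin a : ℝ)),
      (Real.cos a : ℂ)) : ℂ × ℂ)) (continuousAt_ratio h)
    (Continuous.continuousAt (by fun_prop))

theorem normSq_line {e : ℂ} (he : ‖e‖ = 1) (x y : ℝ) :
    ‖e * (x + Complex.I * y)‖ ^ 2 = x ^ 2 + y ^ 2 := by
  rw [norm_mul, he, one_mul, Complex.sq_norm, Complex.normSq_apply]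
  simp; ring

/-- The boundary circle of the half-plane has the radius `1 / √(1 + t ^ 2)` on the unit sphere. -/
theorem cosDist_circlePt {e : ℂ} (he : ‖e‖ = 1) (t a b : ℝ) :
    cosDist (circlePt e t a) (circlePt e t b) = 1 - 2 * Real.sin (a - b) ^ 2 / (1 + t ^ 2) := by
  have hS : 0 < 1 + t ^ 2 := by positivity
  have hsq : √(1 + t ^ 2) ^ 2 = 1 + t ^ 2 := Real.sq_sqrt hS.le
  have h1 : ∀ a, Real.cos a ≠ 0 → 1 + (t ^ 2 + (√(1 + t ^ 2) * Real.tan a) ^ 2) =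
      (1 + t ^ 2) / Real.cos a ^ 2 := by
    intro a ha
    rw [mul_pow, hsq, Real.tan_eq_sin_div_cos]
    field_simp
    linear_combination (1 + t ^ 2) * Real.sin_sq_add_cos_sq a
  have hinf : ∀ a b, Real.cos a = 0 → Real.cos b ≠ 0 →
      cosDist OnePoint.infty (circlePt e t b) = 1 - 2 * Real.sin (a - b) ^ 2 / (1 + t ^ 2) := by
    intro a b ha hb
    rw [circlePt_of_cos_ne_zero e t hb, cosDist_infty_coe, normSq_line he, h1 b hb,
      Real.sin_sub, ha]
    have : Real.sin a ^ 2 = 1 := by have := Real.sin_sq_add_cos_sq a; rw [ha] at this; linarith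
    rw [zero_mul, sub_zero, mul_pow, this]
    field_simp
  by_cases ha : Real.cos a = 0
  · by_cases hb : Real.cos b = 0
    · rw [circlePt_of_cos_eq_zero e t ha, circlePt_of_cos_eq_zero e t hb, cosDist_self,
        Real.sin_sub, ha, hb]
      simp
    · rw [circlePt_of_cos_eq_zero e t ha, hinf a b ha hb]
  · by_cases hb : Real.cos b = 0
    · rw [circlePt_of_cos_eq_zero e t hb, cosDist_comm, hinf b a hb ha, ← neg_sub a b,
        Real.sin_neg, neg_sq]
    · have e1 : e * (t + Complex.I * (√(1 + t ^ 2) * Real.tan a : ℝ)) -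
          e * (t + Complex.I * (√(1 + t ^ 2) * Real.tan b : ℝ)) =
          e * ((0 : ℝ) + Complex.I * (√(1 + t ^ 2) * (Real.tan a - Real.tan b) : ℝ)) := by
        push_cast; ring
      rw [circlePt_of_cos_ne_zero e t ha, circlePt_of_cos_ne_zero e t hb, cosDist_coe, e1,
        normSq_line he, normSq_line he, normSq_line he, h1 a ha, h1 b hb, Real.sin_sub, mul_pow,
        hsq, Real.tan_eq_sin_div_cos, Real.tan_eq_sin_div_cos]
      field_simp
      ring

theorem circlePt_eq_iff {e : ℂ} (he : ‖e‖ = 1) (t : ℝ) {a b : ℝ} (hab : |a - b| < Real.pi)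
    (h : circlePt e t a = circlePt e t b) : a = b := by
  have h1 := cosDist_circlePt he t a b
  rw [h, cosDist_self] at h1
  have hS : 0 < 1 + t ^ 2 := by positivity
  have h2 : Real.sin (a - b) ^ 2 = 0 := by
    have : 2 * Real.sin (a - b) ^ 2 / (1 + t ^ 2) = 0 := by linarith
    rw [div_eq_zero_iff] at this
    rcases this with h3 | h3
    · linarith
    · exact absurd h3 hS.ne'
  have h3 : Real.sin (a - b) = 0 := by simpa using h2
  rw [abs_lt] at hab
  exact sub_eq_zero.1 ((Real.sin_eq_zero_iff_of_lt_of_lt hab.1 hab.2).1 h3)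

theorem image_circlePt {e : ℂ} (he : ‖e‖ = 1) (t : ℝ) :
    circlePt e t '' Icc (-(Real.pi / 2)) (Real.pi / 2) = boundaryCircle e t := by
  ext x
  constructor
  · rintro ⟨a, -, rfl⟩
    by_cases ha : Real.cos a = 0
    · rw [circlePt_of_cos_eq_zero e t ha]; exact Or.inl rfl
    · rw [circlePt_of_cos_ne_zero e t ha]
      refine Or.inr ⟨_, ?_, rfl⟩
      rw [mem_ofPred_eq, conj_mul_mul he]
      simp
  · rintro (rfl | ⟨u, hu, rfl⟩)
    · exact ⟨Real.pi / 2, ⟨by linarith [Real.pi_pos], le_rfl⟩,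
        circlePt_of_cos_eq_zero e t Real.cos_pi_div_two⟩
    · have hs : √(1 + t ^ 2) ≠ 0 := (Real.sqrt_pos.2 (by positivity)).ne'
      refine ⟨Real.arctan ((starRingEnd ℂ e * u).im / √(1 + t ^ 2)),
        ⟨(Real.neg_pi_div_two_lt_arctan _).le, (Real.arctan_lt_pi_div_two _).le⟩, ?_⟩
      rw [circlePt_of_cos_ne_zero e t (Real.cos_arctan_pos _).ne', Real.tan_arctan,
        mul_div_cancel₀ _ hs, OnePoint.coe_eq_coe]
      rw [mem_ofPred_eq] at hu
      rw [← hu, mul_comm Complex.I, Complex.re_add_im, ← mul_assoc, Complex.mul_conj', he]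
      simp

/-- The antipode of the midpoint of an arc of length `l` in the parameter has distance at least
`π - l` from the whole arc. -/
theorem arc_distance {e : ℂ} (he : ‖e‖ = 1) (t m l : ℝ) (hl : 0 ≤ l) (hl' : l < Real.pi) :
    ∃ w, (∀ a, |a - m| ≤ l / 2 → Real.pi - l ≤ angDist w (circlePt e t a)) := by
  obtain ⟨w, hw⟩ := exists_antipode (circlePt e t m)
  refine ⟨w, fun a ha => ?_⟩
  rw [angDist, hw, cosDist_circlePt he]
  have h1 : Real.cos l ≤ 1 - 2 * Real.sin (m - a) ^ 2 := by
    have h2 : Real.cos (2 * (m - a)) = 1 - 2 * Real.sin (m - a) ^ 2 := by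
      rw [Real.cos_two_mul, Real.cos_sq']; ring
    rw [← h2, ← Real.cos_abs (2 * (m - a)), abs_mul, abs_two, abs_sub_comm]
    exact Real.cos_le_cos_of_nonneg_of_le_pi (by positivity) hl'.le (by linarith)
  have h3 : Real.sin (m - a) ^ 2 / (1 + t ^ 2) ≤ Real.sin (m - a) ^ 2 :=
    div_le_self (sq_nonneg _) (by nlinarith [sq_nonneg t])
  rw [← Real.arccos_cos (x := Real.pi - l) (by linarith) (by linarith), Real.cos_pi_sub]
  refine Real.arccos_le_arccos ?_
  rw [mul_div_assoc]
  linarith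

/-- Three points on the boundary circle of a half-plane cannot all be singular if the diameter is
less than `4 π / 3`: for any two of the three arcs, whose lengths in the parameter sum up to `π`,
the antipodes of their midpoints give a lower bound for the diameter. -/
theorem Linked.eq_of_singAt (hF : LocUniv F) {d : ℝ} (hL : Linked F d) (hd : d < 4 * Real.pi / 3)
    {e : ℂ} (he : ‖e‖ = 1) {t : ℝ} {φ : ℂ → ℂ} (h : IsSec F (halfPlane e t) φ)
    (hinf : SingAt F (halfPlane e t) φ OnePoint.infty) {p q : ℂ}
    (hp : (starRingEnd ℂ e * p).re = t) (hq : (starRingEnd ℂ e * q).re = t)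
    (hsp : SingAt F (halfPlane e t) φ p) (hsq : SingAt F (halfPlane e t) φ q) : p = q := by
  by_contra hpq
  have hpi := Real.pi_pos
  -- parameters of the two finite points
  have hpar : ∀ u : ℂ, (starRingEnd ℂ e * u).re = t →
      ∃ a ∈ Ioo (-(Real.pi / 2)) (Real.pi / 2), circlePt e t a = u := by
    intro u hu
    have : (u : OnePoint ℂ) ∈ circlePt e t '' Icc (-(Real.pi / 2)) (Real.pi / 2) := by
      rw [image_circlePt he]; exact Or.inr ⟨u, hu, rfl⟩
    obtain ⟨a, ha, hau⟩ := this
    refine ⟨a, ⟨lt_of_le_of_ne ha.1 ?_, lt_of_le_of_ne ha.2 ?_⟩, hau⟩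
    · rintro rfl
      rw [circlePt_of_cos_eq_zero e t (by simp)] at hau
      exact OnePoint.infty_ne_coe u hau
    · rintro rfl
      rw [circlePt_of_cos_eq_zero e t (by simp)] at hau
      exact OnePoint.infty_ne_coe u hau
  obtain ⟨α, β, hα, hαβ, hβ, hsα, hsβ⟩ : ∃ α β, -(Real.pi / 2) < α ∧ α < β ∧ β < Real.pi / 2 ∧
      SingAt F (halfPlane e t) φ (circlePt e t α) ∧
      SingAt F (halfPlane e t) φ (circlePt e t β) := by
    obtain ⟨a, ha, hap⟩ := hpar p hp
    obtain ⟨b, hb, hbq⟩ := hpar q hq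
    rw [← hap] at hsp
    rw [← hbq] at hsq
    rcases lt_trichotomy a b with hab | rfl | hab
    · exact ⟨a, b, ha.1, hab, hb.2, hsp, hsq⟩
    · exact absurd (OnePoint.coe_eq_coe.1 (hap.symm.trans hbq)) hpq
    · exact ⟨b, a, hb.1, hab, ha.2, hsq, hsp⟩
  set P := circlePt e t with hP
  have hPc : Continuous P := continuous_circlePt he t
  have hPend : ∀ a, a = -(Real.pi / 2) ∨ a = Real.pi / 2 → P a = OnePoint.infty := by
    rintro a (rfl | rfl) <;> exact circlePt_of_cos_eq_zero e t (by simp)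
  have hinj : ∀ a ∈ Icc (-(Real.pi / 2)) (Real.pi / 2), ∀ b ∈ Icc (-(Real.pi / 2)) (Real.pi / 2),
      P a = P b → a = b ∨ P a = OnePoint.infty ∧ (a ≤ -(Real.pi / 2) ∧ Real.pi / 2 ≤ b ∨
        b ≤ -(Real.pi / 2) ∧ Real.pi / 2 ≤ a) := by
    intro a ha b hb hab
    by_cases hlt : |a - b| < Real.pi
    · exact Or.inl (circlePt_eq_iff he t hlt hab)
    · right
      rw [not_lt, le_abs] at hlt
      rcases hlt with h1 | h1
      · exact ⟨hPend a (Or.inr (by linarith [ha.2, hb.1])),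
          Or.inr ⟨by linarith [ha.2], by linarith [hb.1]⟩⟩
      · exact ⟨hPend a (Or.inl (by linarith [ha.1, hb.2])),
          Or.inl ⟨by linarith [hb.2], by linarith [ha.1]⟩⟩
  -- the three arcs
  have hcl : ∀ x y, IsClosed (P '' Icc x y) := fun x y => (isCompact_Icc.image hPc).isClosed
  set T₁ := P '' Icc (-(Real.pi / 2)) α with hT₁
  set T₂ := P '' Icc α β with hT₂
  set T₃ := P '' Icc β (Real.pi / 2) with hT₃
  have hunion : T₁ ∪ T₂ ∪ T₃ = frontier ((↑) '' halfPlane e t : Set (OnePoint ℂ)) := by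
    rw [frontier_halfPlane_sphere he, ← image_circlePt he, hT₁, hT₂, hT₃, ← image_union,
      ← image_union, Icc_union_Icc_eq_Icc hα.le hαβ.le,
      Icc_union_Icc_eq_Icc (hα.trans hαβ).le hβ.le]
  have s12 : ∀ b ∈ T₁, b ∈ T₂ → SingAt F (halfPlane e t) φ b := by
    rintro _ ⟨a, ha, rfl⟩ ⟨b, hb, hab⟩
    rcases hinj b ⟨by linarith [hb.1], by linarith [hb.2]⟩ a
      ⟨by linarith [ha.1], by linarith [ha.2]⟩ hab with rfl | ⟨h1, -⟩
    · rwa [le_antisymm ha.2 hb.1]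
    · rwa [← hab, h1]
  have s23 : ∀ b ∈ T₂, b ∈ T₃ → SingAt F (halfPlane e t) φ b := by
    rintro _ ⟨a, ha, rfl⟩ ⟨b, hb, hab⟩
    rcases hinj b ⟨by linarith [hb.1], by linarith [hb.2]⟩ a
      ⟨by linarith [ha.1], by linarith [ha.2]⟩ hab with rfl | ⟨h1, -⟩
    · rwa [le_antisymm ha.2 hb.1]
    · rwa [← hab, h1]
  have s13 : ∀ b ∈ T₁, b ∈ T₃ → SingAt F (halfPlane e t) φ b := by
    rintro _ ⟨a, ha, rfl⟩ ⟨b, hb, hab⟩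
    rcases hinj b ⟨by linarith [hb.1], by linarith [hb.2]⟩ a
      ⟨by linarith [ha.1], by linarith [ha.2]⟩ hab with rfl | ⟨h1, -⟩
    · exact absurd (hb.1.trans ha.2) hαβ.not_ge
    · rwa [← hab, h1]
  -- the midpoint of an arc belongs to no other arc
  have hmid : ∀ x y x' y', -(Real.pi / 2) ≤ x → x < y → y ≤ Real.pi / 2 → -(Real.pi / 2) ≤ x' →
      y' ≤ Real.pi / 2 → (y ≤ x' ∨ y' ≤ x) → P ((x + y) / 2) ∉ P '' Icc x' y' := by
    rintro x y x' y' h1 h2 h3 h4 h5 h6 ⟨b, hb, hab⟩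
    rcases hinj b ⟨by linarith [hb.1], by linarith [hb.2]⟩ ((x + y) / 2)
      ⟨by linarith, by linarith⟩ hab with rfl | ⟨-, h7 | h7⟩
    · rcases h6 with h6 | h6 <;> linarith [hb.1, hb.2]
    · linarith
    · linarith
  have hmem : ∀ x y, x < y → P ((x + y) / 2) ∈ P '' Icc x y := fun x y hxy =>
    mem_image_of_mem _ ⟨by linarith, by linarith⟩
  have m12 := hmid _ _ α β le_rfl hα (by linarith) hα.le hβ.le (Or.inl le_rfl)
  have m13 := hmid _ _ β (Real.pi / 2) le_rfl hα (by linarith) (by linarith) le_rfl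
    (Or.inl hαβ.le)
  have m21 := hmid α β _ α hα.le hαβ hβ.le le_rfl (by linarith) (Or.inr le_rfl)
  have m23 := hmid α β β (Real.pi / 2) hα.le hαβ hβ.le (by linarith) le_rfl (Or.inl le_rfl)
  have m31 := hmid β _ _ α (by linarith) hβ le_rfl le_rfl (by linarith) (Or.inr hαβ.le)
  have m32 := hmid β _ α β (by linarith) hβ le_rfl hα.le hβ.le (Or.inr le_rfl)
  have split₁ : IsSplit F (halfPlane e t) φ T₁ (T₂ ∪ T₃) :=
    ⟨hcl _ _, (hcl _ _).union (hcl _ _), by rw [← union_assoc, hunion],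
      fun b h1 h2 => h2.elim (s12 b h1) (s13 b h1), ⟨_, hmem _ _ hα, fun h' => h'.elim m12 m13⟩,
      ⟨_, Or.inl (hmem _ _ hαβ), m21⟩⟩
  have split₂ : IsSplit F (halfPlane e t) φ T₂ (T₁ ∪ T₃) :=
    ⟨hcl _ _, (hcl _ _).union (hcl _ _), by rw [← union_assoc, union_comm T₂, hunion],
      fun b h1 h2 => h2.elim (fun h3 => s12 b h3 h1) (s23 b h1),
      ⟨_, hmem _ _ hαβ, fun h' => h'.elim m21 m23⟩, ⟨_, Or.inl (hmem _ _ hα), m12⟩⟩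
  have split₃ : IsSplit F (halfPlane e t) φ T₃ (T₁ ∪ T₂) :=
    ⟨hcl _ _, (hcl _ _).union (hcl _ _), by rw [union_comm, hunion],
      fun b h1 h2 => h2.elim (fun h3 => s13 b h3 h1) (fun h3 => s23 b h3 h1),
      ⟨_, hmem _ _ hβ, fun h' => h'.elim m31 m32⟩, ⟨_, Or.inl (hmem _ _ hα), m13⟩⟩
  have hdist : ∀ x y, x < y → y - x < Real.pi → ∃ w, w ∉ P '' Icc x y ∧
      ∀ b ∈ P '' Icc x y, Real.pi - (y - x) ≤
        angDist ((1 : GL (Fin 2) ℂ) • w) ((1 : GL (Fin 2) ℂ) • b) := by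
    intro x y hxy hlt
    obtain ⟨w, hw⟩ := arc_distance he t ((x + y) / 2) (y - x) (by linarith) hlt
    have hw' : ∀ b ∈ P '' Icc x y, Real.pi - (y - x) ≤ angDist w b := by
      rintro _ ⟨a, ha, rfl⟩
      refine hw a (abs_le.2 ⟨?_, ?_⟩) <;> linarith [ha.1, ha.2]
    refine ⟨w, fun hmem => ?_, fun b hb => by simpa only [one_smul] using hw' b hb⟩
    have := hw' w hmem
    rw [angDist, cosDist_self, Real.arccos_one] at this
    linarith
  obtain ⟨w₁, n₁, d₁⟩ := hdist _ _ hα (by linarith)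
  obtain ⟨w₂, n₂, d₂⟩ := hdist _ _ hαβ (by linarith)
  obtain ⟨w₃, n₃, d₃⟩ := hdist _ _ hβ (by linarith)
  have hL' : Linked (fun z => (1 : GL (Fin 2) ℂ) • F z) d := by simpa only [one_smul] using hL
  have hR := isRegion_halfPlane he t
  have e12 := hL'.add_le hF hR h split₁ split₂ s12 n₁ n₂ d₁ d₂
  have e23 := hL'.add_le hF hR h split₂ split₃ s23 n₂ n₃ d₂ d₃
  have e13 := hL'.add_le hF hR h split₁ split₃ s13 n₁ n₃ d₁ d₃
  linarith

/-! ### Extremal half-planes -/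

theorem SingAt.smul {Ω Ω' : Set ℂ} {φ m : ℂ → ℂ} {b : OnePoint ℂ} (h : SingAt F Ω φ b)
    (A : GL (Fin 2) ℂ) (hmaps : MapsTo m Ω' Ω) :
    SingAt (fun z => A • F z) Ω' (φ ∘ m) (A • b) := by
  intro z hz he
  refine h z (closure_mono ?_ hz) ((mobiusHomeo A).injective he)
  rw [image_comp]
  exact image_mono hmaps.image_subset

theorem mem_halfPlane_inv_iff {e w : ℂ} (he : ‖e‖ = 1) {t k : ℝ} (hk : 0 < k)
    (ht : t = (starRingEnd ℂ e * w).re + k) {v : ℂ} (hv : v ≠ 0) :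
    w + v⁻¹ ∈ halfPlane e t ↔ v ∈ ball (starRingEnd ℂ e / (2 * k : ℝ)) (1 / (2 * k)) := by
  have hv2 : 0 < Complex.normSq v := Complex.normSq_pos.2 hv
  have hee : e.re * e.re + e.im * e.im = 1 := by
    rw [← Complex.normSq_apply, ← Complex.sq_norm, he, one_pow]
  have e1 : (starRingEnd ℂ e * (w + v⁻¹)).re =
      (starRingEnd ℂ e * w).re + (e.re * v.re - e.im * v.im) / Complex.normSq v := by
    rw [mul_add, Complex.add_re, Complex.mul_re _ v⁻¹, Complex.inv_re, Complex.inv_im]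
    simp only [Complex.conj_re, Complex.conj_im]
    ring
  have e2 : ‖v - starRingEnd ℂ e / (2 * k : ℝ)‖ ^ 2 =
      Complex.normSq v - (e.re * v.re - e.im * v.im) / k + (1 / (2 * k)) ^ 2 := by
    rw [Complex.sq_norm, Complex.normSq_apply, Complex.normSq_apply, Complex.sub_re,
      Complex.sub_im, Complex.div_ofReal_re, Complex.div_ofReal_im, Complex.conj_re,
      Complex.conj_im]
    field_simp
    linear_combination hee
  have hk2 : 0 < 1 / (2 * k) := by positivity
  rw [mem_ball, dist_eq_norm, ← sq_lt_sq₀ (norm_nonneg _) hk2.le, e2, halfPlane, mem_ofPred_eq, e1,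
    ht, add_lt_add_iff_left, lt_div_iff₀ hv2]
  constructor
  · intro h
    have : Complex.normSq v < (e.re * v.re - e.im * v.im) / k := by
      rw [lt_div_iff₀ hk]; linarith
    linarith
  · intro h
    have : Complex.normSq v < (e.re * v.re - e.im * v.im) / k := by linarith
    rw [lt_div_iff₀ hk] at this
    linarith

theorem zero_mem_sphere_inv {e : ℂ} (he : ‖e‖ = 1) {k : ℝ} (hk : 0 < k) :
    (0 : ℂ) ∈ sphere (starRingEnd ℂ e / (2 * k : ℝ)) (1 / (2 * k)) := by
  rw [mem_sphere, dist_eq_norm, zero_sub, norm_neg, norm_div, Complex.norm_real, RCLike.norm_conj,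
    he, Real.norm_of_nonneg (by positivity)]

/-- Near a singular boundary point, a section over a convex set extends to the discs which have this
point on their boundary. -/
theorem SingUnique.exists_sections (hF : LocUniv F) {a : ℂ} {ε : ℝ} (hε : 0 < ε)
    (hu : SingUnique F a ε) {D : Set ℂ} {φ : ℂ → ℂ} (hD : IsOpen D) (hDc : Convex ℝ D)
    (h : IsSec F D φ) (ha : a ∈ frontier D) (hs : SingAt F D φ a) :
    ∃ δ > 0, ∀ v ∈ D, dist v a < δ → ∃ χ, IsSec F (ball v (dist v a)) χ ∧ χ v = φ v := by
  have hδ : 0 < ε / 8 := by positivity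
  set δ := ε / 8 with hδdef
  have hDδ : Convex ℝ (D ∩ ball a δ) := hDc.inter (convex_ball _ _)
  have hacl : a ∈ closure (D ∩ ball a δ) := by
    rw [mem_closure_iff_nhds]
    intro N hN
    obtain ⟨y, ⟨hyN, hyb⟩, hyD⟩ :=
      mem_closure_iff_nhds.1 ha.1 (N ∩ ball a δ) (inter_mem hN (ball_mem_nhds a hδ))
    exact ⟨y, hyN, hyD, hyb⟩
  obtain ⟨v₀, hv₀D, hv₀⟩ : (D ∩ ball a δ).Nonempty := closure_nonempty_iff.1 ⟨a, hacl⟩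
  have hC : ∀ v ∈ D ∩ ball a δ,
      φ v ∈ connectedComponentIn (F ⁻¹' ((↑) '' ball a δ)) (φ v₀) := by
    intro v hv
    refine (hDδ.isPreconnected.image φ (h.cont.mono inter_subset_left)).subset_connectedComponentIn
      ⟨v₀, ⟨hv₀D, hv₀⟩, rfl⟩ ?_ ⟨v, hv, rfl⟩
    rintro _ ⟨w, hw, rfl⟩
    exact ⟨w, hw.2, (h.eq w hw.1).symm⟩
  have hno : ¬ ∃ ψ, IsSec F (ball a δ) ψ ∧
      ψ '' ball a δ = connectedComponentIn (F ⁻¹' ((↑) '' ball a δ)) (φ v₀) := by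
    rintro ⟨ψ, hψ, him⟩
    have h1 := hC v₀ ⟨hv₀D, hv₀⟩
    rw [← him] at h1
    obtain ⟨w, hw, he⟩ := h1
    obtain rfl : w = v₀ := by
      have := hψ.eq w hw
      rw [he, h.eq v₀ hv₀D] at this
      exact (OnePoint.coe_eq_coe.1 this).symm
    have := hs.of_eqOn_inter hF h hψ hDc (convex_ball _ _)
      ((h.mono inter_subset_left).eqOn hF (hψ.mono inter_subset_right) hDδ.isPreconnected
        ⟨hv₀D, hv₀⟩ he.symm) hacl
    exact this (ψ a) (subset_closure ⟨a, mem_ball_self hδ, rfl⟩) (hψ.eq a (mem_ball_self hδ))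
  obtain ⟨p, hp⟩ := hu.exists_hasSingularDisc hF le_rfl hno
  refine ⟨δ, hδ, fun v hv hvδ => ?_⟩
  obtain ⟨⟨c, χ, h1, h2, h3, h4, h5⟩, h6⟩ := hp _ (hC v ⟨hv, hvδ⟩)
  have hcv : v = c := OnePoint.coe_eq_coe.1 ((h.eq v hv).symm.trans h1)
  subst hcv
  have hvp := h6 v h1
  have hm : v ∈ ball v (dist v p) := mem_ball_self (dist_pos.2 h2)
  obtain rfl : a = p := by
    refine hu (h.mono (inter_subset_left (t := ball a δ))) h3 (hD.inter isOpen_ball) isOpen_ball hDδ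
      (convex_ball _ _)
      (inter_subset_right.trans (ball_subset_ball (by linarith)))
      (ball_subset_ball' (by linarith)) ⟨v, ⟨hv, hvδ⟩, hm⟩
      ((h.mono (inter_subset_left.trans inter_subset_left)).eqOn hF (h3.mono inter_subset_right)
        (hDδ.inter (convex_ball _ _)).isPreconnected ⟨⟨hv, hvδ⟩, hm⟩ h4.symm) ?_
      (hs.mono inter_subset_left) (mem_frontier_ball_dist h2) h5
    rw [(hD.inter isOpen_ball).frontier_eq]
    rw [hD.frontier_eq] at ha
    exact ⟨hacl, fun h' => ha.2 h'.1⟩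
  exact ⟨χ, h3, h4⟩

/-- Uniqueness of singular boundary points near every point of the sphere, in arbitrary charts. -/
theorem Linked.exists_singUnique_smul (hF : LocUniv F) {d : ℝ} (hL : Linked F d)
    (hd : d < 2 * Real.pi) (A : GL (Fin 2) ℂ) (a : ℂ) :
    ∃ ε > 0, SingUnique (fun z => A • F z) a ε :=
  Linked.exists_singUnique (hF.smul A) (M := A⁻¹) (by simpa only [inv_smul_smul] using hL) hd a

theorem invSub_inv {w v : ℂ} (hv : v ≠ 0) :
    invSub w • ((w + v⁻¹ : ℂ) : OnePoint ℂ) = (v : OnePoint ℂ) := by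
  rw [invSub_coe (by simpa using hv)]
  simp

/-- A section over a half-plane, read in the chart `u ↦ 1 / (u - w)`. -/
theorem IsSec.comp_invSub {e w : ℂ} (he : ‖e‖ = 1) {t k : ℝ} (hk : 0 < k)
    (ht : t = (starRingEnd ℂ e * w).re + k) {φ : ℂ → ℂ} (h : IsSec F (halfPlane e t) φ) :
    IsSec (fun z => invSub w • F z)
      (ball (starRingEnd ℂ e / (2 * k : ℝ)) (1 / (2 * k))) (φ ∘ fun v => w + v⁻¹) := by
  have hne : ∀ v ∈ ball (starRingEnd ℂ e / (2 * k : ℝ)) (1 / (2 * k)), v ≠ 0 := by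
    rintro v hv rfl
    exact (mem_ball.1 hv).ne (zero_mem_sphere_inv he hk)
  refine h.smul _ ?_ (fun v hv => (mem_halfPlane_inv_iff he hk ht (hne v hv)).2 hv)
    fun v hv => invSub_inv (hne v hv)
  exact continuousOn_const.add (continuousOn_inv₀.mono hne)

theorem singAt_invSub_iff {e w : ℂ} (he : ‖e‖ = 1) {t k : ℝ} (hk : 0 < k)
    (ht : t = (starRingEnd ℂ e * w).re + k) {φ : ℂ → ℂ} :
    SingAt (fun z => invSub w • F z) (ball (starRingEnd ℂ e / (2 * k : ℝ)) (1 / (2 * k)))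
      (φ ∘ fun v => w + v⁻¹) ((0 : ℂ) : OnePoint ℂ) ↔
    SingAt F (halfPlane e t) φ OnePoint.infty := by
  have him : (φ ∘ fun v => w + v⁻¹) '' ball (starRingEnd ℂ e / (2 * k : ℝ)) (1 / (2 * k)) =
      φ '' halfPlane e t := by
    rw [image_comp]
    congr 1
    ext u
    constructor
    · rintro ⟨v, hv, rfl⟩
      refine (mem_halfPlane_inv_iff he hk ht ?_).2 hv
      rintro rfl
      exact (mem_ball.1 hv).ne (zero_mem_sphere_inv he hk)
    · intro hu
      have hne : u - w ≠ 0 := by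
        intro h0
        rw [sub_eq_zero.1 h0, halfPlane, mem_ofPred_eq] at hu
        linarith
      have hu' : w + (u - w)⁻¹⁻¹ = u := by rw [inv_inv]; ring
      exact ⟨(u - w)⁻¹, (mem_halfPlane_inv_iff he hk ht (inv_ne_zero hne)).1 (by rwa [hu']), hu'⟩
  unfold SingAt
  rw [him, ← invSub_infty w]
  simp only [ne_eq, smul_left_cancel_iff]

theorem add_mem_halfPlane {e : ℂ} (he : ‖e‖ = 1) {t x : ℝ} {u : ℂ}
    (h : t < (starRingEnd ℂ e * u).re + x) : u + e * x ∈ halfPlane e t := by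
  rw [halfPlane, mem_ofPred_eq, mul_add, conj_mul_mul he, Complex.add_re, Complex.ofReal_re]
  exact h

/-- A section over a half-plane for which the point at infinity is singular extends to a half-plane
with a singular point on the boundary line. -/
theorem IsSec.exists_extremal_halfPlane (hF : LocUniv F)
    (hU : ∀ (A : GL (Fin 2) ℂ) (a : ℂ), ∃ ε > 0, SingUnique (fun z => A • F z) a ε)
    (hng : ¬ ∃ φ, IsSec F univ φ) {e : ℂ} (he : ‖e‖ = 1) {t : ℝ} {φ : ℂ → ℂ}
    (h : IsSec F (halfPlane e t) φ) (hinf : SingAt F (halfPlane e t) φ OnePoint.infty) :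
    ∃ (s : ℝ) (ψ : ℂ → ℂ) (q : ℂ), IsSec F (halfPlane e s) ψ ∧
      SingAt F (halfPlane e s) ψ OnePoint.infty ∧ (starRingEnd ℂ e * q).re = s ∧
      SingAt F (halfPlane e s) ψ q := by
  have hmono : ∀ {s s' : ℝ}, s ≤ s' → halfPlane e s' ⊆ halfPlane e s :=
    fun hs u hu => lt_of_le_of_lt hs hu
  let S : Set ℝ := {s | s ≤ t ∧ ∃ ψ, IsSec F (halfPlane e s) ψ ∧ EqOn ψ φ (halfPlane e t)}
  have htS : t ∈ S := ⟨le_rfl, φ, h, fun _ _ => rfl⟩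
  obtain ⟨u₀, hu₀⟩ : (halfPlane e t).Nonempty := (isRegion_halfPlane he t).nonempty
  choose hSt χ hχ hχφ using fun s : S => s.2
  obtain ⟨ψ, hψ, hψχ⟩ := IsSec.glue (F := F) (ι := S) (U := fun s => halfPlane e s)
    (χ := fun s => χ s) (fun s => isOpen_halfPlane e s) hχ (fun s s' =>
      ((hχ s).mono inter_subset_left).eqOn hF ((hχ s').mono inter_subset_right)
        ((convex_halfPlane _ _).inter (convex_halfPlane _ _)).isPreconnected
        ⟨hmono (hSt s) hu₀, hmono (hSt s') hu₀⟩ ((hχφ s hu₀).trans (hχφ s' hu₀).symm))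
  have hbdd : BddBelow S := by
    by_contra hb
    refine hng ⟨ψ, hψ.mono fun u _ => ?_⟩
    obtain ⟨s, hs, hsu⟩ := not_bddBelow_iff.1 hb (starRingEnd ℂ e * u).re
    exact mem_iUnion.2 ⟨⟨s, hs⟩, hsu⟩
  set s := sInf S with hs
  have hst : s ≤ t := csInf_le hbdd htS
  have hψs : IsSec F (halfPlane e s) ψ := by
    refine hψ.mono fun u hu => ?_
    obtain ⟨s', hs', hlt⟩ := exists_lt_of_csInf_lt ⟨t, htS⟩ hu
    exact mem_iUnion.2 ⟨⟨s', hs'⟩, hlt⟩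
  have hψφ : EqOn ψ φ (halfPlane e t) := fun u hu =>
    (hψχ ⟨t, htS⟩ hu).trans (hχφ ⟨t, htS⟩ hu)
  -- the chart in which both half-planes become discs
  set w : ℂ := e * (s - 1 : ℝ) with hw
  have hew : (starRingEnd ℂ e * w).re = s - 1 := by
    rw [hw, conj_mul_mul he, Complex.ofReal_re]
  have hk1 : s = (starRingEnd ℂ e * w).re + 1 := by linarith
  have hk2 : t = (starRingEnd ℂ e * w).re + (t - s + 1) := by linarith
  have hk2' : 0 < t - s + 1 := by linarith
  have hG := hF.smul (invSub w)
  have hsinf : SingAt F (halfPlane e s) ψ OnePoint.infty := by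
    rw [← singAt_invSub_iff he one_pos hk1]
    refine SingAt.of_eqOn_inter hG ((singAt_invSub_iff he hk2' hk2).2 hinf)
      (h.comp_invSub he hk2' hk2) (hψs.comp_invSub he one_pos hk1) (convex_ball _ _)
      (convex_ball _ _) ?_ ?_
    · rintro v ⟨hv, -⟩
      refine (hψφ ((mem_halfPlane_inv_iff he hk2' hk2 ?_).2 hv)).symm
      rintro rfl
      exact (mem_ball.1 hv).ne (zero_mem_sphere_inv he hk2')
    · rw [inter_eq_left.2]
      · have := sphere_subset_closedBall (zero_mem_sphere_inv he hk2')
        rwa [← closure_ball _ (by positivity)] at this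
      · intro v hv
        have hv0 : v ≠ 0 := by
          rintro rfl
          exact (mem_ball.1 hv).ne (zero_mem_sphere_inv he hk2')
        exact (mem_halfPlane_inv_iff he one_pos hk1 hv0).1
          (hmono hst ((mem_halfPlane_inv_iff he hk2' hk2 hv0).2 hv))
  by_contra hcon
  push Not at hcon
  have hreg := fun q hq => hcon s ψ q hψs hsinf hq
  -- the section extends uniformly near infinity
  obtain ⟨ε, hε, hu⟩ := hU (invSub w) 0
  obtain ⟨δ, hδ, hsec⟩ := hu.exists_sections hG hε isOpen_ball (convex_ball _ _)
    (hψs.comp_invSub he one_pos hk1) (by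
      rw [frontier_ball _ (by positivity)]; exact zero_mem_sphere_inv he one_pos)
    ((singAt_invSub_iff he one_pos hk1).2 hsinf)
  have hwne : ∀ u ∈ halfPlane e s, u - w ≠ 0 := by
    intro u hu h0
    rw [sub_eq_zero.1 h0, halfPlane, mem_ofPred_eq] at hu
    linarith
  have hfar : ∀ u ∈ halfPlane e s, max (1 / δ) 2 < dist u w →
      ∃ χ, IsSec F (ball u 1) χ ∧ χ u = ψ u := by
    intro u hu hd
    have hne := hwne u hu
    have hd1 : 1 / δ < ‖u - w‖ := (le_max_left _ _).trans_lt (dist_eq_norm u w ▸ hd)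
    have hd2 : 2 < ‖u - w‖ := (le_max_right _ _).trans_lt (dist_eq_norm u w ▸ hd)
    have hu' : w + (u - w)⁻¹⁻¹ = u := by rw [inv_inv]; ring
    obtain ⟨χ, hχ, hχu⟩ := hsec (u - w)⁻¹
      ((mem_halfPlane_inv_iff he one_pos hk1 (inv_ne_zero hne)).1 (by rwa [hu'])) (by
        rw [dist_zero_right, norm_inv]
        rw [one_div_lt hδ (by linarith)] at hd1
        rwa [← one_div])
    have hball : ∀ v ∈ ball u 1, 1 < ‖v - w‖ ∧ ‖u - v‖ < 1 := by
      intro v hv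
      rw [mem_ball, dist_comm, dist_eq_norm] at hv
      have := norm_add_le (u - v) (v - w)
      rw [sub_add_sub_cancel] at this
      exact ⟨by linarith, hv⟩
    have hvne : ∀ v ∈ ball u 1, v - w ≠ 0 := fun v hv =>
      norm_pos_iff.1 (one_pos.trans (hball v hv).1)
    refine ⟨χ ∘ fun v => (v - w)⁻¹, ?_, ?_⟩
    · have h1 := hχ.smul (Ω' := ball u 1) (m := fun v => (v - w)⁻¹) (invSub w)⁻¹
        ((continuousOn_id.sub continuousOn_const).inv₀ hvne) (fun v hv => ?_) fun v hv => ?_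
      · simpa only [inv_smul_smul] using h1
      · obtain ⟨h2, h3⟩ := hball v hv
        have hvw := hvne v hv
        rw [mem_ball, dist_zero_right, dist_eq_norm, inv_sub_inv hvw hne, norm_div, norm_mul,
          norm_inv, div_lt_iff₀ (by positivity), show u - w - (v - w) = u - v by ring]
        have h4 : ‖u - w‖ ≠ 0 := norm_ne_zero_iff.2 hne
        field_simp
        linarith
      · rw [inv_smul_eq_iff, invSub_coe (sub_ne_zero.1 (hvne v hv))]
    · simp only [Function.comp, hχu, hu']
  -- and uniformly on bounded sets, as there are no singular points
  obtain ⟨ρ, hρ, hnear⟩ := hψs.exists_uniform_radius hF (convex_halfPlane _ _)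
    (isCompact_closedBall w (max (1 / δ) 2)) (by
      intro b _ hb
      have hb' : s ≤ (starRingEnd ℂ e * b).re := by
        have : IsClosed {u : ℂ | s ≤ (starRingEnd ℂ e * u).re} :=
          isClosed_le continuous_const (by fun_prop)
        have hsub : halfPlane e s ⊆ {u : ℂ | s ≤ (starRingEnd ℂ e * u).re} :=
          fun u (hu : s < (starRingEnd ℂ e * u).re) => mem_ofPred_eq ▸ hu.le
        exact closure_minimal hsub this hb
      rcases eq_or_lt_of_le hb' with h2 | h2
      · exact hreg b h2.symm
      · intro h3
        exact h3 (ψ b) (subset_closure (mem_image_of_mem _ h2)) (hψs.eq b h2))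
  set r := min ρ 1 with hr
  have hr0 : 0 < r := lt_min hρ one_pos
  obtain ⟨ψ', h1, h2⟩ := hψs.exists_iUnion_ball hF (convex_halfPlane _ _) (r := fun _ => r)
    (fun _ _ => hr0) (by
      intro y hy
      rcases le_or_gt (dist y w) (max (1 / δ) 2) with h3 | h3
      · obtain ⟨χ, h4, h5⟩ := hnear y ⟨hy, h3⟩
        exact ⟨χ, h4.mono (ball_subset_ball (min_le_left _ _)), h5⟩
      · obtain ⟨χ, h4, h5⟩ := hfar y hy h3
        exact ⟨χ, h4.mono (ball_subset_ball (min_le_right _ _)), h5⟩)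
  have hmem : s - r / 2 ∈ S := by
    refine ⟨by linarith, ψ', h1.mono fun u hu => ?_, fun u hu =>
      (h2 (hmono hst hu)).trans (hψφ hu)⟩
    have hu : s - r / 2 < (starRingEnd ℂ e * u).re := hu
    refine mem_iUnion.2 ⟨⟨u + e * (r / 2 : ℝ), add_mem_halfPlane he (by linarith)⟩, ?_⟩
    rw [mem_ball, dist_eq_norm, sub_add_cancel_left, norm_neg, norm_mul, he, one_mul,
      Complex.norm_real, Real.norm_of_nonneg (by positivity)]
    linarith
  have := csInf_le hbdd hmem
  linarith

/-! ### Continuation along half-planes with two singular points -/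

/-- The half-plane with `0` on its boundary, symmetric about the ray from `0` through `c`. -/
def halfPlaneAt (c : ℂ) : Set ℂ := {u | 0 < (u / c).re}

theorem isOpen_halfPlaneAt (c : ℂ) : IsOpen (halfPlaneAt c) :=
  isOpen_lt continuous_const (by fun_prop)

theorem halfPlaneAt_eq {c : ℂ} (hc : c ≠ 0) : halfPlaneAt c = halfPlane (c / ‖c‖) 0 := by
  ext u
  have hn := norm_pos_iff.2 hc
  have e : u / c = ((‖c‖⁻¹ : ℝ) : ℂ) * (starRingEnd ℂ (c / ‖c‖) * u) := by
    have h1 : starRingEnd ℂ c * c = ‖c‖ ^ 2 := by rw [mul_comm, Complex.mul_conj']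
    have h2 : (‖c‖ : ℂ) ≠ 0 := by exact_mod_cast hn.ne'
    rw [map_div₀, Complex.conj_ofReal, Complex.ofReal_inv]
    field_simp
    linear_combination -u * h1
  rw [halfPlaneAt, halfPlane, mem_ofPred_eq, mem_ofPred_eq, e, Complex.re_ofReal_mul]
  exact mul_pos_iff_of_pos_left (by positivity)

theorem convex_halfPlaneAt {c : ℂ} (hc : c ≠ 0) : Convex ℝ (halfPlaneAt c) := by
  rw [halfPlaneAt_eq hc]; exact convex_halfPlane _ _

theorem self_mem_halfPlaneAt {c : ℂ} (hc : c ≠ 0) : c ∈ halfPlaneAt c := by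
  simp [halfPlaneAt, hc]

theorem ne_zero_of_mem_halfPlaneAt {c u : ℂ} (h : u ∈ halfPlaneAt c) : u ≠ 0 := by
  rintro rfl; simp [halfPlaneAt] at h

theorem inv_mem_halfPlaneAt_iff {c v : ℂ} : v⁻¹ ∈ halfPlaneAt c ↔ v ∈ halfPlaneAt c⁻¹ := by
  rw [halfPlaneAt, halfPlaneAt, mem_ofPred_eq, mem_ofPred_eq, div_inv_eq_mul, ← inv_inv c,
    div_inv_eq_mul, ← mul_inv, inv_inv, Complex.inv_re]
  rcases eq_or_ne (v * c) 0 with h0 | h0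
  · simp [h0]
  · exact div_pos_iff_of_pos_right (Complex.normSq_pos.2 h0)

theorem mem_halfPlaneAt_of_dist_lt {c u : ℂ} (hc : c ≠ 0) (h : dist u c < ‖c‖) :
    u ∈ halfPlaneAt c := by
  have h1 : u / c = 1 + (u - c) / c := by field_simp; ring
  have h2 : ‖(u - c) / c‖ < 1 := by
    rw [norm_div, div_lt_one (norm_pos_iff.2 hc), ← dist_eq_norm]; exact h
  have h3 := Complex.abs_re_le_norm ((u - c) / c)
  have h4 := neg_abs_le ((u - c) / c).re
  rw [halfPlaneAt, mem_ofPred_eq, h1, Complex.add_re, Complex.one_re]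
  linarith

theorem zero_mem_closure_halfPlaneAt_inter {c u : ℂ} {r : ℝ} (hr : 0 < r)
    (hu : u ∈ halfPlaneAt c) {S : Set ℂ} (hS : ∀ t : ℝ, 0 < t → t * ‖u‖ < r → t * u ∈ S) :
    (0 : ℂ) ∈ closure (halfPlaneAt c ∩ S) := by
  have hc : Continuous fun t : ℝ => (t : ℂ) * u := by fun_prop
  have hlim : Tendsto (fun t : ℝ => (t : ℂ) * u) (𝓝[>] 0) (𝓝 0) := by
    have := hc.tendsto 0
    simp only [Complex.ofReal_zero, zero_mul] at this
    exact this.mono_left nhdsWithin_le_nhds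
  have hev : ∀ᶠ t : ℝ in 𝓝[>] 0, t * ‖u‖ < r := by
    have hc' : Continuous fun t : ℝ => t * ‖u‖ := by fun_prop
    have := hc'.tendsto 0
    rw [zero_mul] at this
    exact (this.mono_left nhdsWithin_le_nhds).eventually_lt_const hr
  refine mem_closure_of_tendsto hlim ?_
  filter_upwards [hev, self_mem_nhdsWithin] with t ht ht0
  refine ⟨?_, hS t ht0 ht⟩
  rw [halfPlaneAt, mem_ofPred_eq, mul_div_assoc, Complex.re_ofReal_mul]
  exact mul_pos ht0 hu

theorem zero_mem_frontier_halfPlaneAt {c : ℂ} (hc : c ≠ 0) :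
    (0 : ℂ) ∈ frontier (halfPlaneAt c) := by
  rw [(isOpen_halfPlaneAt c).frontier_eq]
  refine ⟨?_, fun h => ne_zero_of_mem_halfPlaneAt h rfl⟩
  have := zero_mem_closure_halfPlaneAt_inter one_pos (self_mem_halfPlaneAt hc) (S := univ)
    fun _ _ _ => mem_univ _
  rwa [inter_univ] at this

theorem IsSec.comp_inv {c : ℂ} {φ : ℂ → ℂ} (h : IsSec F (halfPlaneAt c) φ) :
    IsSec (fun z => invSub 0 • F z) (halfPlaneAt c⁻¹) (φ ∘ fun v => v⁻¹) := by
  refine h.smul _ (continuousOn_inv₀.mono fun v hv => ne_zero_of_mem_halfPlaneAt hv)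
    (fun v hv => inv_mem_halfPlaneAt_iff.2 hv) fun v hv => ?_
  have := invSub_inv (w := 0) (ne_zero_of_mem_halfPlaneAt hv)
  rwa [zero_add] at this

theorem singAt_inv_iff {c : ℂ} {φ : ℂ → ℂ} {b b' : OnePoint ℂ} (hb : invSub 0 • b = b') :
    SingAt (fun z => invSub 0 • F z) (halfPlaneAt c⁻¹) (φ ∘ fun v => v⁻¹) b' ↔
      SingAt F (halfPlaneAt c) φ b := by
  have him : (φ ∘ fun v => v⁻¹) '' halfPlaneAt c⁻¹ = φ '' halfPlaneAt c := by
    rw [image_comp]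
    congr 1
    ext u
    constructor
    · rintro ⟨v, hv, rfl⟩; exact inv_mem_halfPlaneAt_iff.2 hv
    · intro hu
      exact ⟨u⁻¹, by rw [← inv_mem_halfPlaneAt_iff, inv_inv]; exact hu, inv_inv u⟩
  unfold SingAt
  rw [him, ← hb]
  simp only [ne_eq, smul_left_cancel_iff]

/-- Transfer of the singular points `0` and `∞` between half-planes. -/
theorem SingAt.zero_of_halfPlaneAt (hF : LocUniv F) {c c' : ℂ} {φ ψ : ℂ → ℂ} (hc : c ≠ 0)
    (hc' : c' ∈ halfPlaneAt c) (h : IsSec F (halfPlaneAt c) φ) (h' : IsSec F (halfPlaneAt c') ψ)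
    (he : EqOn φ ψ (halfPlaneAt c ∩ halfPlaneAt c'))
    (hs : SingAt F (halfPlaneAt c) φ ((0 : ℂ) : OnePoint ℂ)) :
    SingAt F (halfPlaneAt c') ψ ((0 : ℂ) : OnePoint ℂ) := by
  have hc'0 := ne_zero_of_mem_halfPlaneAt hc'
  refine hs.of_eqOn_inter hF h h' (convex_halfPlaneAt hc) (convex_halfPlaneAt hc'0) he ?_
  refine zero_mem_closure_halfPlaneAt_inter one_pos hc' fun t ht _ => ?_
  rw [halfPlaneAt, mem_ofPred_eq, mul_div_assoc, div_self hc'0, Complex.re_ofReal_mul]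
  simpa using ht

theorem SingAt.infty_of_halfPlaneAt (hF : LocUniv F) {c c' : ℂ} {φ ψ : ℂ → ℂ} (hc : c ≠ 0)
    (hc' : c' ∈ halfPlaneAt c) (h : IsSec F (halfPlaneAt c) φ) (h' : IsSec F (halfPlaneAt c') ψ)
    (he : EqOn φ ψ (halfPlaneAt c ∩ halfPlaneAt c'))
    (hs : SingAt F (halfPlaneAt c) φ OnePoint.infty) :
    SingAt F (halfPlaneAt c') ψ OnePoint.infty := by
  rw [← singAt_inv_iff (invSub_infty 0)] at hs ⊢
  refine hs.zero_of_halfPlaneAt (hF.smul _) (inv_ne_zero hc)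
    (inv_mem_halfPlaneAt_iff.1 (by rwa [inv_inv])) h.comp_inv h'.comp_inv fun v hv => ?_
  exact he ⟨inv_mem_halfPlaneAt_iff.2 hv.1, inv_mem_halfPlaneAt_iff.2 hv.2⟩

/-- The half-plane about `F x` carries a section through `x` for which `0` and `∞` are singular. -/
def IsLogPoint (F : ℂ → OnePoint ℂ) (x : ℂ) : Prop :=
  ∃ (c : ℂ) (φ : ℂ → ℂ), F x = c ∧ c ≠ 0 ∧ IsSec F (halfPlaneAt c) φ ∧ φ c = x ∧
    SingAt F (halfPlaneAt c) φ ((0 : ℂ) : OnePoint ℂ) ∧ SingAt F (halfPlaneAt c) φ OnePoint.infty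

theorem IsLogPoint.inv {x : ℂ} (h : IsLogPoint F x) : IsLogPoint (fun z => invSub 0 • F z) x := by
  obtain ⟨c, φ, h1, h2, h3, h4, h5, h6⟩ := h
  refine ⟨c⁻¹, φ ∘ fun v => v⁻¹, ?_, inv_ne_zero h2, h3.comp_inv, by simpa using h4,
    (singAt_inv_iff (invSub_infty 0)).2 h6, (singAt_inv_iff (invSub_self 0)).2 h5⟩
  simp only [h1]
  rw [invSub_coe h2, sub_zero]

/-- The value `0` is not attained in the limit, because the local section at such a point would
agree with a section for which `0` is singular. -/
theorem IsLogPoint.ne_zero_of_mem_closure (hF : LocUniv F) {x : ℂ}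
    (hx : x ∈ closure {x | IsLogPoint F x}) : F x ≠ ((0 : ℂ) : OnePoint ℂ) := by
  intro h0
  obtain ⟨r, hr, χ, h1, h2, h3⟩ := hF.exists_local_section h0
  obtain ⟨_, ⟨c, hc, rfl⟩, hL⟩ := mem_closure_iff_nhds.1 hx _ (h3 r hr le_rfl)
  obtain ⟨c', φ, k1, k2, k3, k4, k5, -⟩ := hL
  obtain rfl : c' = c := OnePoint.coe_eq_coe.1 (k1.symm.trans (h1.eq _ hc))
  have hm := self_mem_halfPlaneAt k2
  have hs := k5.of_eqOn_inter hF k3 h1 (convex_halfPlaneAt k2) (convex_ball _ _)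
    ((k3.mono inter_subset_left).eqOn hF (h1.mono inter_subset_right)
      ((convex_halfPlaneAt k2).inter (convex_ball _ _)).isPreconnected ⟨hm, hc⟩ k4)
    (zero_mem_closure_halfPlaneAt_inter hr hm fun t ht htr => by
      rw [mem_ball, dist_zero_right, norm_mul, Complex.norm_real, Real.norm_of_nonneg ht.le]
      exact htr)
  exact hs (χ 0) (subset_closure ⟨0, mem_ball_self hr, rfl⟩) (h1.eq 0 (mem_ball_self hr))

/-- The set of these points is closed: the sections at nearby points of the set cover the half-plane
at a limit point and agree where they overlap. -/
theorem isClosed_isLogPoint (hF : LocUniv F) : IsClosed {x | IsLogPoint F x} := by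
  refine isClosed_of_closure_subset fun x hx => ?_
  have hinf : F x ≠ OnePoint.infty := by
    intro h0
    refine IsLogPoint.ne_zero_of_mem_closure (hF.smul (invSub 0)) (x := x)
      (closure_mono (fun y hy => IsLogPoint.inv hy) hx) ?_
    rw [h0, invSub_infty]
  obtain ⟨c, hc⟩ : ∃ c : ℂ, F x = c := ⟨finPart (F x), (coe_finPart hinf).symm⟩
  have hc0 : c ≠ 0 := by
    rintro rfl; exact IsLogPoint.ne_zero_of_mem_closure hF hx hc
  obtain ⟨r, hr, χ, h1, h2, h3⟩ := hF.exists_local_section hc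
  have hr' : 0 < min r (‖c‖ / 2) := lt_min hr (half_pos (norm_pos_iff.2 hc0))
  set r' := min r (‖c‖ / 2) with hr'def
  have hr'r : r' ≤ r := min_le_left _ _
  let I := {y : ℂ | y ∈ ball c r' ∧ IsLogPoint F (χ y)}
  have hIc : c ∈ closure I := by
    rw [Metric.mem_closure_iff]
    intro s hs
    have hs' : 0 < min s r' := lt_min hs hr'
    obtain ⟨_, ⟨y, hy, rfl⟩, hL⟩ := mem_closure_iff_nhds.1 hx _
      (h3 _ hs' ((min_le_right _ _).trans hr'r))
    refine ⟨y, ⟨ball_subset_ball (min_le_right _ _) hy, hL⟩, ?_⟩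
    rw [dist_comm]
    exact ball_subset_ball (min_le_left _ _) hy
  have hdata : ∀ y : I, ∃ φ, IsSec F (halfPlaneAt y) φ ∧ φ y = χ y ∧ (y : ℂ) ≠ 0 ∧
      c ∈ halfPlaneAt y ∧ SingAt F (halfPlaneAt y) φ ((0 : ℂ) : OnePoint ℂ) ∧
      SingAt F (halfPlaneAt y) φ OnePoint.infty := by
    rintro ⟨y, hy, y', φ, k1, k2, k3, k4, k5, k6⟩
    obtain rfl : y' = y :=
      OnePoint.coe_eq_coe.1 (k1.symm.trans (h1.eq _ (ball_subset_ball hr'r hy)))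
    refine ⟨φ, k3, k4, k2, mem_halfPlaneAt_of_dist_lt k2 ?_, k5, k6⟩
    have h4 : dist y' c < ‖c‖ / 2 := (mem_ball.1 hy).trans_le (min_le_right _ _)
    have h5 := norm_sub_norm_le c y'
    rw [← dist_eq_norm, dist_comm] at h5
    rw [dist_comm]
    linarith
  choose φ k1 k2 k3 k4 k5 k6 using hdata
  have hφc : ∀ y : I, φ y c = x := by
    intro y
    rw [← h2]
    exact ((k1 y).mono inter_subset_left).eqOn hF (h1.mono inter_subset_right)
      ((convex_halfPlaneAt (k3 y)).inter (convex_ball _ _)).isPreconnected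
      ⟨self_mem_halfPlaneAt (k3 y), ball_subset_ball hr'r y.2.1⟩ (k2 y) ⟨k4 y, mem_ball_self hr⟩
  obtain ⟨ψ, hψ, hψφ⟩ := IsSec.glue (F := F) (ι := I) (U := fun y => halfPlaneAt y) (χ := φ)
    (fun y => isOpen_halfPlaneAt y) k1 fun y y' =>
      ((k1 y).mono inter_subset_left).eqOn hF ((k1 y').mono inter_subset_right)
        ((convex_halfPlaneAt (k3 y)).inter (convex_halfPlaneAt (k3 y'))).isPreconnected
        ⟨k4 y, k4 y'⟩ ((hφc y).trans (hφc y').symm)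
  have hψ' : IsSec F (halfPlaneAt c) ψ := by
    refine hψ.mono fun u hu => ?_
    have hcont : ContinuousAt (fun y : ℂ => (u / y).re) c :=
      Complex.continuous_re.continuousAt.comp (continuousAt_const.div continuousAt_id hc0)
    obtain ⟨y, hy, hyI⟩ := mem_closure_iff_nhds.1 hIc _ (hcont.eventually_const_lt hu)
    exact mem_iUnion.2 ⟨⟨y, hyI⟩, hy⟩
  obtain ⟨y₀, hy₀⟩ : I.Nonempty := closure_nonempty_iff.1 ⟨c, hIc⟩
  have he : EqOn (φ ⟨y₀, hy₀⟩) ψ (halfPlaneAt y₀ ∩ halfPlaneAt c) :=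
    fun u hu => (hψφ ⟨y₀, hy₀⟩ hu.1).symm
  exact ⟨c, ψ, hc, hc0, hψ', (hψφ ⟨y₀, hy₀⟩ (k4 _)).trans (hφc _),
    (k5 ⟨y₀, hy₀⟩).zero_of_halfPlaneAt hF (k3 _) (k4 _) (k1 _) hψ' he,
    (k6 ⟨y₀, hy₀⟩).infty_of_halfPlaneAt hF (k3 _) (k4 _) (k1 _) hψ' he⟩

/-- If `0` and `∞` are the only singular boundary points, a section over a half-plane extends to
discs about its points of radius proportional to the distance to `0`. -/
theorem IsSec.exists_uniform_ratio (hF : LocUniv F)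
    (hU : ∀ (A : GL (Fin 2) ℂ) (a : ℂ), ∃ ε > 0, SingUnique (fun z => A • F z) a ε) {c : ℂ}
    (hc : c ≠ 0) {φ : ℂ → ℂ} (h : IsSec F (halfPlaneAt c) φ)
    (h0 : SingAt F (halfPlaneAt c) φ ((0 : ℂ) : OnePoint ℂ))
    (hinf : SingAt F (halfPlaneAt c) φ OnePoint.infty)
    (hreg : ∀ b ∈ closure (halfPlaneAt c), b ≠ 0 → ¬ SingAt F (halfPlaneAt c) φ b) :
    ∃ k > 0, ∀ y ∈ halfPlaneAt c, ∃ χ, IsSec F (ball y (k * ‖y‖)) χ ∧ χ y = φ y := by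
  have hH := convex_halfPlaneAt hc
  obtain ⟨ε, hε, hu⟩ := hU 1 0
  simp only [one_smul] at hu
  obtain ⟨δ, hδ, hnear⟩ := hu.exists_sections hF hε (isOpen_halfPlaneAt c) hH h
    (zero_mem_frontier_halfPlaneAt hc) h0
  obtain ⟨ε', hε', hu'⟩ := hU (invSub 0) 0
  obtain ⟨δ', hδ', hfar⟩ := hu'.exists_sections (hF.smul _) hε' (isOpen_halfPlaneAt c⁻¹)
    (convex_halfPlaneAt (inv_ne_zero hc)) h.comp_inv (zero_mem_frontier_halfPlaneAt (inv_ne_zero hc))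
    ((singAt_inv_iff (invSub_infty 0)).2 hinf)
  have hfar' : ∀ y ∈ halfPlaneAt c, 1 / δ' < ‖y‖ →
      ∃ χ, IsSec F (ball y (1 / 2 * ‖y‖)) χ ∧ χ y = φ y := by
    intro y hy hyδ
    have hy0 := ne_zero_of_mem_halfPlaneAt hy
    have hyn := norm_pos_iff.2 hy0
    obtain ⟨χ, hχ, hχy⟩ := hfar y⁻¹ (inv_mem_halfPlaneAt_iff.1 (by rwa [inv_inv])) (by
      rw [dist_zero_right, norm_inv, ← one_div, one_div_lt hyn hδ']; exact hyδ)
    have hv : ∀ v ∈ ball y (1 / 2 * ‖y‖), v ≠ 0 ∧ dist v⁻¹ y⁻¹ < dist y⁻¹ 0 := by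
      intro v hv
      rw [mem_ball, dist_eq_norm] at hv
      have h1 := norm_sub_norm_le y v
      rw [norm_sub_rev] at h1
      have h2 : v ≠ 0 := norm_pos_iff.1 (by linarith)
      refine ⟨h2, ?_⟩
      rw [dist_zero_right, dist_eq_norm, inv_sub_inv h2 hy0, norm_div, norm_mul, norm_inv,
        div_lt_iff₀ (by positivity), norm_sub_rev]
      field_simp
      linarith
    refine ⟨χ ∘ fun v => v⁻¹, ?_, by simp [hχy]⟩
    have h1 := hχ.smul (Ω' := ball y (1 / 2 * ‖y‖)) (m := fun v => v⁻¹) (invSub 0)⁻¹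
      (continuousOn_inv₀.mono fun v hv' => (hv v hv').1) (fun v hv' => (hv v hv').2)
      fun v hv' => by rw [inv_smul_eq_iff, invSub_coe (hv v hv').1, sub_zero]
    simpa only [inv_smul_smul] using h1
  have hK : IsCompact (closedBall (0 : ℂ) (1 / δ') ∩ {y | δ ≤ ‖y‖}) :=
    (isCompact_closedBall _ _).inter_right (isClosed_le continuous_const continuous_norm)
  obtain ⟨ρ, hρ, hmid⟩ := h.exists_uniform_radius hF hH hK fun b hb hb' => hreg b hb' (by
    rintro rfl
    have := hb.2
    rw [mem_ofPred_eq, norm_zero] at this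
    linarith)
  refine ⟨min (1 / 2) (ρ * δ'), by positivity, fun y hy => ?_⟩
  have hyn := norm_pos_iff.2 (ne_zero_of_mem_halfPlaneAt hy)
  have hk1 : min (1 / 2) (ρ * δ') * ‖y‖ ≤ 1 / 2 * ‖y‖ := by gcongr; exact min_le_left _ _
  have hk2 : min (1 / 2) (ρ * δ') * ‖y‖ ≤ ρ * δ' * ‖y‖ := by gcongr; exact min_le_right _ _
  rcases lt_or_ge (1 / δ') ‖y‖ with h1 | h1
  · obtain ⟨χ, h2, h3⟩ := hfar' y hy h1
    exact ⟨χ, h2.mono (ball_subset_ball hk1), h3⟩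
  · rcases lt_or_ge ‖y‖ δ with h2 | h2
    · obtain ⟨χ, h3, h4⟩ := hnear y hy (by rwa [dist_zero_right])
      refine ⟨χ, h3.mono (ball_subset_ball ?_), h4⟩
      rw [dist_zero_right]
      linarith
    · obtain ⟨χ, h3, h4⟩ := hmid y ⟨hy, by rwa [mem_closedBall, dist_zero_right], h2⟩
      refine ⟨χ, h3.mono (ball_subset_ball (hk2.trans ?_)), h4⟩
      rw [le_div_iff₀ hδ'] at h1
      nlinarith

/-- The set of these points is open: the section over a half-plane extends about each of its points
to a disc of radius proportional to the modulus. A point of a slightly rotated half-plane lies in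
the disc about the corresponding point of the original one, which gives the new section. -/
theorem isOpen_isLogPoint (hF : LocUniv F)
    (hU : ∀ (A : GL (Fin 2) ℂ) (a : ℂ), ∃ ε > 0, SingUnique (fun z => A • F z) a ε)
    (hreg : ∀ (c : ℂ) (φ : ℂ → ℂ), c ≠ 0 → IsSec F (halfPlaneAt c) φ →
      SingAt F (halfPlaneAt c) φ ((0 : ℂ) : OnePoint ℂ) →
      SingAt F (halfPlaneAt c) φ OnePoint.infty →
      ∀ b ∈ closure (halfPlaneAt c), b ≠ 0 → ¬ SingAt F (halfPlaneAt c) φ b) :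
    IsOpen {x | IsLogPoint F x} := by
  rw [isOpen_iff_mem_nhds]
  rintro _ ⟨c, φ, -, hc, h3, rfl, h5, h6⟩
  obtain ⟨k, hk, hsec⟩ := h3.exists_uniform_ratio hF hU hc h5 h6 (hreg c φ hc h3 h5 h6)
  obtain ⟨ψ, hψ, hψφ⟩ := h3.exists_iUnion_ball hF (convex_halfPlaneAt hc)
    (r := fun y => k * ‖y‖)
    (fun y hy => mul_pos hk (norm_pos_iff.2 (ne_zero_of_mem_halfPlaneAt hy))) hsec
  have hkc : 0 < k * ‖c‖ := mul_pos hk (norm_pos_iff.2 hc)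
  have hopen := (h3.mono inter_subset_left).isOpen_image hF
    ((isOpen_halfPlaneAt c).inter (isOpen_ball (x := c) (ε := k * ‖c‖)))
  filter_upwards [hopen.mem_nhds ⟨c, ⟨self_mem_halfPlaneAt hc, mem_ball_self hkc⟩, rfl⟩]
  rintro _ ⟨c', ⟨hc', hcc'⟩, rfl⟩
  have hc'0 := ne_zero_of_mem_halfPlaneAt hc'
  have hψ' : IsSec F (halfPlaneAt c') ψ := by
    refine hψ.mono fun u hu => ?_
    -- the rotation and dilation which maps `c'` to `c`
    have hy : u * (c / c') ∈ halfPlaneAt c := by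
      have : u * (c / c') / c = u / c' := by field_simp
      rw [halfPlaneAt, mem_ofPred_eq, this]; exact hu
    refine mem_iUnion.2 ⟨⟨_, hy⟩, ?_⟩
    have hu0 := norm_pos_iff.2 (ne_zero_of_mem_halfPlaneAt hu)
    have hc'n := norm_pos_iff.2 hc'0
    have e : u - u * (c / c') = u / c' * (c' - c) := by field_simp
    rw [mem_ball, dist_eq_norm] at hcc' ⊢
    rw [e, norm_mul, norm_mul, norm_div, norm_div]
    calc ‖u‖ / ‖c'‖ * ‖c' - c‖ < ‖u‖ / ‖c'‖ * (k * ‖c‖) := by gcongr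
      _ = k * (‖u‖ * (‖c‖ / ‖c'‖)) := by ring
  have he : EqOn φ ψ (halfPlaneAt c ∩ halfPlaneAt c') := fun u hu => (hψφ hu.1).symm
  exact ⟨c', ψ, h3.eq _ hc', hc'0, hψ', hψφ hc', h5.zero_of_halfPlaneAt hF hc hc' h3 hψ' he,
    h6.infty_of_halfPlaneAt hF hc hc' h3 hψ' he⟩

/-! ### Linear-fractional and exponential maps -/

theorem differentiable_of_exp_eq {c g : ℂ → ℂ} (hc : Differentiable ℂ c) (hg : Continuous g)
    (h : ∀ z, Complex.exp (g z) = c z) : Differentiable ℂ g := by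
  intro z₀
  have hc0 : ∀ z, c z ≠ 0 := fun z => h z ▸ Complex.exp_ne_zero _
  have him : ∀ᶠ z in 𝓝 z₀, |(g z - g z₀).im| < Real.pi := by
    have hcont : Continuous fun z => |(g z - g z₀).im| := by fun_prop
    refine hcont.continuousAt.eventually_lt_const ?_
    simpa using Real.pi_pos
  have e : g =ᶠ[𝓝 z₀] fun z => g z₀ + Complex.log (c z / c z₀) := by
    filter_upwards [him] with z hz
    rw [abs_lt] at hz
    rw [← h z, ← h z₀, ← Complex.exp_sub, Complex.log_exp hz.1 hz.2.le]
    ring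
  refine DifferentiableAt.congr_of_eventuallyEq ?_ e
  refine (differentiableAt_const _).add (DifferentiableAt.clog ((hc z₀).div_const _) ?_)
  simp [div_self (hc0 z₀)]

/-- A map all of whose points lie on sections over half-planes with the singular points `0` and `∞`
is the exponential of an affine map: a logarithm of it has sections over discs of radius one about
all its values, hence a section over the whole plane. -/
theorem LocUniv.exists_eq_exp (hF : LocUniv F) (h : ∀ x, IsLogPoint F x) :
    ∃ α β : ℂ, α ≠ 0 ∧ ∀ z, F z = ((Complex.exp (α * z + β) : ℂ) : OnePoint ℂ) := by
  choose c φ h1 h2 h3 h4 _ _ using h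
  have hne : ∀ z, F z ≠ OnePoint.infty := fun z => by rw [h1 z]; exact OnePoint.coe_ne_infty _
  have hcfin : (fun w => finPart (F w)) = c := by
    funext z; rw [h1 z, finPart_coe]
  have hd : Differentiable ℂ c := fun z => by
    have := (hF.differentiableAt_finPart (hne z)).1; rwa [hcfin] at this
  have hd' : ∀ z, deriv c z ≠ 0 := fun z => by
    have := (hF.differentiableAt_finPart (hne z)).2; rwa [hcfin] at this
  obtain ⟨g, hg, hexp⟩ := Complex.exists_continuousOn_eqOn_exp_comp isSimplyConnected_univ_complex
    isOpen_univ (g := c) hd.continuous.continuousOn (by rintro ⟨z, -, hz⟩; exact h2 z hz)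
  have hg : Continuous g := continuousOn_univ.1 hg
  have hexp : ∀ z, Complex.exp (g z) = c z := fun z => hexp (mem_univ z)
  have hgd := differentiable_of_exp_eq hd hg hexp
  have hG : LocUniv fun z => (g z : OnePoint ℂ) := by
    refine LocUniv.of_differentiable hgd fun z hz => hd' z ?_
    have h5 : c = fun z => Complex.exp (g z) := funext fun z => (hexp z).symm
    rw [h5, ((hgd z).hasDerivAt.cexp).deriv, hz, mul_zero]
  -- sections of the logarithm over discs of radius one
  have hsec : ∀ x, ∃ χ, IsSec (fun z => (g z : OnePoint ℂ)) (ball (g x) 1) χ ∧ χ (g x) = x := by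
    intro x
    have hmaps : ∀ ζ ∈ ball (g x) 1, Complex.exp ζ ∈ halfPlaneAt (c x) := by
      intro ζ hζ
      rw [mem_ball, dist_eq_norm] at hζ
      have h5 := (Complex.abs_im_le_norm (ζ - g x)).trans_lt hζ
      rw [abs_lt] at h5
      have hpi := Real.pi_gt_three
      rw [halfPlaneAt, mem_ofPred_eq, ← hexp x, ← Complex.exp_sub, Complex.exp_re]
      exact mul_pos (Real.exp_pos _) (Real.cos_pos_of_mem_Ioo ⟨by linarith, by linarith⟩)
    have hcont : ContinuousOn (fun ζ => φ x (Complex.exp ζ)) (ball (g x) 1) :=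
      (h3 x).cont.comp Complex.continuous_exp.continuousOn hmaps
    have hx : φ x (Complex.exp (g x)) = x := by rw [hexp, h4]
    refine ⟨fun ζ => φ x (Complex.exp ζ), ⟨hcont, ?_⟩, hx⟩
    have hE : LocUniv fun z => (Complex.exp z : OnePoint ℂ) :=
      LocUniv.of_differentiable Complex.differentiable_exp fun z => by
        rw [Complex.deriv_exp]; exact Complex.exp_ne_zero z
    have key : EqOn (fun ζ => g (φ x (Complex.exp ζ))) (fun ζ => ζ) (ball (g x) 1) := by
      refine (T2Space.isSeparatedMap _).eqOn_of_comp_eqOn hE.isLocallyInjective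
        (convex_ball _ _).isPreconnected (hg.comp_continuousOn hcont) continuousOn_id
        (fun ζ hζ => ?_) (mem_ball_self one_pos) (by simp only [hx])
      have h5 := (h3 x).eq _ (hmaps ζ hζ)
      rw [h1, OnePoint.coe_eq_coe] at h5
      simp only [Function.comp, hexp, h5]
    intro ζ hζ
    exact congrArg _ (key hζ)
  obtain ⟨ψ, hψ⟩ : ∃ ψ, IsSec (fun z => (g z : OnePoint ℂ)) univ ψ := by
    by_contra hng
    obtain ⟨r, hr, ψ, k1, -, b, hb, hs⟩ := hG.exists_maximal_disc (x := 0) rfl hng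
    have hbcl : b ∈ closure (ball (g 0) r) := by
      rw [closure_ball _ hr.ne']; exact sphere_subset_closedBall hb
    obtain ⟨y, hyb, hy⟩ := mem_closure_iff_nhds.1 hbcl _ (ball_mem_nhds b one_pos)
    have hgy : g (ψ y) = y := OnePoint.coe_eq_coe.1 (k1.eq y hy)
    obtain ⟨χ, k2, k3⟩ := hsec (ψ y)
    rw [hgy] at k2 k3
    have hby : b ∈ ball y 1 := by rw [mem_ball, dist_comm]; exact hyb
    have hs' := hs.of_eqOn_inter hG k1 k2 (convex_ball _ _) (convex_ball _ _)
      ((k1.mono inter_subset_left).eqOn hG (k2.mono inter_subset_right)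
        ((convex_ball _ _).inter (convex_ball _ _)).isPreconnected
        ⟨hy, mem_ball_self one_pos⟩ k3.symm) (by
      rw [mem_closure_iff_nhds]
      intro N hN
      obtain ⟨u, ⟨hu1, hu2⟩, hu3⟩ :=
        mem_closure_iff_nhds.1 hbcl _ (inter_mem hN (isOpen_ball.mem_nhds hby))
      exact ⟨u, hu1, hu3, hu2⟩)
    exact hs' (χ b) (subset_closure ⟨b, hby, rfl⟩) (k2.eq b hby)
  obtain ⟨α, β, hα, haff⟩ := hG.affine_of_section_univ hψ
  exact ⟨α, β, hα, fun z => by rw [h1, ← hexp, OnePoint.coe_eq_coe.1 (haff z)]⟩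

/-- The translation `w ↦ w - q`. -/
noncomputable def translate (q : ℂ) : GL (Fin 2) ℂ :=
  Matrix.GeneralLinearGroup.mkOfDetNeZero !![1, -q; 0, 1] (by rw [Matrix.det_fin_two_of]; simp)

theorem translate_coe (q w : ℂ) : translate q • (w : OnePoint ℂ) = ((w - q : ℂ) : OnePoint ℂ) := by
  rw [smul_coe]
  simp [translate, Matrix.GeneralLinearGroup.mkOfDetNeZero, ratio, ← sub_eq_add_neg]

theorem translate_infty (q : ℂ) :
    translate q • (OnePoint.infty : OnePoint ℂ) = OnePoint.infty := by
  rw [smul_infty]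
  simp [translate, Matrix.GeneralLinearGroup.mkOfDetNeZero, ratio]

theorem add_mem_halfPlane_iff {e u q : ℂ} {s : ℝ} :
    u + q ∈ halfPlane e ((starRingEnd ℂ e * q).re + s) ↔ u ∈ halfPlane e s := by
  rw [halfPlane, halfPlane, mem_ofPred_eq, mem_ofPred_eq, mul_add, Complex.add_re, add_comm,
    add_lt_add_iff_right]

/-- In the isometric chart sending a singular boundary point of a disc to infinity, the disc becomes
a half-plane. -/
theorem IsSec.exists_halfPlane {c p : ℂ} {r : ℝ} (hr : 0 < r) {φ : ℂ → ℂ}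
    (h : IsSec F (ball c r) φ) (hp : p ∈ sphere c r) (hs : SingAt F (ball c r) φ p) :
    ∃ (e : ℂ) (t : ℝ) (ψ : ℂ → ℂ), ‖e‖ = 1 ∧ IsSec (fun z => toInfty p • F z) (halfPlane e t) ψ ∧
      SingAt (fun z => toInfty p • F z) (halfPlane e t) ψ OnePoint.infty := by
  have hcp : ‖c - p‖ = r := by rw [← dist_eq_norm, dist_comm]; exact hp
  set K : ℝ := 1 + ‖p‖ ^ 2 with hK
  have hK0 : 0 < K := one_add_sq_pos p
  have hKc : (K : ℂ) = 1 + starRingEnd ℂ p * p := by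
    rw [hK, mul_comm, Complex.mul_conj']; push_cast; ring
  have hKc0 : (K : ℂ) ≠ 0 := by exact_mod_cast hK0.ne'
  have hrc0 : (r : ℂ) ≠ 0 := by exact_mod_cast hr.ne'
  set e : ℂ := starRingEnd ℂ ((c - p) / r) with he
  have he1 : ‖e‖ = 1 := by
    rw [he, RCLike.norm_conj, norm_div, hcp, Complex.norm_real, Real.norm_of_nonneg hr.le,
      div_self hr.ne']
  set k : ℝ := K / (2 * r) with hk
  have hk0 : 0 < k := by positivity
  set t : ℝ := (starRingEnd ℂ e * starRingEnd ℂ p).re + k with ht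
  have hcenter : starRingEnd ℂ e / (2 * k : ℝ) = (c - p) / K := by
    rw [he, Complex.conj_conj, hk]; push_cast; field_simp
  have hradius : 1 / (2 * k) = r / K := by rw [hk]; field_simp
  have hne : ∀ u ∈ halfPlane e t, u - starRingEnd ℂ p ≠ 0 := by
    intro u hu h0
    rw [sub_eq_zero.1 h0, halfPlane, mem_ofPred_eq] at hu
    linarith
  have hmaps : MapsTo (fun u => p + K * (u - starRingEnd ℂ p)⁻¹) (halfPlane e t) (ball c r) := by
    intro u hu
    have hu' : starRingEnd ℂ p + (u - starRingEnd ℂ p)⁻¹⁻¹ = u := by rw [inv_inv]; ring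
    have h1 := (mem_halfPlane_inv_iff he1 hk0 ht (inv_ne_zero (hne u hu))).1 (by rwa [hu'])
    rw [hcenter, hradius, mem_ball, dist_eq_norm, lt_div_iff₀ hK0] at h1
    rw [mem_ball, dist_eq_norm]
    have e1 : p + K * (u - starRingEnd ℂ p)⁻¹ - c =
        ((u - starRingEnd ℂ p)⁻¹ - (c - p) / K) * K := by field_simp; ring
    rwa [e1, norm_mul, Complex.norm_real, Real.norm_of_nonneg hK0.le]
  refine ⟨e, t, _, he1, h.smul (toInfty p) ?_ hmaps ?_, ?_⟩
  · exact continuousOn_const.add (continuousOn_const.mul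
      ((continuousOn_id.sub continuousOn_const).inv₀ hne))
  · intro u hu
    have h1 := hne u hu
    have h2 : p + K * (u - starRingEnd ℂ p)⁻¹ ≠ p := by
      rw [ne_eq, add_eq_left]; exact mul_ne_zero hKc0 (inv_ne_zero h1)
    rw [toInfty_coe h2, OnePoint.coe_eq_coe]
    rw [add_sub_cancel_left]
    field_simp
    rw [hKc]
    ring
  · have := hs.smul (toInfty p) hmaps
    rwa [toInfty_self] at this

/-- If the diameter is less than `4 π / 3`, the map is linear-fractional or a linear-fractional
transformation of an exponential: if there is no section over the whole plane, there is one over a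
half-plane with the singular boundary points `∞` and some finite `q`, and it can be continued over
all half-planes with these boundary points, since there is never a third singular point. -/
theorem Linked.exists_eq (hF : LocUniv F) {d : ℝ} (hL : Linked F d) (hd : d < 4 * Real.pi / 3) :
    (∃ (A : GL (Fin 2) ℂ) (α β : ℂ), α ≠ 0 ∧
      ∀ z, F z = A • ((α * z + β : ℂ) : OnePoint ℂ)) ∨
    ∃ (A : GL (Fin 2) ℂ) (α β : ℂ), α ≠ 0 ∧
      ∀ z, F z = A • ((Complex.exp (α * z + β) : ℂ) : OnePoint ℂ) := by
  by_cases hng : ∃ φ, IsSec F univ φ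
  · obtain ⟨φ, hφ⟩ := hng
    obtain ⟨α, β, hα, h⟩ := hF.affine_of_section_univ hφ
    exact Or.inl ⟨1, α, β, hα, fun z => by rw [h, one_smul]⟩
  obtain ⟨_, ⟨c, -, rfl⟩, ⟨x, hx⟩⟩ := hF.dense_range.inter_open_nonempty ((↑) '' (univ : Set ℂ))
    (OnePoint.isOpen_image_coe.2 isOpen_univ) ⟨_, mem_image_of_mem _ (mem_univ 0)⟩
  obtain ⟨r, hr, φ, h1, -, p, hp, hs⟩ := hF.exists_maximal_disc hx hng
  obtain ⟨e, t, ψ, he, h2, h3⟩ := h1.exists_halfPlane hr hp hs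
  set F₁ : ℂ → OnePoint ℂ := fun z => toInfty p • F z with hF₁def
  have hF₁ : LocUniv F₁ := hF.smul _
  have hL₁ : Linked F₁ d := hL.smul_toInfty p
  have hU := hL₁.exists_singUnique_smul hF₁ (by linarith [Real.pi_pos])
  by_cases hng₁ : ∃ φ, IsSec F₁ univ φ
  · obtain ⟨φ, hφ⟩ := hng₁
    obtain ⟨α, β, hα, h⟩ := hF₁.affine_of_section_univ hφ
    exact Or.inl ⟨(toInfty p)⁻¹, α, β, hα, fun z => by rw [← h, hF₁def, inv_smul_smul]⟩
  right
  obtain ⟨s, χ, q, k1, k2, k3, k4⟩ := h2.exists_extremal_halfPlane hF₁ hU hng₁ he h3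
  set G : ℂ → OnePoint ℂ := fun z => translate q • F₁ z with hGdef
  have hG : LocUniv G := hF₁.smul _
  have hUG : ∀ (A : GL (Fin 2) ℂ) (a : ℂ), ∃ ε > 0, SingUnique (fun z => A • G z) a ε := by
    intro A a
    have := hU (A * translate q) a
    simpa only [mul_smul] using this
  have hnormalize : ∀ e : ℂ, ‖e‖ = 1 → halfPlaneAt e = halfPlane e 0 := by
    intro e he
    rw [halfPlaneAt_eq (norm_pos_iff.1 (by rw [he]; exact one_pos)), he]; simp
  have hreg : ∀ (c : ℂ) (φ : ℂ → ℂ), c ≠ 0 → IsSec G (halfPlaneAt c) φ →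
      SingAt G (halfPlaneAt c) φ ((0 : ℂ) : OnePoint ℂ) →
      SingAt G (halfPlaneAt c) φ OnePoint.infty →
      ∀ b ∈ closure (halfPlaneAt c), b ≠ 0 → ¬ SingAt G (halfPlaneAt c) φ b := by
    intro c φ hc hφ hs0 hsinf b hb hb0 hsb
    set e' : ℂ := c / ‖c‖ with he'
    have he'1 : ‖e'‖ = 1 := by
      rw [he', norm_div, Complex.norm_real, norm_norm, div_self (norm_ne_zero_iff.2 hc)]
    rw [halfPlaneAt_eq hc, ← he'] at hφ hs0 hsinf hsb hb
    have hb' : (starRingEnd ℂ e' * b).re = 0 := by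
      have hcl : IsClosed {u : ℂ | 0 ≤ (starRingEnd ℂ e' * u).re} :=
        isClosed_le continuous_const (by fun_prop)
      have hsub : halfPlane e' 0 ⊆ {u : ℂ | 0 ≤ (starRingEnd ℂ e' * u).re} :=
        fun u (hu : 0 < (starRingEnd ℂ e' * u).re) => mem_ofPred_eq ▸ hu.le
      have h5 : 0 ≤ (starRingEnd ℂ e' * b).re := closure_minimal hsub hcl hb
      rcases eq_or_lt_of_le h5 with h6 | h6
      · exact h6.symm
      · exact absurd (hφ.eq b h6) (hsb (φ b) (subset_closure ⟨b, h6, rfl⟩))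
    have hmaps : MapsTo (fun u => u - q) (halfPlane e' ((starRingEnd ℂ e' * q).re + 0))
        (halfPlane e' 0) := by
      intro u hu
      rw [← sub_add_cancel u q, add_mem_halfPlane_iff] at hu
      exact hu
    have hT : ∀ u : ℂ, (translate q)⁻¹ • ((u - q : ℂ) : OnePoint ℂ) = u := fun u => by
      rw [inv_smul_eq_iff, translate_coe]
    have hTinf : (translate q)⁻¹ • (OnePoint.infty : OnePoint ℂ) = OnePoint.infty := by
      rw [inv_smul_eq_iff, translate_infty]
    have hGF : (fun z => (translate q)⁻¹ • G z) = F₁ := by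
      funext z; rw [hGdef, inv_smul_smul]
    have j1 := hφ.smul (translate q)⁻¹ (by fun_prop) hmaps fun u _ => hT u
    have j2 := hs0.smul (translate q)⁻¹ hmaps
    have j3 := hsb.smul (translate q)⁻¹ hmaps
    have j4 := hsinf.smul (translate q)⁻¹ hmaps
    have hT0 := hT q
    have hTb := hT (b + q)
    rw [sub_self] at hT0
    rw [add_sub_cancel_right] at hTb
    rw [hGF] at j1 j2 j3 j4
    rw [hT0] at j2
    rw [hTb] at j3
    rw [hTinf] at j4
    have := hL₁.eq_of_singAt hF₁ hd he'1 j1 j4 (p := b + q) (q := q)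
      (by rw [mul_add, Complex.add_re, hb', zero_add, add_zero]) (by rw [add_zero]) j3 j2
    exact hb0 (by simpa using this)
  have hmaps : MapsTo (fun u => u + q) (halfPlaneAt e) (halfPlane e s) := by
    intro u hu
    rw [hnormalize e he, ← add_mem_halfPlane_iff (q := q), k3, add_zero] at hu
    exact hu
  have hT : ∀ u : ℂ, translate q • ((u + q : ℂ) : OnePoint ℂ) = u := fun u => by
    rw [translate_coe, add_sub_cancel_right]
  have he0 : e ≠ 0 := norm_pos_iff.1 (by rw [he]; exact one_pos)
  have hlog : IsLogPoint G ((χ ∘ fun u => u + q) e) := by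
    have j1 := k1.smul (translate q) (by fun_prop) hmaps fun u _ => hT u
    have j2 := k4.smul (translate q) hmaps
    have j3 := k2.smul (translate q) hmaps
    rw [translate_coe, sub_self] at j2
    rw [translate_infty] at j3
    exact ⟨e, _, j1.eq e (self_mem_halfPlaneAt he0), he0, j1, rfl, j2, j3⟩
  have hall : {x | IsLogPoint G x} = univ :=
    (isClopen_iff.1 ⟨isClosed_isLogPoint hG, isOpen_isLogPoint hG hUG hreg⟩).resolve_left
      (Nonempty.ne_empty ⟨_, hlog⟩)
  obtain ⟨α, β, hα, h⟩ := hG.exists_eq_exp fun x => by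
    have : x ∈ {x | IsLogPoint G x} := hall ▸ mem_univ x
    exact this
  refine ⟨(translate q * toInfty p)⁻¹, α, β, hα, fun z => ?_⟩
  rw [← h, hGdef, eq_inv_smul_iff, mul_smul]

/-! ### Developing maps and the length of curves -/

/-- In a suitable isometric coordinate on the sphere, a developing map is analytic with nonvanishing
derivative, and its density has the usual expression. At poles the coordinate is `1/f`. -/
theorem exists_chart_density (hf : IsDevelopingMap f) (z : ℂ) :
    ∃ (T : GL (Fin 2) ℂ) (g : ℂ → ℂ), (∀ x y, cosDist (T • x) (T • y) = cosDist x y) ∧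
      AnalyticAt ℂ g z ∧ deriv g z ≠ 0 ∧ ∀ᶠ w in 𝓝 z, T • toSphere f w = (g w : OnePoint ℂ) ∧
        sphericalDensity f w = 2 * ‖deriv g w‖ / (1 + ‖g w‖ ^ 2) := by
  have hm := hf.meromorphic (mem_univ z)
  by_cases h0 : 0 ≤ meromorphicOrderAt f z
  · have ha := hm.meromorphicOrderAt_nonneg_iff_analyticAt.1 h0
    refine ⟨1, f, fun x y => by simp, ha, hf.deriv_ne_zero z h0, ?_⟩
    filter_upwards [ha.eventually_analyticAt] with w hw
    simp [toSphere, sphericalDensity, hw.meromorphicOrderAt_nonneg]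
  · have h1 : meromorphicOrderAt f z = -1 := by
      have h2 := hf.simple_poles z
      have hne : meromorphicOrderAt f z ≠ ⊤ := fun h => h0 (h ▸ le_top)
      lift meromorphicOrderAt f z to ℤ using hne with n hn
      rw [show (-1 : WithTop ℤ) = ((-1 : ℤ) : WithTop ℤ) from rfl, WithTop.coe_le_coe] at h2
      have h3 : ¬ 0 ≤ n := fun h => h0 (by exact_mod_cast h)
      rw [show n = -1 by lia]
      rfl
    have hi : meromorphicOrderAt f⁻¹ z = 1 := by
      rw [meromorphicOrderAt_inv, h1]
      rfl
    have ha : AnalyticAt ℂ f⁻¹ z :=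
      hm.inv.meromorphicOrderAt_nonneg_iff_analyticAt.1 (by rw [hi]; exact zero_le_one)
    have ho : analyticOrderAt f⁻¹ z = 1 := by
      rw [ha.meromorphicOrderAt_eq] at hi
      generalize analyticOrderAt f⁻¹ z = n at hi
      cases n with
      | top => simp at hi
      | coe n =>
        simp only [ENat.map_natCast] at hi
        norm_cast at hi ⊢
    have hd : deriv f⁻¹ z ≠ 0 := by
      have h2 := analyticOrderAt_deriv_of_pos ha (n := 0) (by simpa using ho)
      exact ((ha.deriv.analyticOrderAt_eq_zero).1 (by simpa using h2))
    have hz : f⁻¹ z = 0 := by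
      by_contra h
      rw [(ha.analyticOrderAt_eq_zero).2 h] at ho
      simp at ho
    refine ⟨toInfty 0, f⁻¹, cosDist_toInfty 0, ha, hd, ?_⟩
    have he : ∀ᶠ w in 𝓝[≠] z, AnalyticAt ℂ f w ∧ f w ≠ 0 :=
      hm.meromorphicAt.eventually_analyticAt.and
        ((meromorphicOrderAt_ne_top_iff_eventually_ne_zero hm.meromorphicAt).1 (by simp [h1]))
    rw [eventually_nhdsWithin_iff] at he
    filter_upwards [he] with w hw
    by_cases hwz : w = z
    · subst hwz
      simp only [toSphere, sphericalDensity, h0, if_false]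
      exact ⟨by rw [hz, toInfty_zero_infty], trivial⟩
    · obtain ⟨h2, h3⟩ := hw hwz
      have h4 : deriv f⁻¹ w = -deriv f w / f w ^ 2 := deriv_inv'' h2.differentiableAt h3
      simp only [toSphere, sphericalDensity, h2.meromorphicOrderAt_nonneg, if_true]
      refine ⟨by rw [toInfty_zero_coe h3]; rfl, ?_⟩
      have h5 : 0 < ‖f w‖ := norm_pos_iff.2 h3
      rw [h4, Pi.inv_apply, norm_div, norm_neg, norm_pow, norm_inv]
      field_simp
      ring

theorem locUniv_toSphere (hf : IsDevelopingMap f) : LocUniv (toSphere f) := by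
  intro z
  obtain ⟨T, g, -, h1, h2, h3⟩ := exists_chart_density hf z
  refine ⟨T⁻¹, g, h1, h2, h3.mono fun w hw => ?_⟩
  rw [← hw.1, inv_smul_smul]

theorem continuous_sphericalDensity (hf : IsDevelopingMap f) : Continuous (sphericalDensity f) := by
  rw [continuous_iff_continuousAt]
  intro z
  obtain ⟨T, g, -, h1, h2, h3⟩ := exists_chart_density hf z
  refine ContinuousAt.congr (f := fun w => 2 * ‖deriv g w‖ / (1 + ‖g w‖ ^ 2)) ?_
    (h3.mono fun w hw => hw.2.symm)
  exact (continuousAt_const.mul h1.deriv.continuousAt.norm).div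
    (continuousAt_const.add (h1.continuousAt.norm.pow 2)) (by positivity)

theorem sphericalDensity_nonneg (f : ℂ → ℂ) (z : ℂ) : 0 ≤ sphericalDensity f z := by
  unfold sphericalDensity
  split_ifs <;> positivity

theorem stereo_sq (x : OnePoint ℂ) :
    (stereoC x).re ^ 2 + (stereoC x).im ^ 2 + stereoR x ^ 2 = 1 := by
  have h := cosDist_self x
  simp only [cosDist, Complex.mul_re, Complex.conj_re, Complex.conj_im] at h
  linarith

theorem cosDist_coe_right (x : OnePoint ℂ) (w : ℂ) : cosDist x w =
    (2 * (stereoC x).re * w.re + 2 * (stereoC x).im * w.im +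
      stereoR x * (w.re ^ 2 + w.im ^ 2 - 1)) / (1 + (w.re ^ 2 + w.im ^ 2)) := by
  have h : ‖w‖ ^ 2 = w.re ^ 2 + w.im ^ 2 := by
    rw [← Complex.normSq_eq_norm_sq, Complex.normSq_apply]
    ring
  have hp : 1 + (w.re ^ 2 + w.im ^ 2) ≠ 0 := by positivity
  have h2 : (2 : ℂ) = ((2 : ℝ) : ℂ) := by norm_num
  rw [cosDist, stereoC_coe, stereoR_coe, h, h2]
  simp only [Complex.mul_re, Complex.conj_re, Complex.conj_im, Complex.div_ofReal_re,
    Complex.div_ofReal_im, Complex.ofReal_re, Complex.ofReal_im,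
    Complex.mul_im]
  field_simp
  ring

/-- The derivative of the cosine of the distance to a fixed point along a curve is at most the speed
of the curve times the sine of that distance. -/
theorem exists_hasDerivAt_cosDist (x : OnePoint ℂ) {w : ℝ → ℂ} {w' : ℂ} {t : ℝ}
    (hw : HasDerivAt w w' t) :
    ∃ G', HasDerivAt (fun t => cosDist x (w t)) G' t ∧
      |G'| ≤ 2 * ‖w'‖ / (1 + ‖w t‖ ^ 2) * √(1 - cosDist x (w t) ^ 2) := by
  have hre : HasDerivAt (fun t => (w t).re) w'.re t :=
    Complex.reCLM.hasFDerivAt.comp_hasDerivAt t hw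
  have him : HasDerivAt (fun t => (w t).im) w'.im t :=
    Complex.imCLM.hasFDerivAt.comp_hasDerivAt t hw
  have hp : 0 < 1 + ((w t).re ^ 2 + (w t).im ^ 2) := by positivity
  have hN := ((hre.const_mul (2 * (stereoC x).re)).add (him.const_mul (2 * (stereoC x).im))).add
    ((((hre.pow 2).add (him.pow 2)).sub_const 1).const_mul (stereoR x))
  have hG := hN.div (((hre.pow 2).add (him.pow 2)).const_add 1) hp.ne'
  have hsq := stereo_sq x
  simp only [cosDist_coe_right]
  refine ⟨_, hG, ?_⟩
  have h : ‖w t‖ ^ 2 = (w t).re ^ 2 + (w t).im ^ 2 := by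
    rw [← Complex.normSq_eq_norm_sq, Complex.normSq_apply]
    ring
  have h' : ‖w'‖ ^ 2 = w'.re ^ 2 + w'.im ^ 2 := by
    rw [← Complex.normSq_eq_norm_sq, Complex.normSq_apply]
    ring
  rw [h]
  simp only [Pi.add_apply, Pi.pow_apply]
  generalize (w t).re = p at *
  generalize (w t).im = q at *
  generalize w'.re = p' at *
  generalize w'.im = q' at *
  generalize (stereoC x).re = a at *
  generalize (stereoC x).im = b at *
  generalize stereoR x = c at *
  generalize hv : ‖w'‖ = v at *
  set S := 1 + (p ^ 2 + q ^ 2) with hS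
  set N := 2 * a * p + 2 * b * q + c * (p ^ 2 + q ^ 2 - 1) with hN'
  -- Up to the factor `2 / S ^ 2`, the derivative is the scalar product of the velocity with the
  -- vector `(P, Q)`, whose length is given by this identity.
  have key : ((a + c * p) * S - p * N) ^ 2 + ((b + c * q) * S - q * N) ^ 2 = S ^ 2 - N ^ 2 := by
    rw [hN', hS]
    linear_combination (1 + (p ^ 2 + q ^ 2)) ^ 2 * hsq
  set P := (a + c * p) * S - p * N with hP
  set Q := (b + c * q) * S - q * N with hQ
  have hnn : 0 ≤ S ^ 2 - N ^ 2 := by rw [← key]; positivity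
  have h1 : 1 - (N / S) ^ 2 = (S ^ 2 - N ^ 2) / S ^ 2 := by field_simp
  refine abs_le_of_sq_le_sq ?_ (mul_nonneg (div_nonneg (mul_nonneg zero_le_two
    (hv ▸ norm_nonneg _)) hp.le) (Real.sqrt_nonneg _))
  have h2 : (2 * a * p' + 2 * b * q' +
      c * (((2 : ℕ) : ℝ) * p ^ (2 - 1) * p' + ((2 : ℕ) : ℝ) * q ^ (2 - 1) * q')) * S -
      N * (((2 : ℕ) : ℝ) * p ^ (2 - 1) * p' + ((2 : ℕ) : ℝ) * q ^ (2 - 1) * q') =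
      2 * (p' * P + q' * Q) := by
    rw [hP, hQ]
    norm_num
    ring
  have h3 : (p' * P + q' * Q) ^ 2 ≤ v ^ 2 * (P ^ 2 + Q ^ 2) := by
    rw [h']
    have h4 : (p' ^ 2 + q' ^ 2) * (P ^ 2 + Q ^ 2) - (p' * P + q' * Q) ^ 2 =
        (p' * Q - q' * P) ^ 2 := by ring
    linarith [sq_nonneg (p' * Q - q' * P)]
  rw [h2, mul_pow, Real.sq_sqrt (by rw [h1]; positivity), h1, ← key]
  calc (2 * (p' * P + q' * Q) / S ^ 2) ^ 2 = 4 * (p' * P + q' * Q) ^ 2 / S ^ 4 := by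
        field_simp
        ring
    _ ≤ 4 * (v ^ 2 * (P ^ 2 + Q ^ 2)) / S ^ 4 := by gcongr
    _ = (2 * v / S) ^ 2 * ((P ^ 2 + Q ^ 2) / S ^ 2) := by
        field_simp
        ring

theorem abs_cosDist_le_one (x y : OnePoint ℂ) : |cosDist x y| ≤ 1 := by
  have hx := stereo_sq x
  have hy := stereo_sq y
  simp only [cosDist, Complex.mul_re, Complex.conj_re, Complex.conj_im]
  rw [abs_le]
  constructor
  · linarith [sq_nonneg ((stereoC x).re + (stereoC y).re),
      sq_nonneg ((stereoC x).im + (stereoC y).im), sq_nonneg (stereoR x + stereoR y)]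
  · linarith [sq_nonneg ((stereoC x).re - (stereoC y).re),
      sq_nonneg ((stereoC x).im - (stereoC y).im), sq_nonneg (stereoR x - stereoR y)]

/-- The speed of a curve with respect to the pulled back metric. -/
noncomputable def speed (f : ℂ → ℂ) (γ : ℝ → ℂ) (t : ℝ) : ℝ :=
  sphericalDensity f (γ t) * ‖derivWithin γ (Icc 0 1) t‖

theorem speed_nonneg (f : ℂ → ℂ) (γ : ℝ → ℂ) (t : ℝ) : 0 ≤ speed f γ t :=
  mul_nonneg (sphericalDensity_nonneg _ _) (norm_nonneg _)

theorem continuousOn_speed (hf : IsDevelopingMap f) {γ : ℝ → ℂ}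
    (hγ : ContDiffOn ℝ 1 γ (Icc 0 1)) : ContinuousOn (speed f γ) (Icc 0 1) :=
  ((continuous_sphericalDensity hf).comp_continuousOn hγ.continuousOn).mul
    (hγ.continuousOn_derivWithin (uniqueDiffOn_Icc zero_lt_one) le_rfl).norm

/-- The angular distance between the images of the end points of an arc is at most the length of
the arc. -/
theorem angDist_le_integral_speed (hf : IsDevelopingMap f) {γ : ℝ → ℂ}
    (hγ : ContDiffOn ℝ 1 γ (Icc 0 1)) {a b : ℝ} (ha : 0 ≤ a) (hab : a ≤ b) (hb : b ≤ 1) :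
    angDist (toSphere f (γ a)) (toSphere f (γ b)) ≤ ∫ t in a..b, speed f γ t := by
  set x := toSphere f (γ a)
  have hsub : Icc a b ⊆ Icc 0 1 := Icc_subset_Icc ha hb
  have hcd : ContinuousOn (fun t => cosDist x (toSphere f (γ t))) (Icc a b) :=
    (continuous_cosDist x).comp_continuousOn
      ((locUniv_toSphere hf).continuous.comp_continuousOn (hγ.continuousOn.mono hsub))
  -- Since `arccos` is not differentiable at `± 1`, the estimate is obtained for the function
  -- `arccos (κ * cosDist x ·)` with `κ < 1` first.
  have key : ∀ κ ∈ Ioo (0 : ℝ) 1, Real.arccos (κ * cosDist x (toSphere f (γ b))) -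
      Real.arccos κ ≤ ∫ t in a..b, speed f γ t := by
    rintro κ ⟨hκ0, hκ1⟩
    have hder : ∀ t ∈ Ioo a b, ∃ h', HasDerivAt
        (fun t => Real.arccos (κ * cosDist x (toSphere f (γ t)))) h' t ∧ h' ≤ speed f γ t := by
      intro t ht
      have hγt : HasDerivAt γ (derivWithin γ (Icc 0 1) t) t := by
        have h1 : t ∈ Icc (0 : ℝ) 1 := hsub (Ioo_subset_Icc_self ht)
        exact ((hγ.differentiableOn one_ne_zero t h1).hasDerivWithinAt).hasDerivAt
          (Icc_mem_nhds (ha.trans_lt ht.1) (ht.2.trans_le hb))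
      obtain ⟨T, g, hT, hg1, -, hg3⟩ := exists_chart_density hf (γ t)
      have hgt : HasDerivAt (fun s => g (γ s)) (deriv g (γ t) * derivWithin γ (Icc 0 1) t) t :=
        hg1.differentiableAt.hasDerivAt.comp t hγt
      obtain ⟨G', hG, hG'⟩ := exists_hasDerivAt_cosDist (T • x) hgt
      have he : ∀ᶠ s in 𝓝 t, cosDist x (toSphere f (γ s)) = cosDist (T • x) (g (γ s)) := by
        filter_upwards [hγt.continuousAt.eventually hg3] with s hs
        rw [← hs.1, hT]
      have hG2 := hG.congr_of_eventuallyEq he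
      rw [← he.self_of_nhds] at hG'
      set c := cosDist x (toSphere f (γ t)) with hc
      have hc1 : |c| ≤ 1 := abs_cosDist_le_one _ _
      have hκc : |κ * c| < 1 := by
        rw [abs_mul, abs_of_pos hκ0]
        exact (mul_le_of_le_one_right hκ0.le hc1).trans_lt hκ1
      have hκc' := abs_lt.1 hκc
      have hsq : 0 < 1 - (κ * c) ^ 2 := sub_pos.2 ((sq_lt_one_iff_abs_lt_one _).2 hκc)
      have hder := (Real.hasDerivAt_arccos (x := κ * c) (by linarith) (by linarith)).comp t
        (hG2.const_mul κ)
      refine ⟨_, hder, ?_⟩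
      have hle : √(1 - c ^ 2) ≤ √(1 - (κ * c) ^ 2) := by
        apply Real.sqrt_le_sqrt
        rw [mul_pow]
        have : κ ^ 2 ≤ 1 := pow_le_one₀ hκ0.le hκ1.le
        linarith [mul_le_of_le_one_left (sq_nonneg c) this]
      have hpos : 0 < √(1 - (κ * c) ^ 2) := Real.sqrt_pos.2 hsq
      have hsp : speed f γ t = 2 * ‖deriv g (γ t) * derivWithin γ (Icc 0 1) t‖ /
          (1 + ‖g (γ t)‖ ^ 2) := by
        rw [speed, hg3.self_of_nhds.2, norm_mul]
        ring
      rw [← hsp] at hG'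
      have h0 := speed_nonneg f γ t
      have h1 : |κ * G'| ≤ speed f γ t * √(1 - (κ * c) ^ 2) := by
        rw [abs_mul, abs_of_pos hκ0]
        calc κ * |G'| ≤ 1 * |G'| := by gcongr
          _ ≤ speed f γ t * √(1 - c ^ 2) := by rw [one_mul]; exact hG'
          _ ≤ _ := by gcongr
      calc -(1 / √(1 - (κ * c) ^ 2)) * (κ * G') = -(κ * G') / √(1 - (κ * c) ^ 2) := by ring
        _ ≤ speed f γ t := by
          rw [div_le_iff₀ hpos]
          exact (neg_le_abs _).trans h1
    choose! h' hh' using hder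
    have := intervalIntegral.sub_le_integral_of_hasDeriv_right_of_le hab
      (Real.continuous_arccos.comp_continuousOn (continuousOn_const.mul hcd))
      (fun t ht => (hh' t ht).1.hasDerivWithinAt)
      ((continuousOn_speed hf hγ).mono hsub).integrableOn_Icc (fun t ht => (hh' t ht).2)
    simpa [x, cosDist_self] using this
  have hlim : Tendsto (fun κ : ℝ => Real.arccos (κ * cosDist x (toSphere f (γ b))) -
      Real.arccos κ) (𝓝[<] 1) (𝓝 (angDist x (toSphere f (γ b)))) := by
    have : Continuous fun κ : ℝ => Real.arccos (κ * cosDist x (toSphere f (γ b))) -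
      Real.arccos κ := (Real.continuous_arccos.comp (continuous_id.mul continuous_const)).sub
        Real.continuous_arccos
    have h := this.tendsto 1
    simp only [one_mul, Real.arccos_one, sub_zero] at h
    exact h.mono_left nhdsWithin_le_nhds
  refine le_of_tendsto hlim ?_
  filter_upwards [Ioo_mem_nhdsLT zero_lt_one] with κ hκ using key κ hκ

theorem exists_ofReal_between {x : ℝ≥0∞} {c : ℝ} (h : x < ENNReal.ofReal c) :
    ∃ d : ℝ, x < ENNReal.ofReal d ∧ d < c := by
  obtain ⟨r, h1, h2⟩ := ENNReal.lt_iff_exists_nnreal_btwn.1 h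
  refine ⟨r, by simpa using h1, ?_⟩
  rw [← ENNReal.ofReal_coe_nnreal, ENNReal.ofReal_lt_ofReal_iff'] at h2
  exact h2.1

/-- If the diameter of the plane is smaller than `d`, any two points can be joined by a curve whose
image on the sphere is shorter than `d`. -/
theorem linked_of_sphericalDiam_lt (hf : IsDevelopingMap f) {d : ℝ}
    (hd : sphericalDiam f < ENNReal.ofReal d) : Linked (toSphere f) d := by
  intro y₁ y₂
  have h1 : sphericalDist f y₁ y₂ < ENNReal.ofReal d :=
    (le_iSup₂ (f := fun z w => sphericalDist f z w) y₁ y₂).trans_lt hd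
  simp only [sphericalDist, iInf_lt_iff] at h1
  obtain ⟨γ, hγ, h0, h1', hl⟩ := h1
  have hint : IntervalIntegrable (speed f γ) MeasureTheory.volume 0 1 :=
    ContinuousOn.intervalIntegrable (by
      rw [uIcc_of_le zero_le_one]
      exact continuousOn_speed hf hγ)
  have hlen : ∫ t in (0 : ℝ)..1, speed f γ t < d := by
    have h2 : sphericalLength f γ = ENNReal.ofReal (∫ t in Icc (0 : ℝ) 1, speed f γ t) :=
      (MeasureTheory.ofReal_integral_eq_lintegral_ofReal
        (continuousOn_speed hf hγ).integrableOn_Icc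
        (Eventually.of_forall fun t => speed_nonneg f γ t)).symm
    rw [h2, ENNReal.ofReal_lt_ofReal_iff'] at hl
    rw [intervalIntegral.integral_of_le zero_le_one, ← MeasureTheory.integral_Icc_eq_integral_Ioc]
    exact hl.1
  refine ⟨γ, hγ.continuousOn, h0, h1', fun t₁ t₂ ht1 ht12 ht2 => ?_⟩
  have ha := angDist_le_integral_speed hf hγ le_rfl ht1 (ht12.trans ht2)
  have hb := angDist_le_integral_speed hf hγ (ht1.trans ht12) ht2 le_rfl
  have hi : ∀ a b : ℝ, 0 ≤ a → a ≤ b → b ≤ 1 →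
      IntervalIntegrable (speed f γ) MeasureTheory.volume a b := fun a b h h' h'' =>
    hint.mono_set (by
      rw [uIcc_of_le h', uIcc_of_le zero_le_one]
      exact Icc_subset_Icc h h'')
  have h2 := intervalIntegral.integral_add_adjacent_intervals
    (hi 0 t₁ le_rfl ht1 (ht12.trans ht2)) (hi t₁ t₂ ht1 ht12 ht2)
  have h3 := intervalIntegral.integral_add_adjacent_intervals
    (hi 0 t₂ le_rfl (ht1.trans ht12) ht2) (hi t₂ 1 (ht1.trans ht12) ht2 le_rfl)
  have h4 : 0 ≤ ∫ t in t₁..t₂, speed f γ t :=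
    intervalIntegral.integral_nonneg ht12 fun t _ => speed_nonneg f γ t
  rw [h0] at ha
  rw [h1'] at hb
  linarith

/-- A developing map is recovered from its values on the sphere: the point at infinity and a
vanishing denominator both correspond to the value `0`. -/
theorem eq_div_of_toSphere_eq (hf : IsDevelopingMap f) {A : GL (Fin 2) ℂ} {z w : ℂ}
    (h : toSphere f z = A • (w : OnePoint ℂ)) :
    f z = (A 0 0 * w + A 0 1) / (A 1 0 * w + A 1 1) := by
  rw [smul_coe] at h
  unfold toSphere at h
  by_cases h0 : A 1 0 * w + A 1 1 = 0
  · by_cases h1 : 0 ≤ meromorphicOrderAt f z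
    · simp [ratio, h0, h1] at h
    · have h2 := hf.meromorphic (mem_univ z)
      rw [h2.meromorphicOrderAt_nonneg_iff_analyticAt] at h1
      have h3 := (meromorphicNFAt_iff_analyticAt_or.1 h2).resolve_left h1
      simp [h0, h3.2.2]
  · split_ifs at h with h1
    · simpa [ratio, h0] using h
    · simp [ratio, h0] at h

theorem isLinearFractional_div (A : GL (Fin 2) ℂ) :
    IsLinearFractional fun w => (A 0 0 * w + A 0 1) / (A 1 0 * w + A 1 1) :=
  ⟨_, _, _, _, det_entries_ne A, fun _ => rfl⟩

theorem isLinearFractional_of_toSphere_eq (hf : IsDevelopingMap f) {A : GL (Fin 2) ℂ} {α β : ℂ}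
    (hα : α ≠ 0) (h : ∀ z, toSphere f z = A • ((α * z + β : ℂ) : OnePoint ℂ)) :
    IsLinearFractional f := by
  refine ⟨A 0 0 * α, A 0 0 * β + A 0 1, A 1 0 * α, A 1 0 * β + A 1 1, ?_, fun z => ?_⟩
  · have := mul_ne_zero hα (det_entries_ne A)
    convert this using 1
    ring
  · rw [eq_div_of_toSphere_eq hf (h z)]
    ring_nf

theorem isLinearFractionalExp_of_toSphere_eq (hf : IsDevelopingMap f) {A : GL (Fin 2) ℂ} {α β : ℂ}
    (hα : α ≠ 0) (h : ∀ z, toSphere f z = A • (Complex.exp (α * z + β) : OnePoint ℂ)) :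
    IsLinearFractionalExp f :=
  ⟨_, isLinearFractional_div A, α, β, hα, fun z => eq_div_of_toSphere_eq hf (h z)⟩

/-! ### Singularities of linear-fractional maps and of exponentials -/

/-- There is no singularity over the centre of a disc in which sections through all points of the
preimage exist. -/
theorem not_forall_exists_section (hF : LocUniv (toSphere f)) (s : InverseSingularity f)
    {A : GL (Fin 2) ℂ} {b : ℂ} (hA : A • s.base = (b : OnePoint ℂ)) {η : ℝ} (hη : 0 < η)
    (h : ∀ x, ∀ c ∈ ball b η, A • toSphere f x = (c : OnePoint ℂ) →
      ∃ φ, IsSec (fun z => A • toSphere f z) (ball b η) φ ∧ φ c = x) : False := by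
  obtain ⟨x, hx⟩ := singularity_nonempty s ⟨discNhd A b η, discNhd_mem hA hη⟩
  obtain ⟨c, hc, hcx⟩ := singularity_subset s _ hx
  obtain ⟨φ, hφ, hφc⟩ := h x c hc hcx.symm
  refine not_exists_section_singularity s hA hη ⟨φ, hφ, ?_⟩
  have he := singularity_eq_component s hx
  rw [he] at hx ⊢
  exact hφ.image_eq_component (hF.smul A) isOpen_ball (convex_ball b η).isPreconnected hx hc hφc

/-- If the preimages of small discs about a point are connected, there is at most one singularity
over this point. -/
theorem singularity_eq_of_isPreconnected {s s' : InverseSingularity f} (hb : s.base = s'.base)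
    {A : GL (Fin 2) ℂ} {b : ℂ} (hA : A • s.base = (b : OnePoint ℂ))
    (h : ∀ η > 0, IsPreconnected {z | A • toSphere f z ∈ ((↑) '' ball b η : Set (OnePoint ℂ))}) :
    s = s' := by
  refine singularity_ext hb fun Ω h1 h2 => ?_
  obtain ⟨η, hη, hsub⟩ := exists_discNhd_subset hA (h1.1.mem_nhds h1.2.1)
  have hsub' := hsub η le_rfl
  have hV : ∀ t : InverseSingularity f, ∀ ht : A • t.base = (b : OnePoint ℂ),
      t.V ⟨discNhd A b η, discNhd_mem ht hη⟩ = toSphere f ⁻¹' discNhd A b η := by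
    intro t ht
    obtain ⟨x, hx⟩ := singularity_nonempty t ⟨discNhd A b η, discNhd_mem ht hη⟩
    rw [singularity_eq_component t hx]
    exact IsPreconnected.connectedComponentIn (h η hη) (singularity_subset t _ hx)
  have hA' := hb ▸ hA
  obtain ⟨x, hx⟩ := singularity_nonempty s ⟨discNhd A b η, discNhd_mem hA hη⟩
  refine ⟨x, s.mono ⟨discNhd A b η, discNhd_mem hA hη⟩ ⟨Ω, h1⟩ hsub' hx,
    s'.mono ⟨discNhd A b η, discNhd_mem hA' hη⟩ ⟨Ω, h2⟩ hsub' ?_⟩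
  rw [hV s' hA', ← hV s hA]
  exact hx

theorem card_singularity_le_two {a b : OnePoint ℂ}
    (hbase : ∀ s : InverseSingularity f, s.base = a ∨ s.base = b)
    (hinj : ∀ s s' : InverseSingularity f, s.base = s'.base → s = s') :
    ENat.card (InverseSingularity f) ≤ 2 := by
  have h := ENat.card_le_card_of_injective
    (f := fun s : InverseSingularity f => (⟨s.base, hbase s⟩ : ({a, b} : Set (OnePoint ℂ))))
    fun s s' h => hinj s s' (congrArg Subtype.val h)
  exact h.trans ((ENat.card_coe_set_eq _).trans_le ((encard_insert_le {b} a).trans_eq (by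
    rw [encard_singleton]
    rfl)))

theorem isPreconnected_affine_preimage {S : Set ℂ} (hS : IsPreconnected S) {α : ℂ} (hα : α ≠ 0)
    (β : ℂ) : IsPreconnected {z | α * z + β ∈ S} := by
  have h : {z | α * z + β ∈ S} = (fun w => (w - β) / α) '' S := by
    ext z
    constructor
    · intro hz
      refine ⟨_, hz, ?_⟩
      field_simp
      ring
    · rintro ⟨w, hw, rfl⟩
      simpa [mul_div_cancel₀ _ hα] using hw
  rw [h]
  exact hS.image _ (by fun_prop)

theorem toInfty_zero_smul_coe_mem_iff {w : ℂ} {η : ℝ} (hη : 0 < η) :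
    toInfty 0 • (w : OnePoint ℂ) ∈ ((↑) '' ball (0 : ℂ) η : Set (OnePoint ℂ)) ↔ η⁻¹ < ‖w‖ := by
  by_cases hw : w = 0
  · subst hw
    rw [toInfty_zero_zero]
    simp [hη.le]
  · rw [toInfty_zero_coe hw, OnePoint.coe_injective.mem_set_image, mem_ball_zero_iff, norm_inv,
      inv_lt_comm₀ (norm_pos_iff.2 hw) hη]

/-- The singularities of a linear-fractional map lie over the value omitted in the plane, and the
preimages of small discs about this value are connected. -/
theorem card_singularity_le_of_affine (hf : IsDevelopingMap f) {A : GL (Fin 2) ℂ} {α β : ℂ}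
    (hα : α ≠ 0) (h : ∀ z, toSphere f z = A • ((α * z + β : ℂ) : OnePoint ℂ)) :
    ENat.card (InverseSingularity f) ≤ 2 := by
  have hbase : ∀ s : InverseSingularity f, s.base = A • OnePoint.infty := by
    intro s
    induction hx : A⁻¹ • s.base using OnePoint.rec with
    | infty => rw [← hx, smul_inv_smul]
    | coe c =>
      refine (not_forall_exists_section (locUniv_toSphere hf) s hx one_pos ?_).elim
      intro x w hw hxw
      rw [h, inv_smul_smul, OnePoint.coe_eq_coe] at hxw
      refine ⟨fun w => (w - β) / α, ⟨by fun_prop, fun v _ => ?_⟩, ?_⟩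
      · simp only [h, inv_smul_smul]
        rw [mul_div_cancel₀ _ hα, sub_add_cancel]
      · simp only [← hxw, add_sub_cancel_right, mul_div_cancel_left₀ _ hα]
  refine card_singularity_le_two (b := A • OnePoint.infty) (fun s => Or.inl (hbase s))
    fun s s' hs => ?_
  refine singularity_eq_of_isPreconnected (A := toInfty 0 * A⁻¹) (b := 0) hs
    (by rw [hbase s, mul_smul, inv_smul_smul, toInfty_zero_infty]) fun η hη => ?_
  simp only [h, mul_smul, inv_smul_smul, toInfty_zero_smul_coe_mem_iff hη]
  exact isPreconnected_affine_preimage (isPreconnected_norm_gt (inv_pos.2 hη)) hα β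

/-- The singularities of a linear-fractional transformation of the exponential lie over its two
omitted values, one over each of them, as the preimages of small discs are half-planes. -/
theorem card_singularity_le_of_exp (hf : IsDevelopingMap f) {A : GL (Fin 2) ℂ} {α β : ℂ}
    (hα : α ≠ 0) (h : ∀ z, toSphere f z = A • (Complex.exp (α * z + β) : OnePoint ℂ)) :
    ENat.card (InverseSingularity f) ≤ 2 := by
  have hbase : ∀ s : InverseSingularity f,
      s.base = A • OnePoint.infty ∨ s.base = A • ((0 : ℂ) : OnePoint ℂ) := by
    intro s
    induction hx : A⁻¹ • s.base using OnePoint.rec with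
    | infty => left; rw [← hx, smul_inv_smul]
    | coe c =>
      rcases eq_or_ne c 0 with rfl | hc
      · right; rw [← hx, smul_inv_smul]
      refine (not_forall_exists_section (locUniv_toSphere hf) s hx (norm_pos_iff.2 hc) ?_).elim
      intro x w hw hxw
      rw [h, inv_smul_smul, OnePoint.coe_eq_coe] at hxw
      have hslit : ∀ v ∈ ball c ‖c‖, v / c ∈ Complex.slitPlane := by
        intro v hv
        refine Complex.ball_one_subset_slitPlane ?_
        rw [mem_ball, dist_eq_norm] at hv ⊢
        rw [div_sub_one hc, norm_div]
        exact (div_lt_one (norm_pos_iff.2 hc)).2 hv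
      have hne : ∀ v ∈ ball c ‖c‖, v / c ≠ 0 := fun v hv => Complex.slitPlane_ne_zero (hslit v hv)
      refine ⟨fun v => (α * x + (Complex.log (v / c) - Complex.log (w / c))) / α, ⟨?_, ?_⟩, ?_⟩
      · exact (continuousOn_const.add (((continuousOn_id.div_const c).clog hslit).sub
          continuousOn_const)).div_const α
      · intro v hv
        simp only [h, inv_smul_smul]
        rw [mul_div_cancel₀ _ hα, add_right_comm, Complex.exp_add, hxw, Complex.exp_sub,
          Complex.exp_log (hne v hv), Complex.exp_log (hne w hw),
          div_div_div_cancel_right₀ hc, mul_div_cancel₀]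
        rintro rfl
        exact hne 0 hw (zero_div c)
      · simp only [sub_self, add_zero, mul_div_cancel_left₀ _ hα]
  refine card_singularity_le_two hbase fun s s' hs => ?_
  rcases hbase s with h1 | h1
  · refine singularity_eq_of_isPreconnected (A := toInfty 0 * A⁻¹) (b := 0) hs
      (by rw [h1, mul_smul, inv_smul_smul, toInfty_zero_infty]) fun η hη => ?_
    simp only [h, mul_smul, inv_smul_smul, toInfty_zero_smul_coe_mem_iff hη, Complex.norm_exp,
      ← Real.log_lt_iff_lt_exp (inv_pos.2 hη)]
    exact isPreconnected_affine_preimage (convex_halfSpace_re_gt _).isPreconnected hα β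
  · refine singularity_eq_of_isPreconnected (A := A⁻¹) (b := 0) hs
      (by rw [h1, inv_smul_smul]) fun η hη => ?_
    simp only [h, inv_smul_smul, OnePoint.coe_injective.mem_set_image, mem_ball_zero_iff,
      Complex.norm_exp, ← Real.lt_log_iff_exp_lt hη]
    exact isPreconnected_affine_preimage (convex_halfSpace_re_lt _).isPreconnected hα β

end SphericalMetric

theorem theorem3 (f : ℂ → ℂ) (hf : IsDevelopingMap f) :
    (¬ IsLinearFractional f → ¬ IsLinearFractionalExp f →
      ENNReal.ofReal (4 * Real.pi / 3) ≤ sphericalDiam f) ∧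
    ((∃ s : InverseSingularity f, ¬ s.IsIsolated) →
      ENNReal.ofReal (2 * Real.pi) ≤ sphericalDiam f) ∧
    ((∀ s : InverseSingularity f, s.IsIsolated) → 3 ≤ ENat.card (InverseSingularity f) →
      ENNReal.ofReal (4 * Real.pi / 3) ≤ sphericalDiam f) := by
  have hF := SphericalMetric.locUniv_toSphere hf
  refine ⟨fun h1 h2 => ?_, fun ⟨s, hs⟩ => ?_, fun _ hcard => ?_⟩
  · by_contra! hlt
    obtain ⟨d, hd, hlt'⟩ := SphericalMetric.exists_ofReal_between hlt
    rcases (SphericalMetric.linked_of_sphericalDiam_lt hf hd).exists_eq hF hlt' with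
      ⟨A, α, β, hα, h⟩ | ⟨A, α, β, hα, h⟩
    · exact h1 (SphericalMetric.isLinearFractional_of_toSphere_eq hf hα h)
    · exact h2 (SphericalMetric.isLinearFractionalExp_of_toSphere_eq hf hα h)
  · by_contra! hlt
    obtain ⟨d, hd, hlt'⟩ := SphericalMetric.exists_ofReal_between hlt
    exact hs ((SphericalMetric.linked_of_sphericalDiam_lt hf hd).isIsolated hF hlt' s)
  · by_contra! hlt
    obtain ⟨d, hd, hlt'⟩ := SphericalMetric.exists_ofReal_between hlt
    have hle : ENat.card (InverseSingularity f) ≤ 2 := by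
      rcases (SphericalMetric.linked_of_sphericalDiam_lt hf hd).exists_eq hF hlt' with
        ⟨A, α, β, hα, h⟩ | ⟨A, α, β, hα, h⟩
      · exact SphericalMetric.card_singularity_le_of_affine hf hα h
      · exact SphericalMetric.card_singularity_le_of_exp hf hα h
    exact absurd (hcard.trans hle) (by decide)
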